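/- **Model.** Let $\mathcal S$ be a finite set of seller operators and $\mathcal B$ a set of buyer operators. Seller $s$ owns finitely many licensed sub-bands. Each sub-band $l_s$ of $s$ is leased by a finite set of buyers, and $Q_{l_s}$ consists of $s$ and these buyers. Let $\alpha>2$ be the path loss exponent, $P^{\rm S}>0$ the transmit power of every seller base station (BS), $\sigma^2\ge 0$ the noise power and $\zeta_s>0$ the interference threshold of $s$. The BSs of operator $k$ form a homogeneous Poisson process $\Phi_k$ of intensity $\lambda_k>0$ in $\mathbb R^2$, and the users of seller $s$ a homogeneous Poisson process $\Psi_s$ of intensity $\mu_s>0$. All channel gains are exponential with mean $1$. The maximum power that a buyer BS at a point $x\in\mathbb R^2$ may use on $l_s$ is $P^{\rm B}_{l_s}=\zeta_s/H_{l_s}$ with $H_{l_s}=\sup_{y_i\in\Psi_s}h_{i,l_s}\|x-y_i\|^{-\alpha}$, where the $h_{i,l_s}$ are its channel gains to the users of $s$, independent of each other and of $\Psi_s$; the law of $P^{\rm B}_{l_s}$ does not depend on $x$. The transmit powers $P_{f,l_s}$ of the BSs $f$ of the buyers in $Q_{l_s}$ are distributed as $P^{\rm B}_{l_s}$. For each sub-band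 $l_s$, the processes $\Phi_k$ of $s$ and of the buyers, the transmit powers $P_{f,l_s}$ and the channel gains $h_{f,l_s}$ between the BSs and the typical user are mutually independent. A typical user of buyer $b$ is at the origin, and $x_f$ is the distance of BS $f$ from it. On a sub-band $l_s$ with $b\in Q_{l_s}$ it is served by the BS $0$ of $b$ that maximizes the average received power $P_{f,l_s}x_f^{-\alpha}$ (almost surely unique), and with $\mathcal F_k$ the set of BSs of operator $k$ its SINR is $$\gamma_{b,l_s}=\frac{P_{0,l_s}h_{0,l_s}x_0^{-\alpha}}{I_{b,l_s}+\sigma^2},\qquad I_{b,l_s}=\sum_{f\in\mathcal F_b\setminus\{0\}}P_{f,l_s}h_{f,l_s}x_f^{-\alpha}+\sum_{f\in\mathcal F_s}P^{\rm S}h_{f,l_s}x_f^{-\alpha}+\sum_{k\in Q_{l_s}\setminus\{s,b\}}\sum_{f\in\mathcal F_k}P_{f,l_s}h_{f,l_s}x_f^{-\alpha}.$$ The average rate of this user is $$\mathcal R_b=\sum_{l_s:\,b\in Q_{l_s}}\mathbb E_{P}\big[\mathbb E_{\gamma}[\ln(1+\gamma_{b,l_s})]\big],$$ where $\mathbb E_\gamma$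 (and $\mathbb P$ below) refers to the conditional law of $\gamma_{b,l_s}$ given the transmit powers of the buyer BSs on $l_s$, and $\mathbb E_P$ to the law of these powers. **Theorem.** Let $m_{l_s}=\mathbb E[(P^{\rm B}_{l_s})^{2/\alpha}]$, $\lambda_{b,l_s}=\sum_{k\in Q_{l_s}\setminus\{s,b\}}\lambda_k$, $\rho(\alpha,\beta)=\int_{\beta^{-2/\alpha}}^\infty\frac{d\nu}{1+\nu^{\alpha/2}}$, $\rho(\alpha,\infty)=\int_0^\infty\frac{d\nu}{1+\nu^{\alpha/2}}$, and $$\mathcal L_{b,l_s}(\beta,\kappa)=\exp\!\Big(-\pi\kappa^{2/\alpha}\big[\lambda_b m_{l_s}\rho(\alpha,\beta)+\lambda_s(P^{\rm S})^{2/\alpha}\rho(\alpha,\infty)+\lambda_{b,l_s}m_{l_s}\rho(\alpha,\infty)\big]\Big).$$ Then, with all expectations and integrals finite, for every buyer $b$ $$\mathcal R_b=\sum_{l_s:\,b\in Q_{l_s}}\mathbb E_P\Big[\int_0^\infty\mathbb P\big[\ln(1+\gamma_{b,l_s})>t\big]\,dt\Big]$$ $$=\sum_{l_s:\,b\in Q_{l_s}}\int_0^\infty\!\int_0^\infty\pi\lambda_b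 m_{l_s}\,e^{-(e^t-1)\sigma^2z^{\alpha/2}}\,e^{-\pi\lambda_b m_{l_s}z}\,\mathcal L_{b,l_s}\big(e^t-1,\,(e^t-1)z^{\alpha/2}\big)\,dz\,dt.$$ -/

import Mathlib

open MeasureTheory ProbabilityTheory Set
open scoped ENNReal

namespace SpectrumSharing

/-- The Euclidean plane. -/
abbrev Plane : Type := EuclideanSpace ℝ (Fin 2)

/-- The number of points of the sequence `X` that lie in `A`. -/
noncomputable def pointCount {Ω : Type*} (X : ℕ → Ω → Plane) (A : Set Plane) (ω : Ω) : ℝ≥0∞ :=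
  ∑' n, A.indicator 1 (X n ω)

/-- The points `X 0, X 1, …` form a homogeneous Poisson point process of intensity `lam` in the
plane: the number of points in a set of finite area is Poisson with mean `lam` times the area, and
the numbers of points in finitely many disjoint sets are independent. -/
structure IsHomogeneousPPP {Ω : Type*} [MeasurableSpace Ω] (P : Measure Ω)
    (lam : ℝ) (X : ℕ → Ω → Plane) : Prop where
  measurable : ∀ n, Measurable (X n)
  count_law : ∀ A : Set Plane, MeasurableSet A → volume A ≠ ∞ →
    HasLaw (pointCount X A)
      ((poissonMeasure (lam.toNNReal * (volume A).toNNReal)).map (fun k : ℕ => (k : ℝ≥0∞))) P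
  count_indep : ∀ (m : ℕ) (A : Fin m → Set Plane), (∀ i, MeasurableSet (A i)) →
    Pairwise (fun i j => Disjoint (A i) (A j)) → iIndepFun (fun i => pointCount X (A i)) P

/-- The parameters of a network with seller operators `S` and buyer operators `B`. -/
structure Params (S B : Type*) where
  /-- path loss exponent -/
  α : ℝ
  /-- transmit power of the base stations of the sellers -/
  PS : ℝ
  /-- square root of the noise power -/
  σ : ℝ
  /-- number of licensed sub-bands of each seller -/
  numBands : S → ℕ
  /-- the buyers that lease a given sub-band of a given seller -/
  lessees : (Σ s : S, Fin (numBands s)) → Finset B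
  /-- intensity of the base stations of each seller -/
  lamS : S → ℝ
  /-- intensity of the base stations of each buyer -/
  lamB : B → ℝ
  /-- intensity of the users of each seller -/
  muS : S → ℝ
  /-- maximum interference threshold of each seller -/
  ζ : S → ℝ
  α_gt : 2 < α
  PS_pos : 0 < PS
  lamS_pos : ∀ s, 0 < lamS s
  lamB_pos : ∀ b, 0 < lamB b
  muS_pos : ∀ s, 0 < muS s
  ζ_pos : ∀ s, 0 < ζ s

/-- The licensed sub-bands: a seller together with one of its sub-bands. -/
abbrev Params.Band {S B : Type*} (N : Params S B) : Type _ := Σ s : S, Fin (N.numBands s)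

/-- The random variables of the network, seen from a typical buyer user at the origin. -/
structure Network {S B : Type*} (N : Params S B) (Ω : Type*) where
  /-- locations of the base stations of the sellers -/
  siteS : S → ℕ → Ω → Plane
  /-- locations of the base stations of the buyers -/
  siteB : B → ℕ → Ω → Plane
  /-- channel gain between the typical user and a base station of the seller owning the sub-band -/
  gainS : N.Band → ℕ → Ω → ℝ
  /-- channel gain between the typical user and a base station of a buyer on the sub-band -/
  gainB : N.Band → B → ℕ → Ω → ℝ
  /-- transmit power of a base station of a buyer on the sub-band -/
  powB : N.Band → B → ℕ → Ω → ℝ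
  /-- locations of the users of the sellers -/
  userS : S → ℕ → Ω → Plane
  /-- location of an arbitrary buyer base station -/
  refSite : Plane
  /-- channel gain between that base station and the users of the seller owning the sub-band -/
  refGain : N.Band → ℕ → Ω → ℝ

section

variable {S B Ω : Type*} {N : Params S B}

/-- The largest interference channel gain from an arbitrary buyer base station to the users of the
seller that owns the sub-band `l`. -/
noncomputable def Network.refH (R : Network N Ω) (l : N.Band) (ω : Ω) : ℝ :=
  ⨆ i, R.refGain l i ω * ‖R.refSite - R.userS l.1 i ω‖ ^ (-N.α)

/-- The maximum power at which that base station may transmit on the sub-band `l`. -/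
noncomputable def Network.refPow (R : Network N Ω) (l : N.Band) (ω : Ω) : ℝ :=
  N.ζ l.1 / R.refH l ω

/-- The sources of randomness on one sub-band. -/
inductive Source (B : Type*) where
  | sellerSites : Source B
  | buyerSites : B → Source B
  | sellerGain : ℕ → Source B
  | buyerGain : B → ℕ → Source B
  | buyerPower : B → ℕ → Source B

/-- The σ-algebra generated by each source of randomness on the sub-band `l`. -/
@[reducible] def Network.sourceSigma (R : Network N Ω) (l : N.Band) : Source B → MeasurableSpace Ω
  | .sellerSites => MeasurableSpace.comap (fun ω n => R.siteS l.1 n ω) inferInstance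
  | .buyerSites k => MeasurableSpace.comap (fun ω n => R.siteB k n ω) inferInstance
  | .sellerGain n => MeasurableSpace.comap (R.gainS l n) inferInstance
  | .buyerGain k n => MeasurableSpace.comap (R.gainB l k n) inferInstance
  | .buyerPower k n => MeasurableSpace.comap (R.powB l k n) inferInstance

/-- The σ-algebras generated by the users of the seller owning `l` (`none`) and by the channel
gains between them and the reference buyer base station (`some i`). -/
@[reducible] def Network.refSigma (R : Network N Ω) (l : N.Band) : Option ℕ → MeasurableSpace Ω
  | none => MeasurableSpace.comap (fun ω n => R.userS l.1 n ω) inferInstance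
  | some i => MeasurableSpace.comap (R.refGain l i) inferInstance

/-- The probabilistic model: Poisson base stations and users, Rayleigh fading with unit mean,
transmit powers of the buyer base stations distributed as the maximum allowed power of an arbitrary
buyer base station, and on every sub-band independence of all sources of randomness. -/
structure Network.IsModel [MeasurableSpace Ω] (R : Network N Ω) (P : Measure Ω) : Prop where
  siteS_ppp : ∀ s, IsHomogeneousPPP P (N.lamS s) (R.siteS s)
  siteB_ppp : ∀ k, IsHomogeneousPPP P (N.lamB k) (R.siteB k)
  userS_ppp : ∀ s, IsHomogeneousPPP P (N.muS s) (R.userS s)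
  gainS_meas : ∀ l n, Measurable (R.gainS l n)
  gainS_law : ∀ l n, HasLaw (R.gainS l n) (expMeasure 1) P
  gainB_meas : ∀ l k n, Measurable (R.gainB l k n)
  gainB_law : ∀ l, ∀ k ∈ N.lessees l, ∀ n, HasLaw (R.gainB l k n) (expMeasure 1) P
  refGain_meas : ∀ l i, Measurable (R.refGain l i)
  refGain_law : ∀ l i, HasLaw (R.refGain l i) (expMeasure 1) P
  powB_meas : ∀ l k n, Measurable (R.powB l k n)
  powB_law : ∀ l, ∀ k ∈ N.lessees l, ∀ n, IdentDistrib (R.powB l k n) (R.refPow l) P P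
  indep : ∀ l, iIndep (R.sourceSigma l) P
  ref_indep : ∀ l, iIndep (R.refSigma l) P

/-- Average (over the fading) power received at the origin on the sub-band `l` from the `n`-th base
station of buyer `k`. -/
noncomputable def Network.avgRecv (R : Network N Ω) (l : N.Band) (k : B) (n : ℕ) (ω : Ω) : ℝ :=
  R.powB l k n ω * ‖R.siteB k n ω‖ ^ (-N.α)

/-- The base station of buyer `b` that serves the typical user on the sub-band `l`: the one with
maximum average received power (almost surely there is exactly one). -/
noncomputable def Network.serving (R : Network N Ω) (l : N.Band) (b : B) (ω : Ω) : ℕ :=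
  sInf {n | ∀ m, R.avgRecv l b m ω ≤ R.avgRecv l b n ω}

/-- Power received at the origin on the sub-band `l` from the `n`-th base station of buyer `k`. -/
noncomputable def Network.recvB (R : Network N Ω) (l : N.Band) (k : B) (n : ℕ) (ω : Ω) : ℝ :=
  R.powB l k n ω * R.gainB l k n ω * ‖R.siteB k n ω‖ ^ (-N.α)

/-- Power received at the origin on the sub-band `l` from the `n`-th base station of its owner. -/
noncomputable def Network.recvS (R : Network N Ω) (l : N.Band) (n : ℕ) (ω : Ω) : ℝ :=
  N.PS * R.gainS l n ω * ‖R.siteS l.1 n ω‖ ^ (-N.α)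

variable [DecidableEq B]

/-- Interference experienced by the typical user of buyer `b` on the sub-band `l`. -/
noncomputable def Network.interference (R : Network N Ω) (l : N.Band) (b : B) (ω : Ω) : ℝ :=
  (∑' n, if n = R.serving l b ω then 0 else R.recvB l b n ω)
    + (∑' n, R.recvS l n ω)
    + ∑ k ∈ (N.lessees l).erase b, ∑' n, R.recvB l k n ω

/-- Signal-to-interference-plus-noise ratio of the typical user of buyer `b` on the sub-band `l`. -/
noncomputable def Network.sinr (R : Network N Ω) (l : N.Band) (b : B) (ω : Ω) : ℝ :=
  R.recvB l b (R.serving l b ω) ω / (R.interference l b ω + N.σ ^ 2)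

/-- The collection of all transmit powers of buyer base stations on the sub-band `l`. -/
def Network.powers (R : Network N Ω) (l : N.Band) (ω : Ω) : B → ℕ → ℝ :=
  fun k n => R.powB l k n ω

/-- The conditional law of the SINR on the sub-band `l` given the transmit powers there. -/
noncomputable def Network.sinrLaw [MeasurableSpace Ω] (R : Network N Ω) (P : Measure Ω)
    [IsFiniteMeasure P] (l : N.Band) (b : B) : Kernel (B → ℕ → ℝ) ℝ :=
  condDistrib (R.sinr l b) (R.powers l) P

/-- The law of the transmit powers on the sub-band `l`. -/
noncomputable def Network.powerLaw [MeasurableSpace Ω] (R : Network N Ω) (P : Measure Ω)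
    (l : N.Band) : Measure (B → ℕ → ℝ) :=
  P.map (R.powers l)

/-- The average rate of the typical user of buyer `b`: the sum, over the sub-bands leased by `b`, of
the expectation over the powers of the expectation over the SINR of `ln (1 + SINR)`. -/
noncomputable def Network.averageRate [Fintype S] [MeasurableSpace Ω] (R : Network N Ω)
    (P : Measure Ω) [IsFiniteMeasure P] (b : B) : ℝ :=
  ∑ l : N.Band with b ∈ N.lessees l,
    ∫ p, (∫ γ, Real.log (1 + γ) ∂(R.sinrLaw P l b p)) ∂(R.powerLaw P l)

/-- The expectation of the `2 / α`-th power of the transmit power of a buyer base station on `l`. -/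
noncomputable def Network.powMoment [MeasurableSpace Ω] (R : Network N Ω) (P : Measure Ω)
    (l : N.Band) : ℝ :=
  ∫ ω, R.refPow l ω ^ (2 / N.α) ∂P

/-- The function `ρ(α, β)`. -/
noncomputable def rho (α β : ℝ) : ℝ :=
  ∫ ν in Ioi (β ^ (-2 / α)), 1 / (1 + ν ^ (α / 2))

/-- The constant `ρ(α, ∞)`. -/
noncomputable def rhoInf (α : ℝ) : ℝ :=
  ∫ ν in Ioi (0 : ℝ), 1 / (1 + ν ^ (α / 2))

/-- The total intensity of the base stations of the buyers other than `b` that lease `l`. -/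
def otherIntensity (N : Params S B) (l : N.Band) (b : B) : ℝ :=
  ∑ k ∈ (N.lessees l).erase b, N.lamB k

/-- The expression for the Laplace transform of the interference at `κ`, for SINR threshold `β`. -/
noncomputable def Network.laplaceI [MeasurableSpace Ω] (R : Network N Ω) (P : Measure Ω)
    (l : N.Band) (b : B) (β κ : ℝ) : ℝ :=
  Real.exp (-(Real.pi * N.lamB b * R.powMoment P l * κ ^ (2 / N.α) * rho N.α β))
    * Real.exp (-(Real.pi * N.lamS l.1 * N.PS ^ (2 / N.α) * κ ^ (2 / N.α) * rhoInf N.α))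
    * Real.exp (-(Real.pi * otherIntensity N l b * R.powMoment P l * κ ^ (2 / N.α) * rhoInf N.α))

/-- The integrand of the coverage probability at SINR threshold `β`. -/
noncomputable def Network.coverageIntegrand [MeasurableSpace Ω] (R : Network N Ω) (P : Measure Ω)
    (l : N.Band) (b : B) (β z : ℝ) : ℝ :=
  Real.pi * N.lamB b * R.powMoment P l
    * Real.exp (-(β * N.σ ^ 2 * z ^ (N.α / 2)))
    * Real.exp (-(Real.pi * N.lamB b * R.powMoment P l * z))
    * R.laplaceI P l b β (β * z ^ (N.α / 2))

end

end SpectrumSharing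

/-! Averaging the conditional rate over the powers returns the plain expectation of `ln (1 + γ)`
(`integral_condDistrib_comp`). The powers may therefore be treated as independent marks of the base
stations instead of being held fixed. By the layer-cake formula this expectation is the integral
over `t` of the probability that `γ > e ^ t - 1`. What remains is a coverage probability
(`Network.IsModel.measure_lt_esinr`) and the finiteness of all quantities.

A base station with power `p` at distance `x` is sent to the point `u = p ^ (-2/α) * x ^ 2` of the
half-line, so that its mean received power is `u ^ (-α/2)` and the serving station is the smallest
point. Squared distance carries area to `π` times length, and dilation by `p ^ (-2/α)` multiplies
the intensity by `p ^ (2/α)`. Hence the images have the Laplace functional of a Poisson process of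
constant intensity `c = π λ E[p ^ (2/α)]` (`IsHomogeneousPPP.hasPoissonLaplace_lossPoint`). Nothing
but this functional is used about them afterwards.

The smallest point has density `c * e ^ (-c z)`, and the other points are Poisson beyond it. Both
facts are drawn from the Laplace functional by a reduced Campbell formula on small cells
(`HasPoissonLaplace.lintegral_tsum_indicator`) and a refinement of the cells
(`HasPoissonLaplace.lintegral_tsum_min`). An exponential gain exceeds a level `Y` with probability
`e ^ (-Y)`, which turns coverage into a Laplace transform of the interference
(`HasPoissonLaplace.lintegral_coverage`). An interferer at `u` contributes the factor `1 / (1 + κ u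
^ (-α/2))` with `κ = β z ^ (α/2)`. Integration over `u > z` gives `ρ(α, β)` for the buyer's own
network, and integration over `u > 0` gives `ρ(α, ∞)` for the seller and the other buyers.

For finiteness, the maximum power to the `2/α` is bounded by a multiple of every image point of the
users, and the smallest of these has an exponential tail. The interference of the seller alone makes
the coverage at threshold `e ^ t - 1` decay like `e ^ (-2t/α)`, even without noise. All transforms
are computed in `[0, ∞]`, where no summability is needed. The real-valued SINR is identified at the
end, almost surely (`Network.IsModel.ae_sinr_eq`). -/

namespace SpectrumSharing

open Filter Topology

/-! ### Laplace transforms of variables with values in `[0, ∞]`. -/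

/-- The function `x ↦ exp (-x)` on `[0, ∞]`. -/
noncomputable def negExp (x : ℝ≥0∞) : ℝ≥0∞ := EReal.exp (-(x : EReal))

/-- The inverse of `negExp` on `[0, 1]`. -/
noncomputable def negLog (x : ℝ≥0∞) : ℝ≥0∞ := (-(ENNReal.log x)).toENNReal

@[simp] lemma negExp_zero : negExp 0 = 1 := by simp [negExp]

@[simp] lemma negExp_top : negExp ∞ = 0 := by simp [negExp]

lemma negExp_add (x y : ℝ≥0∞) : negExp (x + y) = negExp x * negExp y := by
  have h : -((x + y : ℝ≥0∞) : EReal) = -(x : EReal) + -(y : EReal) := by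
    rw [EReal.coe_ennreal_add, EReal.neg_add (Or.inl (EReal.coe_ennreal_ne_bot x))
      (Or.inr (EReal.coe_ennreal_ne_bot y)), sub_eq_add_neg]
  rw [negExp, h, EReal.exp_add]; rfl

lemma negExp_ofReal {x : ℝ} (hx : 0 ≤ x) :
    negExp (ENNReal.ofReal x) = ENNReal.ofReal (Real.exp (-x)) := by
  rw [negExp, EReal.coe_ennreal_ofReal, max_eq_left hx, ← EReal.coe_neg, EReal.exp_coe]

lemma antitone_negExp : Antitone negExp := fun x y h => by
  unfold negExp
  exact EReal.exp_monotone (EReal.neg_le_neg_iff.2 (EReal.coe_ennreal_le_coe_ennreal_iff.2 h))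

lemma negExp_le_one (x : ℝ≥0∞) : negExp x ≤ 1 := by
  simpa using antitone_negExp (zero_le : 0 ≤ x)

lemma negExp_ne_top (x : ℝ≥0∞) : negExp x ≠ ∞ :=
  ne_top_of_le_ne_top ENNReal.one_ne_top (negExp_le_one x)

lemma continuous_negExp : Continuous negExp :=
  ENNReal.continuous_exp.comp (continuous_neg.comp continuous_coe_ennreal_ereal)

@[fun_prop] lemma measurable_negExp : Measurable negExp := continuous_negExp.measurable

@[fun_prop] lemma measurable_negLog : Measurable negLog := by
  unfold negLog
  have := ENNReal.measurable_log
  fun_prop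

lemma negExp_negLog {x : ℝ≥0∞} (hx : x ≤ 1) : negExp (negLog x) = x := by
  rw [negExp, negLog, EReal.coe_toENNReal, neg_neg, ENNReal.exp_log]
  exact EReal.neg_nonneg.2 (ENNReal.log_le_zero_iff.2 hx)

lemma negExp_eq_zero_iff {x : ℝ≥0∞} : negExp x = 0 ↔ x = ∞ := by
  simp [negExp]

lemma negExp_sum {ι : Type*} (s : Finset ι) (f : ι → ℝ≥0∞) :
    negExp (∑ i ∈ s, f i) = ∏ i ∈ s, negExp (f i) := by
  classical
  induction s using Finset.induction_on with
  | empty => simp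
  | insert i s hi ih => rw [Finset.sum_insert hi, Finset.prod_insert hi, negExp_add, ih]

lemma negExp_nat_mul (n : ℕ) (x : ℝ≥0∞) : negExp (n * x) = negExp x ^ n := by
  induction n with
  | zero => simp
  | succ n ih => rw [Nat.cast_succ, add_mul, one_mul, negExp_add, ih, pow_succ]

lemma negExp_injective : Function.Injective negExp := fun x y h => by
  have := EReal.exp_strictMono.injective h
  simpa using this

lemma tendsto_lintegral_negExp {Ω : Type*} [MeasurableSpace Ω] {P : Measure Ω}
    [IsFiniteMeasure P] {F : ℕ → Ω → ℝ≥0∞} {f : Ω → ℝ≥0∞} (hF : ∀ n, Measurable (F n))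
    (h : ∀ᵐ ω ∂P, Tendsto (fun n => F n ω) atTop (𝓝 (f ω))) :
    Tendsto (fun n => ∫⁻ ω, negExp (F n ω) ∂P) atTop (𝓝 (∫⁻ ω, negExp (f ω) ∂P)) := by
  refine tendsto_lintegral_of_dominated_convergence (fun _ => 1)
    (fun n => measurable_negExp.comp (hF n)) (fun n => ae_of_all _ fun ω => negExp_le_one _)
    (by simp) ?_
  filter_upwards [h] with ω hω
  exact (continuous_negExp.tendsto _).comp hω

/-- Independence factors the transform of each partial sum, and dominated convergence passes to the
limit because `negExp` is bounded by one. The product is written as `negExp` of a sum of `negLog`s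
so that, with random parameters, it is again a Laplace functional. -/
lemma lintegral_negExp_tsum_of_iIndepFun {Ω : Type*} [MeasurableSpace Ω] {P : Measure Ω}
    [IsProbabilityMeasure P] {W : ℕ → Ω → ℝ≥0∞} (hW : ∀ n, Measurable (W n))
    (hind : iIndepFun W P) :
    ∫⁻ ω, negExp (∑' n, W n ω) ∂P = negExp (∑' n, negLog (∫⁻ ω, negExp (W n ω) ∂P)) := by
  have h1 : ∀ n, ∫⁻ ω, negExp (W n ω) ∂P ≤ 1 := fun n => by
    calc _ ≤ ∫⁻ _, 1 ∂P := lintegral_mono fun ω => negExp_le_one _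
      _ = 1 := by simp
  have hpart : ∀ N, ∫⁻ ω, negExp (∑ n ∈ Finset.range N, W n ω) ∂P
      = negExp (∑ n ∈ Finset.range N, negLog (∫⁻ ω, negExp (W n ω) ∂P)) := fun N => by
    simp_rw [negExp_sum]
    have hi : iIndepFun (fun (n : Finset.range N) ω => negExp (W n ω)) P :=
      (hind.precomp Subtype.val_injective).comp (fun _ => negExp) fun _ => measurable_negExp
    have := lintegral_prod_eq_prod_lintegral_of_indepFun Finset.univ _ hi
      fun n => measurable_negExp.comp (hW n)
    simp only [Finset.univ_eq_attach] at this
    have e1 : ∀ ω, ∏ n ∈ (Finset.range N).attach, negExp (W n ω)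
      = ∏ n ∈ Finset.range N, negExp (W n ω) := fun ω =>
        Finset.prod_attach (Finset.range N) fun n => negExp (W n ω)
    rw [Finset.prod_attach (Finset.range N) fun n => ∫⁻ ω, negExp (W n ω) ∂P] at this
    simp only [e1] at this
    rw [this]
    exact Finset.prod_congr rfl fun n _ => (negExp_negLog (h1 n)).symm
  refine tendsto_nhds_unique (f := fun N => ∫⁻ ω, negExp (∑ n ∈ Finset.range N, W n ω) ∂P)
    (l := atTop) (tendsto_lintegral_negExp (fun N => by fun_prop) (ae_of_all _ fun ω => ENNReal.tendsto_nat_tsum _)) ?_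
  simp_rw [hpart]
  exact (continuous_negExp.tendsto _).comp (ENNReal.tendsto_nat_tsum _)

/-- Freezing one of two independent variables: `ω'` plays the role of an independent copy, which
replaces conditioning throughout. -/
lemma lintegral_of_indepFun {Ω E F : Type*} [MeasurableSpace Ω] [MeasurableSpace E]
    [MeasurableSpace F] {P : Measure Ω} [IsProbabilityMeasure P] {X : Ω → E} {Y : Ω → F}
    (hX : Measurable X) (hY : Measurable Y) (h : IndepFun X Y P) {f : E → F → ℝ≥0∞}
    (hf : Measurable (Function.uncurry f)) :
    ∫⁻ ω, f (X ω) (Y ω) ∂P = ∫⁻ ω, ∫⁻ ω', f (X ω) (Y ω') ∂P ∂P := by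
  have hm := (indepFun_iff_map_prod_eq_prod_map_map hX.aemeasurable hY.aemeasurable).1 h
  have : IsProbabilityMeasure (P.map Y) := Measure.isProbabilityMeasure_map hY.aemeasurable
  calc ∫⁻ ω, f (X ω) (Y ω) ∂P
      = ∫⁻ p, Function.uncurry f p ∂(P.map fun ω => (X ω, Y ω)) := by
        rw [lintegral_map hf (hX.prodMk hY)]; rfl
    _ = ∫⁻ x, ∫⁻ y, f x y ∂(P.map Y) ∂(P.map X) := by
        rw [hm, lintegral_prod _ hf.aemeasurable]; rfl
    _ = ∫⁻ x, ∫⁻ ω', f x (Y ω') ∂P ∂(P.map X) := by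
        congr 1; ext x
        exact lintegral_map (hf.comp measurable_prodMk_left) hY
    _ = _ := by
        rw [lintegral_map _ hX]
        exact Measurable.lintegral_prod_right' (f := fun p : E × Ω => f p.1 (Y p.2))
          (hf.comp (measurable_fst.prodMk (hY.comp measurable_snd)))

/-- A random variable with values in `[0, ∞]` is almost surely finite if its Laplace transform
tends to one at zero. -/
lemma ae_ne_top_of_tendsto_laplace {Ω : Type*} [MeasurableSpace Ω] {P : Measure Ω}
    [IsProbabilityMeasure P] {J : ℕ → Ω → ℝ≥0∞} (hJ : ∀ n, Measurable (J n))
    (h : Tendsto (fun n => ∫⁻ ω, negExp (J n ω) ∂P) atTop (𝓝 1)) :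
    ∀ᵐ ω ∂P, ∃ n, J n ω ≠ ∞ := by
  have hs : MeasurableSet {ω | ∃ n, J n ω ≠ ∞} := by
    have : {ω | ∃ n, J n ω ≠ ∞} = ⋃ n, J n ⁻¹' {∞}ᶜ := by ext; simp
    rw [this]
    exact MeasurableSet.iUnion fun n => hJ n (measurableSet_singleton _).compl
  -- `negExp (J n)` is zero where `J n` is infinite and at most one elsewhere.
  have hle : ∀ n, ∫⁻ ω, negExp (J n ω) ∂P ≤ P {ω | ∃ n, J n ω ≠ ∞} := fun n => by
    rw [← lintegral_indicator_one hs]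
    refine lintegral_mono fun ω => ?_
    by_cases hω : J n ω = ∞
    · simp [hω]
    · rw [indicator_of_mem (show ω ∈ {ω | ∃ n, J n ω ≠ ∞} from ⟨n, hω⟩)]
      exact negExp_le_one _
  have h1 : 1 ≤ P {ω | ∃ n, J n ω ≠ ∞} := le_of_tendsto' h hle
  exact (mem_ae_iff_prob_eq_one hs).2 (le_antisymm prob_le_one h1)

end SpectrumSharing

/-! ### The Laplace functional of a planar Poisson process. -/

namespace SpectrumSharing

open Filter Topology

/-- This is the Poisson generating function `E[q ^ k] = exp (-r (1 - q))` at `q = e ^ (-y)`. -/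
lemma lintegral_negExp_poissonMeasure (r : NNReal) {y : ℝ≥0∞} (hy : y ≠ ∞) :
    ∫⁻ k : ℕ, negExp (y * k) ∂(poissonMeasure r) = negExp (r * (1 - negExp y)) := by
  lift y to NNReal using hy
  have hp : negExp y = ENNReal.ofReal (Real.exp (-y)) := by
    have := negExp_ofReal (NNReal.coe_nonneg y)
    rwa [ENNReal.ofReal_coe_nnreal] at this
  have hs : HasSum (fun k : ℕ => Real.exp (-r) * ((r * Real.exp (-y)) ^ k / (k.factorial : ℝ)))
      (Real.exp (-r) * Real.exp (r * Real.exp (-y))) := by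
    have h := NormedSpace.expSeries_div_hasSum_exp (𝔸 := ℝ) ((r : ℝ) * Real.exp (-y))
    rw [← Real.exp_eq_exp_ℝ] at h
    exact h.mul_left _
  rw [lintegral_countable']
  have ht : ∀ k : ℕ, negExp (y * k) * poissonMeasure r {k} =
      ENNReal.ofReal (Real.exp (-r) * ((r * Real.exp (-y)) ^ k / (k.factorial : ℝ))) := fun k => by
    rw [poissonMeasure_singleton, mul_comm (y : ℝ≥0∞), negExp_nat_mul, hp,
      ← ENNReal.ofReal_pow (Real.exp_nonneg _), ← ENNReal.ofReal_mul (by positivity)]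
    congr 1
    rw [mul_pow]; ring
  simp_rw [ht]
  rw [← ENNReal.ofReal_tsum_of_nonneg (fun k => by positivity) hs.summable, hs.tsum_eq,
    ← Real.exp_add]
  have h1 : (r : ℝ≥0∞) * (1 - negExp y) = ENNReal.ofReal (r * (1 - Real.exp (-y))) := by
    rw [hp, ENNReal.ofReal_mul (NNReal.coe_nonneg r), ENNReal.ofReal_sub _ (Real.exp_nonneg _)]
    simp
  rw [h1, negExp_ofReal]
  · congr 2; ring
  · have : Real.exp (-y) ≤ 1 := Real.exp_le_one_iff.2 (by simp)
    exact mul_nonneg (NNReal.coe_nonneg r) (by linarith)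

variable {Ω : Type*} {X : ℕ → Ω → Plane}

lemma tsum_simpleFunc (g : SimpleFunc Plane ℝ≥0∞) (ω : Ω) :
    ∑' n, g (X n ω) = ∑ y ∈ g.range, y * pointCount X (g ⁻¹' {y}) ω := by
  have h : ∀ n, g (X n ω) = ∑ y ∈ g.range, y * (g ⁻¹' {y}).indicator 1 (X n ω) := fun n => by
    rw [Finset.sum_eq_single (g (X n ω))]
    · simp
    · intro y _ hy
      rw [indicator_of_notMem (by simpa using hy.symm), mul_zero]
    · intro h; exact absurd (g.mem_range_self _) h
  simp_rw [h, pointCount, ← ENNReal.tsum_mul_left]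
  exact Summable.tsum_finsetSum fun _ _ => ENNReal.summable

variable [MeasurableSpace Ω] {P : Measure Ω} {lam : ℝ}

lemma measurable_pointCount (hX : ∀ n, Measurable (X n)) {A : Set Plane}
    (hA : MeasurableSet A) : Measurable (pointCount X A) := by
  unfold pointCount
  exact Measurable.tsum fun n => (measurable_one.indicator hA).comp (hX n)

lemma IsHomogeneousPPP.lintegral_negExp_mul_pointCount (hX : IsHomogeneousPPP P lam X)
    {A : Set Plane} (hA : MeasurableSet A) (hvol : volume A ≠ ∞) {y : ℝ≥0∞} (hy : y ≠ ∞) :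
    ∫⁻ ω, negExp (y * pointCount X A ω) ∂P
      = negExp (ENNReal.ofReal lam * volume A * (1 - negExp y)) := by
  have hm : Measurable fun t : ℝ≥0∞ => negExp (y * t) := by fun_prop
  have := (hX.count_law A hA hvol).lintegral_comp (f := fun t => negExp (y * t)) hm.aemeasurable
  rw [this, lintegral_map hm (by fun_prop), lintegral_negExp_poissonMeasure _ hy]
  congr 2
  simp [ENNReal.ofReal, ENNReal.coe_toNNReal hvol]

variable [IsProbabilityMeasure P]

/-- The fibres of a simple function are disjoint, so their counts are independent Poisson variables
and the transform is a product. The fibre over zero may have infinite area, but it contributes the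
factor one. -/
lemma IsHomogeneousPPP.laplace_simpleFunc (hX : IsHomogeneousPPP P lam X)
    (g : SimpleFunc Plane ℝ≥0∞) (hg : ∀ x, g x ≠ ∞)
    (hvol : ∀ y ≠ 0, volume (g ⁻¹' {y}) ≠ ∞) :
    ∫⁻ ω, negExp (∑' n, g (X n ω)) ∂P
      = negExp (ENNReal.ofReal lam * ∫⁻ x, (1 - negExp (g x))) := by
  simp_rw [tsum_simpleFunc, negExp_sum]
  have hind : iIndepFun (fun (y : g.range) => pointCount X (g ⁻¹' {(y : ℝ≥0∞)})) P := by
    let e := g.range.equivFin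
    have := hX.count_indep _ (fun i => g ⁻¹' {((e.symm i : g.range) : ℝ≥0∞)})
      (fun i => g.measurableSet_fiber _) (fun i j hij => by
        refine Disjoint.preimage _ (disjoint_singleton.2 fun h => hij ?_)
        exact e.symm.injective (Subtype.ext h))
    have := this.precomp e.injective
    simpa using this
  have hind' := hind.comp (fun (y : g.range) t => negExp ((y : ℝ≥0∞) * t)) (fun y => by fun_prop)
  have hmeas : ∀ y, Measurable (pointCount X (g ⁻¹' {y})) := fun y =>
    measurable_pointCount hX.measurable (g.measurableSet_fiber _)
  have key := lintegral_prod_eq_prod_lintegral_of_indepFun Finset.univ _ hind'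
    (fun y => measurable_negExp.comp ((hmeas y).const_mul _))
  have e1 : ∀ ω, ∏ y : g.range, negExp (y * pointCount X (g ⁻¹' {(y : ℝ≥0∞)}) ω)
      = ∏ y ∈ g.range, negExp (y * pointCount X (g ⁻¹' {y}) ω) := fun ω =>
        Finset.prod_coe_sort g.range fun y => negExp (y * pointCount X (g ⁻¹' {y}) ω)
  simp only [Function.comp_def, e1] at key
  rw [key, Finset.prod_coe_sort g.range fun y => ∫⁻ ω, negExp (y * pointCount X (g ⁻¹' {y}) ω) ∂P]
  have e2 : ∀ y ∈ g.range, ∫⁻ ω, negExp (y * pointCount X (g ⁻¹' {y}) ω) ∂P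
      = negExp (ENNReal.ofReal lam * ((1 - negExp y) * volume (g ⁻¹' {y}))) := fun y hy => by
    obtain ⟨x, rfl⟩ := SimpleFunc.mem_range.1 hy
    by_cases h0 : g x = 0
    · simp [h0]
    · rw [hX.lintegral_negExp_mul_pointCount (g.measurableSet_fiber _) (hvol _ h0) (hg x), mul_assoc,
        mul_comm (volume _)]
  rw [Finset.prod_congr rfl e2, ← negExp_sum, ← Finset.mul_sum]
  congr 2
  have : ∀ x, 1 - negExp (g x) = (g.map fun y => 1 - negExp y) x := fun x => rfl
  simp_rw [this]
  rw [SimpleFunc.lintegral_eq_lintegral, SimpleFunc.map_lintegral]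

/-- The Laplace functional of a homogeneous Poisson process. -/
lemma IsHomogeneousPPP.laplace (hX : IsHomogeneousPPP P lam X) {g : Plane → ℝ≥0∞}
    (hg : Measurable g) :
    ∫⁻ ω, negExp (∑' n, g (X n ω)) ∂P
      = negExp (ENNReal.ofReal lam * ∫⁻ x, (1 - negExp (g x))) := by
  -- Simple functions increasing to `g`, cut off to balls so that the fibres over nonzero values
  -- have finite area.
  let B : ℕ → Set Plane := fun j => Metric.ball 0 j
  let G : ℕ → SimpleFunc Plane ℝ≥0∞ := fun j => (SimpleFunc.eapprox g j).restrict (B j)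
  have hB : ∀ j, MeasurableSet (B j) := fun j => measurableSet_ball
  have hGapp : ∀ j x, G j x = (B j).indicator (SimpleFunc.eapprox g j) x := fun j x =>
    SimpleFunc.restrict_apply _ (hB j) x
  have hmono : Monotone fun j x => G j x := by
    intro i j hij x
    simp only [hGapp]
    by_cases hx : x ∈ B i
    · have hx' : x ∈ B j := Metric.ball_subset_ball (by exact_mod_cast hij) hx
      rw [indicator_of_mem hx, indicator_of_mem hx']
      exact SimpleFunc.monotone_eapprox g hij x
    · rw [indicator_of_notMem hx]; exact zero_le
  have hlim : ∀ x, Tendsto (fun j => G j x) atTop (𝓝 (g x)) := fun x => by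
    have h1 : Tendsto (fun j => SimpleFunc.eapprox g j x) atTop (𝓝 (g x)) := by
      rw [← SimpleFunc.iSup_eapprox_apply hg x]
      exact tendsto_atTop_iSup fun i j hij => SimpleFunc.monotone_eapprox g hij x
    refine h1.congr' ?_
    obtain ⟨N, hN⟩ := exists_nat_gt ‖x‖
    filter_upwards [eventually_ge_atTop N] with j hj
    rw [hGapp, indicator_of_mem]
    simp only [B, Metric.mem_ball, dist_zero_right]
    exact hN.trans_le (by exact_mod_cast hj)
  have hG : ∀ j, ∫⁻ ω, negExp (∑' n, G j (X n ω)) ∂P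
      = negExp (ENNReal.ofReal lam * ∫⁻ x, (1 - negExp (G j x))) := fun j => by
    refine hX.laplace_simpleFunc _ (fun x => ?_) fun y hy => ?_
    · rw [hGapp]
      by_cases hx : x ∈ B j
      · rw [indicator_of_mem hx]; exact (SimpleFunc.eapprox_lt_top _ _ _).ne
      · simp [hx]
    · refine ne_top_of_le_ne_top (measure_ball_lt_top (x := (0 : Plane)) (r := j)).ne
        (measure_mono fun x hx => ?_)
      by_contra hxB
      rw [mem_preimage, mem_singleton_iff, hGapp, indicator_of_notMem hxB] at hx
      exact hy hx.symm
  refine tendsto_nhds_unique (f := fun j => ∫⁻ ω, negExp (∑' n, G j (X n ω)) ∂P) (l := atTop)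
    (tendsto_lintegral_negExp (fun j => Measurable.tsum fun n =>
      (G j).measurable.comp (hX.measurable n)) (ae_of_all _ fun ω => ?_)) ?_
  · have : ∀ ω, ∑' n, g (X n ω) = ⨆ j, ∑' n, G j (X n ω) := fun ω => by
      have e : ∀ n, g (X n ω) = ⨆ j, G j (X n ω) := fun n =>
        tendsto_nhds_unique (hlim _) (tendsto_atTop_iSup fun i j hij => hmono hij _)
      simp_rw [e, ← lintegral_count]
      exact lintegral_iSup (f := fun j n => G j (X n ω)) (fun j => measurable_from_top)
        fun i j hij n => hmono hij _
    rw [this]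
    exact tendsto_atTop_iSup fun i j hij => ENNReal.tsum_le_tsum fun n => hmono hij _
  · simp_rw [hG]
    refine (continuous_negExp.tendsto _).comp (ENNReal.Tendsto.const_mul ?_ (Or.inr ENNReal.ofReal_ne_top))
    refine lintegral_tendsto_of_tendsto_of_monotone
      (fun j => (measurable_const.sub (measurable_negExp.comp (G j).measurable)).aemeasurable)
      (ae_of_all _ fun x i j hij => tsub_le_tsub_left (antitone_negExp (hmono hij x)) _)
      (ae_of_all _ fun x => ?_)
    exact ENNReal.Tendsto.sub tendsto_const_nhds ((continuous_negExp.tendsto _).comp (hlim x))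
      (Or.inl ENNReal.one_ne_top)

end SpectrumSharing

/-! ### From marked points in the plane to points on the half-line. -/

namespace SpectrumSharing

open Filter Topology

/-- The disc of radius `√b` has area `π b`, which is linear in `b`; half-open intervals determine
the image measure. -/
lemma map_norm_sub_sq_volume (x₀ : Plane) :
    (volume : Measure Plane).map (fun x => ‖x - x₀‖ ^ 2)
      = ENNReal.ofReal Real.pi • (volume : Measure ℝ).restrict (Ioi 0) := by
  have hm : Measurable fun x : Plane => ‖x - x₀‖ ^ 2 := by fun_prop
  have hball : ∀ b : ℝ, 0 ≤ b → {x : Plane | ‖x - x₀‖ ^ 2 ≤ b} = Metric.closedBall x₀ √b := by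
    intro b hb
    ext x
    simp only [mem_ofPred_eq, Metric.mem_closedBall, dist_eq_norm]
    exact (Real.le_sqrt (norm_nonneg _) hb).symm
  have hvol : ∀ b : ℝ, 0 ≤ b →
      volume {x : Plane | ‖x - x₀‖ ^ 2 ≤ b} = ENNReal.ofReal Real.pi * ENNReal.ofReal b := by
    intro b hb
    rw [hball b hb, EuclideanSpace.volume_closedBall_fin_two, ← ENNReal.ofReal_pow (Real.sqrt_nonneg _),
      Real.sq_sqrt hb, mul_comm]
  have hfin : IsLocallyFiniteMeasure
      (ENNReal.ofReal Real.pi • (volume : Measure ℝ).restrict (Ioi 0)) :=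
    isLocallyFiniteMeasureSMulNNReal _ Real.pi.toNNReal
  symm
  refine Measure.ext_of_Ioc _ _ fun a b hab => ?_
  rw [Measure.map_apply hm measurableSet_Ioc, Measure.smul_apply,
    Measure.restrict_apply measurableSet_Ioc, Ioc_inter_Ioi, Real.volume_Ioc, smul_eq_mul]
  rcases lt_or_ge a 0 with ha | ha
  · rw [max_eq_right ha.le, sub_zero]
    rcases lt_or_ge b 0 with hb | hb
    · rw [ENNReal.ofReal_of_nonpos hb.le, mul_zero]
      have : (fun x : Plane => ‖x - x₀‖ ^ 2) ⁻¹' Ioc a b = ∅ := by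
        ext x
        simp only [mem_preimage, mem_Ioc, mem_empty_iff_false, iff_false, not_and, not_le]
        intro _
        exact hb.trans_le (by positivity)
      rw [this, measure_empty]
    · rw [← hvol b hb]
      congr 1
      ext x
      simp only [mem_preimage, mem_Ioc, mem_ofPred_eq, iff_and_self]
      intro _
      exact ha.trans_le (by positivity)
  · have hb : 0 ≤ b := ha.trans hab.le
    have : (fun x : Plane => ‖x - x₀‖ ^ 2) ⁻¹' Ioc a b
        = {x : Plane | ‖x - x₀‖ ^ 2 ≤ b} \ {x : Plane | ‖x - x₀‖ ^ 2 ≤ a} := by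
      ext x
      simp only [mem_preimage, mem_Ioc, Set.mem_sdiff, mem_ofPred_eq, not_le, and_comm]
    have hsub : {x : Plane | ‖x - x₀‖ ^ 2 ≤ a} ⊆ {x : Plane | ‖x - x₀‖ ^ 2 ≤ b} :=
      fun x hx => by
        simp only [mem_ofPred_eq] at hx ⊢
        exact hx.trans hab.le
    rw [this, measure_sdiff hsub (measurableSet_le hm measurable_const).nullMeasurableSet, hvol a ha, hvol b hb,
      max_eq_left ha, ENNReal.ofReal_sub _ ha, ENNReal.mul_sub]
    · exact fun _ _ => ENNReal.ofReal_ne_top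
    · rw [hvol a ha]; exact ENNReal.mul_ne_top ENNReal.ofReal_ne_top ENNReal.ofReal_ne_top

/-- Dilations of the half-line. -/
lemma lintegral_Ioi_comp_mul {F : ℝ → ℝ≥0∞} {a : ℝ} (ha : 0 < a) (t : ℝ) :
    ∫⁻ u in Ioi t, F (a * u) = ENNReal.ofReal a⁻¹ * ∫⁻ u in Ioi (a * t), F u := by
  have h := Real.smul_map_volume_mul_left ha.ne'
  have he : MeasurableEmbedding (fun u : ℝ => a * u) :=
    (Homeomorph.mulLeft₀ a ha.ne').measurableEmbedding
  have h1 : ∫⁻ u in Ioi (a * t), F u ∂((volume : Measure ℝ).map (a * ·))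
      = ∫⁻ u in Ioi t, F (a * u) := by
    rw [he.restrict_map, he.lintegral_map]
    congr 2
    ext u
    simp only [mem_Ioi, mem_preimage]
    exact mul_lt_mul_iff_right₀ ha
  rw [← h1]
  conv_rhs => rw [← h]
  rw [Measure.restrict_smul, lintegral_smul_measure, smul_eq_mul, ← mul_assoc, abs_of_pos ha,
    ← ENNReal.ofReal_mul (by positivity), inv_mul_cancel₀ ha.ne', ENNReal.ofReal_one, one_mul]

lemma lintegral_comp_mul_norm_sub_sq {F : ℝ → ℝ≥0∞} (hF : Measurable F) {a : ℝ} (ha : 0 < a)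
    (x₀ : Plane) :
    ∫⁻ x : Plane, F (a * ‖x - x₀‖ ^ 2)
      = ENNReal.ofReal Real.pi * (ENNReal.ofReal a⁻¹ * ∫⁻ u in Ioi 0, F u) := by
  have hm : Measurable fun x : Plane => ‖x - x₀‖ ^ 2 := by fun_prop
  have : ∫⁻ x : Plane, F (a * ‖x - x₀‖ ^ 2)
      = ∫⁻ u, F (a * u) ∂((volume : Measure Plane).map (fun x => ‖x - x₀‖ ^ 2)) := by
    rw [lintegral_map (by fun_prop) hm]
  rw [this, map_norm_sub_sq_volume, lintegral_smul_measure, lintegral_Ioi_comp_mul ha, mul_zero,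
    smul_eq_mul]

variable {Ω : Type*} [MeasurableSpace Ω] {P : Measure Ω}

/-- The points `T n` have the Laplace functional of a Poisson process of intensity `c` on the
half-line. -/
def HasPoissonLaplace (P : Measure Ω) (T : ℕ → Ω → ℝ) (c : ℝ≥0∞) : Prop :=
  ∀ g : ℝ → ℝ≥0∞, Measurable g →
    ∫⁻ ω, negExp (∑' n, g (T n ω)) ∂P = negExp (c * ∫⁻ u in Ioi 0, (1 - negExp (g u)))

/-- The path loss, raised to the power `-2 / α`, of the `n`-th point with mark `M`. -/
noncomputable def lossPoint (α : ℝ) (x₀ : Plane) (M : ℕ → Ω → ℝ) (X : ℕ → Ω → Plane)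
    (n : ℕ) (ω : Ω) : ℝ :=
  M n ω ^ (-(2 / α)) * ‖X n ω - x₀‖ ^ 2

lemma measurable_lossPoint {α : ℝ} {x₀ : Plane} {M : ℕ → Ω → ℝ} {X : ℕ → Ω → Plane}
    (hM : ∀ n, Measurable (M n)) (hX : ∀ n, Measurable (X n)) (n : ℕ) :
    Measurable (lossPoint α x₀ M X n) := by
  have := hM n
  have := hX n
  unfold lossPoint
  fun_prop

/-- This identity dictates the exponents in `lossPoint`: received power becomes a decreasing
function of a single positive number. -/
lemma lossPoint_rpow {Ω : Type*} {α : ℝ} (hα : 0 < α) {x₀ : Plane} {M : ℕ → Ω → ℝ}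
    {X : ℕ → Ω → Plane} {n : ℕ} {ω : Ω} (hM : 0 ≤ M n ω) :
    lossPoint α x₀ M X n ω ^ (-(α / 2)) = M n ω * ‖X n ω - x₀‖ ^ (-α) := by
  rw [lossPoint, Real.mul_rpow (by positivity) (by positivity), ← Real.rpow_mul hM,
    ← Real.rpow_natCast, ← Real.rpow_mul (norm_nonneg _)]
  congr 1
  · rw [show -(2 / α) * -(α / 2) = 1 by field_simp, Real.rpow_one]
  · congr 1; push_cast; ring

variable [IsProbabilityMeasure P] {lam : ℝ} {X : ℕ → Ω → Plane} {M : ℕ → Ω → ℝ}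

/-- Displacement of a marked Poisson process in the plane to the half-line. -/
lemma IsHomogeneousPPP.hasPoissonLaplace_lossPoint (hX : IsHomogeneousPPP P lam X)
    (hM : ∀ n, Measurable (M n)) (hMi : iIndepFun M P) {ν : Measure ℝ} [IsProbabilityMeasure ν]
    (hMν : ∀ n, P.map (M n) = ν) (hν : ∀ᵐ p ∂ν, 0 < p)
    (hXM : IndepFun (fun ω n => X n ω) (fun ω n => M n ω) P) (α : ℝ) (x₀ : Plane) :
    HasPoissonLaplace P (lossPoint α x₀ M X)
      (ENNReal.ofReal (Real.pi * lam) * ∫⁻ p, ENNReal.ofReal (p ^ (2 / α)) ∂ν) := by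
  intro g hg
  let τ : ℝ → Plane → ℝ≥0∞ := fun p x => g (p ^ (-(2 / α)) * ‖x - x₀‖ ^ 2)
  have hτ : Measurable (Function.uncurry τ) := by
    unfold τ Function.uncurry
    fun_prop
  have hXm := hX.measurable
  have hτ' : ∀ x, Measurable fun p => τ p x := fun x => hτ.comp measurable_prodMk_right
  have hE1 : ∀ x, ∫⁻ p, negExp (τ p x) ∂ν ≤ 1 := fun x => by
    calc _ ≤ ∫⁻ _, 1 ∂ν := lintegral_mono fun p => negExp_le_one _
      _ = 1 := by simp
  have hEm : Measurable fun x => ∫⁻ p, negExp (τ p x) ∂ν :=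
    Measurable.lintegral_prod_left' (f := fun q : ℝ × Plane => negExp (τ q.1 q.2))
      (measurable_negExp.comp hτ)
  calc ∫⁻ ω, negExp (∑' n, g (lossPoint α x₀ M X n ω)) ∂P
      = ∫⁻ ω, ∫⁻ ω', negExp (∑' n, τ (M n ω') (X n ω)) ∂P ∂P := by
        refine lintegral_of_indepFun (f := fun x m => negExp (∑' n, τ (m n) (x n)))
          (by fun_prop) (by fun_prop) hXM ?_
        refine measurable_negExp.comp (Measurable.tsum fun n => ?_)
        have h2 : Measurable fun q : (ℕ → Plane) × (ℕ → ℝ) => (q.2 n, q.1 n) := by fun_prop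
        exact hτ.comp h2
    -- With the sites frozen, the independent marks are integrated out and leave an effective cost
    -- per site.
    _ = ∫⁻ ω, negExp (∑' n, negLog (∫⁻ p, negExp (τ p (X n ω)) ∂ν)) ∂P := by
        refine lintegral_congr fun ω => ?_
        rw [lintegral_negExp_tsum_of_iIndepFun (W := fun n ω' => τ (M n ω') (X n ω))
          (fun n => (hτ' _).comp (hM n)) (hMi.comp (fun n p => τ p (X n ω)) fun n => hτ' _)]
        congr 3
        ext n
        rw [← hMν n, lintegral_map (f := fun p => negExp (τ p (X n ω)))
          (measurable_negExp.comp (hτ' _)) (hM n)]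
    _ = negExp (ENNReal.ofReal lam *
          ∫⁻ x, (1 - negExp (negLog (∫⁻ p, negExp (τ p x) ∂ν)))) :=
        hX.laplace (measurable_negLog.comp hEm)
    _ = _ := by
        congr 1
        rw [ENNReal.ofReal_mul Real.pi_nonneg, mul_comm (ENNReal.ofReal Real.pi), mul_assoc,
          mul_assoc]
        congr 1
        calc ∫⁻ x, (1 - negExp (negLog (∫⁻ p, negExp (τ p x) ∂ν)))
            = ∫⁻ x, ∫⁻ p, (1 - negExp (τ p x)) ∂ν := by
              refine lintegral_congr fun x => ?_
              rw [negExp_negLog (hE1 x), lintegral_sub (g := fun p => negExp (τ p x)) (measurable_negExp.comp (hτ' x))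
                (ne_top_of_le_ne_top ENNReal.one_ne_top (hE1 x))
                (ae_of_all _ fun p => negExp_le_one _)]
              simp
          _ = ∫⁻ p, (∫⁻ x, (1 - negExp (τ p x))) ∂ν := by
              refine lintegral_lintegral_swap (f := fun x p => 1 - negExp (τ p x))
                (Measurable.aemeasurable ?_)
              exact (measurable_const.sub
                (measurable_negExp.comp (hτ.comp measurable_swap)))
          -- For fixed mark `p` the dilation by `p ^ (-2/α)` produces the intensity factor `p ^
          -- (2/α)`.
          _ = ∫⁻ p, ENNReal.ofReal Real.pi * (ENNReal.ofReal (p ^ (2 / α)) *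
                ∫⁻ u in Ioi 0, (1 - negExp (g u))) ∂ν := by
              refine lintegral_congr_ae ?_
              filter_upwards [hν] with p hp
              have := lintegral_comp_mul_norm_sub_sq (F := fun u => 1 - negExp (g u))
                (by fun_prop) (Real.rpow_pos_of_pos hp (-(2 / α))) x₀
              rw [this, Real.rpow_neg hp.le, inv_inv]
          _ = _ := by
              rw [lintegral_const_mul _ (by fun_prop), lintegral_mul_const _ (by fun_prop)]

end SpectrumSharing

/-! ### A reduced Campbell formula derived from the Laplace functional. -/

namespace SpectrumSharing

open Filter Topology

/-- The sum of `f` over all indices but `n`. -/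
noncomputable def sumExcept (n : ℕ) (f : ℕ → ℝ≥0∞) : ℝ≥0∞ := ∑' m, if m = n then 0 else f m

lemma add_sumExcept (n : ℕ) (f : ℕ → ℝ≥0∞) : f n + sumExcept n f = ∑' m, f m := by
  rw [sumExcept, ENNReal.tsum_eq_add_tsum_ite (f := f) n]
  congr!

lemma le_sumExcept {n m : ℕ} (h : m ≠ n) (f : ℕ → ℝ≥0∞) : f m ≤ sumExcept n f := by
  have := ENNReal.le_tsum (f := fun m => if m = n then 0 else f m) m
  simp only [if_neg h] at this
  exact this

lemma measurable_sumExcept {E : Type*} [MeasurableSpace E] {f : ℕ → E → ℝ≥0∞} (n : ℕ)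
    (hf : ∀ m, Measurable (f m)) : Measurable fun x => sumExcept n fun m => f m x := by
  unfold sumExcept
  refine Measurable.tsum fun m => ?_
  split_ifs
  · exact measurable_const
  · exact hf m

lemma sumExcept_congr {n : ℕ} {f g : ℕ → ℝ≥0∞} (h : ∀ m ≠ n, f m = g m) :
    sumExcept n f = sumExcept n g := by
  unfold sumExcept
  congr 1; ext m
  split_ifs with hm
  · rfl
  · exact h m hm

lemma tendsto_tsum_of_monotone {f : ℕ → ℕ → ℝ≥0∞} {g : ℕ → ℝ≥0∞} (hf : ∀ m, Monotone fun j => f j m)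
    (h : ∀ m, Tendsto (fun j => f j m) atTop (𝓝 (g m))) :
    Tendsto (fun j => ∑' m, f j m) atTop (𝓝 (∑' m, g m)) := by
  simp_rw [← lintegral_count]
  exact lintegral_tendsto_of_tendsto_of_monotone (fun j => measurable_from_top.aemeasurable)
    (ae_of_all _ hf) (ae_of_all _ h)

lemma tendsto_tsum_of_dominated {f : ℕ → ℕ → ℝ≥0∞} {g b : ℕ → ℝ≥0∞}
    (hf : ∀ᶠ j in atTop, ∀ m, f j m ≤ b m) (hb : ∑' m, b m ≠ ∞)
    (h : ∀ m, Tendsto (fun j => f j m) atTop (𝓝 (g m))) :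
    Tendsto (fun j => ∑' m, f j m) atTop (𝓝 (∑' m, g m)) := by
  simp_rw [← lintegral_count] at hb ⊢
  exact tendsto_lintegral_filter_of_dominated_convergence b
    (Eventually.of_forall fun j => measurable_from_top) (hf.mono fun j hj => ae_of_all _ hj)
    hb (ae_of_all _ h)

/-- The expression is the difference quotient at zero of `x ↦ 1 - e ^ (-x w)` along `x = e ^ (-j)`.
-/
lemma tendsto_exp_mul_one_sub_negExp {w : ℝ≥0∞} (hw : w ≠ ∞) :
    Tendsto (fun j : ℕ => ENNReal.ofReal (Real.exp j) *
      (1 - negExp (ENNReal.ofReal (Real.exp (-j)) * w))) atTop (𝓝 w) := by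
  have h1 : Tendsto (fun j : ℕ => Real.exp j * (1 - Real.exp (-(Real.exp (-j) * w.toReal))))
      atTop (𝓝 w.toReal) := by
    have hd : HasDerivAt (fun x : ℝ => 1 - Real.exp (-(x * w.toReal))) w.toReal 0 := by
      have : HasDerivAt (fun x : ℝ => -(x * w.toReal)) (-(1 * w.toReal)) 0 :=
        ((hasDerivAt_id (0 : ℝ)).mul_const _).neg
      simpa using this.exp.const_sub 1
    have hz : Tendsto (fun j : ℕ => Real.exp (-(j : ℝ))) atTop (𝓝[≠] 0) := by
      refine tendsto_nhdsWithin_iff.2 ⟨?_, Eventually.of_forall fun j => (Real.exp_pos _).ne'⟩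
      exact Real.tendsto_exp_neg_atTop_nhds_zero.comp tendsto_natCast_atTop_atTop
    refine ((hasDerivAt_iff_tendsto_slope.1 hd).comp hz).congr fun j => ?_
    simp only [Function.comp_apply, slope, vsub_eq_sub, sub_zero, zero_mul, neg_zero, Real.exp_zero,
      sub_self, smul_eq_mul]
    rw [← Real.exp_neg, neg_neg]
  have h2 := ENNReal.tendsto_ofReal h1
  rw [ENNReal.ofReal_toReal hw] at h2
  refine h2.congr fun j => ?_
  rw [ENNReal.ofReal_mul (Real.exp_nonneg _), ENNReal.ofReal_sub _ (Real.exp_nonneg _),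
    ← negExp_ofReal (by positivity), ENNReal.ofReal_mul (Real.exp_nonneg _),
    ENNReal.ofReal_toReal hw, ENNReal.ofReal_one]

lemma ofReal_exp_mul_negExp_natCast (j : ℕ) :
    ENNReal.ofReal (Real.exp j) * negExp j = 1 := by
  have : ((j : ℕ) : ℝ≥0∞) = ENNReal.ofReal j := by simp
  rw [this, negExp_ofReal (Nat.cast_nonneg _), ← ENNReal.ofReal_mul (Real.exp_nonneg _),
    ← Real.exp_add]
  simp

lemma negExp_natCast (j : ℕ) : negExp j = ENNReal.ofReal (Real.exp (-j)) := by
  rw [← negExp_ofReal (Nat.cast_nonneg _)]; simp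

variable {Ω : Type*} [MeasurableSpace Ω] {P : Measure Ω} [IsProbabilityMeasure P]
  {T : ℕ → Ω → ℝ} {c : ℝ≥0∞}

/-- A reduced Campbell formula: the sum over the points in `A` of a functional of the other points
which vanishes if another point lies in `A`. -/
lemma HasPoissonLaplace.lintegral_tsum_indicator (hT : HasPoissonLaplace P T c) (hc : c ≠ ∞)
    (hTm : ∀ n, Measurable (T n)) {A : Set ℝ} (hA : MeasurableSet A) {ψ h : ℝ → ℝ≥0∞}
    (hψ : Measurable ψ) (hh : Measurable h) (hhA : ∀ u ∈ A, h u = ∞)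
    (hD : ∫⁻ u in Ioi 0, (1 - negExp (h u)) ≠ ∞) :
    ∫⁻ ω, ∑' n, A.indicator (fun u => negExp (ψ u)) (T n ω)
        * negExp (sumExcept n fun m => h (T m ω)) ∂P
      = c * (∫⁻ u in Ioi 0, A.indicator (fun u => negExp (ψ u)) u)
        * negExp (c * ∫⁻ u in Ioi 0, (1 - negExp (h u))) := by
  classical
  -- The infinite penalty on `A` is relaxed to `j + ψ`: a point of `A` then costs the factor `e ^
  -- (-j)` and carries the weight `negExp ψ`.
  let hj : ℕ → ℝ → ℝ≥0∞ := fun j u => if u ∈ A then j + ψ u else h u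
  have hjm : ∀ j, Measurable (hj j) := fun j => Measurable.ite hA (by fun_prop) hh
  have hjle : ∀ j u, hj j u ≤ h u := fun j u => by
    by_cases hu : u ∈ A <;> simp [hj, hu, hhA]
  have hjmono : ∀ u, Monotone fun j => hj j u := fun u i j hij => by
    by_cases hu : u ∈ A
    · simp only [hj, hu, if_true]
      gcongr
    · simp [hj, hu]
  have hjlim : ∀ u, Tendsto (fun j => hj j u) atTop (𝓝 (h u)) := fun u => by
    by_cases hu : u ∈ A
    · simp only [hj, hu, if_true, hhA]
      refine tendsto_nhds_top_mono ENNReal.tendsto_nat_nhds_top (Eventually.of_forall fun j => ?_)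
      exact le_self_add
    · simp [hj, hu]
  let e : ℕ → ℝ≥0∞ := fun j => ENNReal.ofReal (Real.exp j)
  let v : ℝ≥0∞ := ∫⁻ u in Ioi 0, A.indicator (fun u => negExp (ψ u)) u
  let D : ℝ≥0∞ := ∫⁻ u in Ioi 0, (1 - negExp (h u))
  let Dj : ℕ → ℝ≥0∞ := fun j => ∫⁻ u in Ioi 0, (1 - negExp (hj j u))
  have hφm : Measurable (A.indicator fun u => negExp (ψ u)) :=
    (measurable_negExp.comp hψ).indicator hA
  -- The exponents for `h` and `hj` differ exactly by `e ^ (-j)` times the integral of `negExp ψ`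
  -- over the positive part of `A`.
  have hDDj : ∀ j, D = Dj j + ENNReal.ofReal (Real.exp (-j)) * v := fun j => by
    rw [← lintegral_const_mul _ hφm, ← lintegral_add_left (by fun_prop)]
    refine lintegral_congr fun u => ?_
    by_cases hu : u ∈ A
    · simp only [hj, hu, if_true, hhA, negExp_top, tsub_zero, indicator_of_mem, negExp_add,
        negExp_natCast]
      refine (tsub_add_cancel_of_le ?_).symm
      rw [← negExp_natCast, ← negExp_add]
      exact negExp_le_one _
    · simp [hj, hu]
  have hv : v ≠ ∞ := by
    refine ne_top_of_le_ne_top hD (lintegral_mono fun u => ?_)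
    by_cases hu : u ∈ A
    · simp [hu, hhA, negExp_le_one]
    · simp [hu]
  have hDjlim : Tendsto Dj atTop (𝓝 D) := by
    have h0 : Tendsto (fun j : ℕ => ENNReal.ofReal (Real.exp (-j)) * v) atTop (𝓝 0) := by
      have : Tendsto (fun j : ℕ => ENNReal.ofReal (Real.exp (-j))) atTop (𝓝 0) := by
        rw [← ENNReal.ofReal_zero]
        exact ENNReal.tendsto_ofReal
          (Real.tendsto_exp_neg_atTop_nhds_zero.comp tendsto_natCast_atTop_atTop)
      simpa using ENNReal.Tendsto.mul_const this (Or.inr hv)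
    have h1 := ENNReal.Tendsto.sub (tendsto_const_nhds (x := D)) h0 (Or.inl hD)
    rw [tsub_zero] at h1
    refine h1.congr fun j => ?_
    rw [hDDj j]
    exact ENNReal.add_sub_cancel_right (ENNReal.mul_ne_top ENNReal.ofReal_ne_top hv)
  -- The difference removes configurations without a point in `A`. The factor `e ^ j` normalises
  -- those with one point, and those with several points disappear as `j` grows.
  let F : ℕ → Ω → ℝ≥0∞ := fun j ω =>
    e j * (negExp (∑' n, hj j (T n ω)) - negExp (∑' n, h (T n ω)))
  have hsm : Measurable fun ω => negExp (∑' n, h (T n ω)) :=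
    measurable_negExp.comp (Measurable.tsum fun n => hh.comp (hTm n))
  have hsmj : ∀ j, Measurable fun ω => negExp (∑' n, hj j (T n ω)) := fun j =>
    measurable_negExp.comp (Measurable.tsum fun n => (hjm j).comp (hTm n))
  have hF : ∀ j, ∫⁻ ω, F j ω ∂P = negExp (c * Dj j) *
      (e j * (1 - negExp (ENNReal.ofReal (Real.exp (-j)) * (c * v)))) := fun j => by
    simp only [F]
    rw [lintegral_const_mul (e j) (f := fun ω => negExp (∑' n, hj j (T n ω)) -
      negExp (∑' n, h (T n ω))) ((hsmj j).sub hsm), lintegral_sub hsm, hT _ (hjm j), hT _ hh]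
    · change e j * (negExp (c * Dj j) - negExp (c * D)) = _
      rw [hDDj j, mul_add, negExp_add, mul_left_comm c, mul_left_comm (negExp _) (e j),
        ENNReal.mul_sub (fun _ _ => negExp_ne_top _), mul_one]
    · refine ne_top_of_le_ne_top ENNReal.one_ne_top ?_
      calc _ ≤ ∫⁻ _, 1 ∂P := lintegral_mono fun p => negExp_le_one _
        _ = 1 := by simp
    · exact ae_of_all _ fun ω => antitone_negExp (ENNReal.tsum_le_tsum fun n => hjle _ _)
  -- A point of `A` makes the sum of `h` infinite, so the subtracted term vanishes, and `e ^ j`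
  -- cancels the `e ^ (-j)` of that point.
  have hFval : ∀ ω n, T n ω ∈ A → ∀ j, F j ω =
      negExp (ψ (T n ω)) * negExp (sumExcept n fun m => hj j (T m ω)) := fun ω n hn j => by
    have h1 : ∑' n, h (T n ω) = ∞ := by
      rw [← add_sumExcept n, hhA _ hn, top_add]
    simp only [F, h1, negExp_top, tsub_zero]
    rw [← add_sumExcept n, negExp_add]
    simp only [hj, hn, if_true, negExp_add]
    rw [← mul_assoc, ← mul_assoc, ofReal_exp_mul_negExp_natCast, one_mul]
  have hFnone : ∀ ω, (∀ n, T n ω ∉ A) → ∀ j, F j ω = 0 := fun ω hn j => by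
    simp [F, hj, hn]
  refine tendsto_nhds_unique (f := fun j => ∫⁻ ω, F j ω ∂P) (l := atTop) ?_ ?_
  · refine tendsto_lintegral_of_dominated_convergence (fun _ => 1)
      (fun j => measurable_const.mul ((hsmj j).sub hsm)) (fun j => ae_of_all _ fun ω => ?_)
      (by simp) (ae_of_all _ fun ω => ?_)
    · by_cases hn : ∃ n, T n ω ∈ A
      · obtain ⟨n, hn⟩ := hn
        rw [hFval ω n hn]
        exact mul_le_one' (negExp_le_one _) (negExp_le_one _)
      · push Not at hn
        rw [hFnone ω hn]; exact zero_le
    · by_cases hn : ∃ n, T n ω ∈ A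
      · obtain ⟨n, hn⟩ := hn
        rw [tsum_eq_single n, indicator_of_mem hn]
        · simp_rw [hFval ω n hn]
          refine ENNReal.Tendsto.const_mul ?_ (Or.inr (negExp_ne_top _))
          refine (continuous_negExp.tendsto _).comp (tendsto_tsum_of_monotone (fun m => ?_) fun m => ?_)
          · split_ifs
            · exact monotone_const
            · exact hjmono _
          · split_ifs
            · exact tendsto_const_nhds
            · exact hjlim _
        -- For every other index `m` the point `T n` of `A` is among those in the excluded sum, so
        -- that term is zero.
        · intro m hm
          have : sumExcept m (fun m => h (T m ω)) = ∞ :=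
            top_le_iff.1 ((hhA _ hn).symm.le.trans (le_sumExcept hm.symm fun m => h (T m ω)))
          rw [this, negExp_top, mul_zero]
      · push Not at hn
        simp_rw [hFnone ω hn, fun n => indicator_of_notMem (hn n) (fun u => negExp (ψ u)), zero_mul,
          tsum_zero]
        exact tendsto_const_nhds
  · simp_rw [hF]
    rw [mul_comm (c * _)]
    refine ENNReal.Tendsto.mul ?_ (Or.inr (ENNReal.mul_ne_top hc hv))
      (tendsto_exp_mul_one_sub_negExp (ENNReal.mul_ne_top hc hv)) (Or.inr (negExp_ne_top _))
    exact (continuous_negExp.tendsto _).comp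
      (ENNReal.Tendsto.const_mul hDjlim (Or.inr hc))

end SpectrumSharing

/-! ### The process seen from its smallest point. -/

namespace SpectrumSharing

open Filter Topology

/-- The upper end point of the interval of length `1 / (j + 1)` that contains `z`. -/
noncomputable def gridCeil (j : ℕ) (z : ℝ) : ℝ := ⌈((j : ℝ) + 1) * z⌉₊ / ((j : ℝ) + 1)

lemma measurable_gridCeil (j : ℕ) : Measurable (gridCeil j) := by
  unfold gridCeil
  have : Measurable fun z : ℝ => ((⌈((j : ℝ) + 1) * z⌉₊ : ℕ) : ℝ) :=
    (measurable_from_top (f := fun n : ℕ => (n : ℝ))).comp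
      (Nat.measurable_ceil.comp (measurable_const_mul _))
  exact this.div_const _

lemma le_gridCeil (j : ℕ) (z : ℝ) : z ≤ gridCeil j z := by
  rw [gridCeil, le_div_iff₀ (by positivity), mul_comm]
  exact Nat.le_ceil _

lemma tendsto_gridCeil {z : ℝ} (hz : 0 < z) : Tendsto (fun j => gridCeil j z) atTop (𝓝 z) := by
  have h : Tendsto (fun j : ℕ => z + 1 / ((j : ℝ) + 1)) atTop (𝓝 (z + 0)) :=
    tendsto_const_nhds.add tendsto_one_div_add_atTop_nhds_zero_nat
  rw [add_zero] at h
  refine tendsto_of_tendsto_of_tendsto_of_le_of_le tendsto_const_nhds h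
    (fun j => le_gridCeil j z) fun j => ?_
  have hj : (0 : ℝ) < (j : ℝ) + 1 := by positivity
  have e : (z + 1 / ((j : ℝ) + 1)) * ((j : ℝ) + 1) = ((j : ℝ) + 1) * z + 1 := by field_simp
  rw [gridCeil, div_le_iff₀ hj, e]
  exact (Nat.ceil_lt_add_one (by positivity)).le

lemma mem_Ioc_grid_iff {j k : ℕ} {z : ℝ} :
    z ∈ Ioc ((k : ℝ) / ((j : ℝ) + 1)) (((k : ℝ) + 1) / ((j : ℝ) + 1))
      ↔ ⌈((j : ℝ) + 1) * z⌉₊ = k + 1 := by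
  have hj : (0 : ℝ) < (j : ℝ) + 1 := by positivity
  rw [Nat.ceil_eq_iff (Nat.succ_ne_zero k), mem_Ioc, div_lt_iff₀ hj, le_div_iff₀ hj, mul_comm z]
  simp

/-- Splitting a quantity along the grid. -/
lemma tsum_indicator_grid (j : ℕ) {z : ℝ} (hz : 0 < z) (φ : ℝ → ℝ≥0∞) (Y : ℝ → ℝ≥0∞) :
    ∑' k : ℕ, (Ioc ((k : ℝ) / ((j : ℝ) + 1)) (((k : ℝ) + 1) / ((j : ℝ) + 1))).indicator φ z
        * Y (((k : ℝ) + 1) / ((j : ℝ) + 1)) = φ z * Y (gridCeil j z) := by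
  obtain ⟨k, hk⟩ : ∃ k, ⌈((j : ℝ) + 1) * z⌉₊ = k + 1 := by
    refine Nat.exists_eq_succ_of_ne_zero (Nat.ceil_pos.2 (by positivity)).ne'
  rw [tsum_eq_single k, indicator_of_mem (mem_Ioc_grid_iff.2 hk), gridCeil, hk]
  · simp
  · intro k' hk'
    rw [indicator_of_notMem, zero_mul]
    rw [mem_Ioc_grid_iff, hk]
    omega

lemma tsum_eq_sum_add_tsum_ite (s : Finset ℕ) (k : ℕ → ℝ≥0∞) :
    ∑' m, k m = ∑ m ∈ s, k m + ∑' m, (if m ∈ s then 0 else k m) := by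
  have h : ∑ m ∈ s, k m = ∑' m, (if m ∈ s then k m else 0) := by
    rw [tsum_eq_sum (s := s) fun m hm => by simp [hm]]
    exact Finset.sum_congr rfl fun m hm => by simp [hm]
  rw [h, ← ENNReal.tsum_add]
  refine tsum_congr fun m => ?_
  split_ifs <;> simp

lemma tsum_le_one_of_forall_ne {f : ℕ → ℝ≥0∞} (h1 : ∀ n, f n ≤ 1)
    (h : ∀ n m, n ≠ m → f n ≠ 0 → f m = 0) : ∑' n, f n ≤ 1 := by
  by_cases hn : ∃ n, f n ≠ 0
  · obtain ⟨n, hn⟩ := hn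
    rw [tsum_eq_single n fun m hm => h n m hm.symm hn]
    exact h1 n
  · push Not at hn
    simp [hn]

variable {Ω : Type*} [MeasurableSpace Ω] {P : Measure Ω} {T : ℕ → Ω → ℝ} {c : ℝ≥0∞}

/-- The void probability is the Laplace functional of an infinite penalty on `(-∞, a]`. -/
lemma HasPoissonLaplace.measure_forall_le (hT : HasPoissonLaplace P T c)
    (hTm : ∀ n, Measurable (T n)) (a : ℝ) :
    P {ω | ∀ n, a < T n ω} = negExp (c * ENNReal.ofReal a) := by
  let g : ℝ → ℝ≥0∞ := (Iic a).indicator fun _ => ∞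
  have hg : Measurable g := measurable_const.indicator measurableSet_Iic
  have h := hT g hg
  have h0 : ∫⁻ u in Ioi 0, (1 - negExp (g u)) = ENNReal.ofReal a := by
    have e : ∀ u, 1 - negExp (g u) = (Iic a).indicator 1 u := fun u => by
      by_cases hu : u ∈ Iic a <;> simp [g, hu]
    simp_rw [e]
    rw [lintegral_indicator_one measurableSet_Iic, Measure.restrict_apply measurableSet_Iic,
      inter_comm, Ioi_inter_Iic, Real.volume_Ioc, sub_zero]
  rw [h0] at h
  rw [← h]
  have hs : MeasurableSet {ω | ∀ n, a < T n ω} := by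
    have : {ω | ∀ n, a < T n ω} = ⋂ n, T n ⁻¹' Ioi a := by ext; simp
    rw [this]
    exact MeasurableSet.iInter fun n => hTm n measurableSet_Ioi
  rw [← lintegral_indicator_one hs]
  refine lintegral_congr fun ω => ?_
  by_cases hω : ∀ n, a < T n ω
  · rw [indicator_of_mem (show ω ∈ {ω | ∀ n, a < T n ω} from hω)]
    have : ∀ n, g (T n ω) = 0 := fun n =>
      indicator_of_notMem (show T n ω ∉ Iic a from not_le.2 (hω n)) _
    simp [this]
  · rw [indicator_of_notMem (show ω ∉ {ω | ∀ n, a < T n ω} from hω)]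
    push Not at hω
    obtain ⟨n, hn⟩ := hω
    have : ∑' n, g (T n ω) = ∞ := ENNReal.tsum_eq_top_of_eq_top
      ⟨n, indicator_of_mem (show T n ω ∈ Iic a from hn) _⟩
    simp [this]

variable [IsProbabilityMeasure P]

/-- An infinite penalty on `(-∞, 0]` costs nothing in the integral over the half-line, so its
transform is one and no point lies there. -/
lemma HasPoissonLaplace.ae_pos (hT : HasPoissonLaplace P T c) (hTm : ∀ n, Measurable (T n)) :
    ∀ᵐ ω ∂P, ∀ n, 0 < T n ω := by
  let g : ℝ → ℝ≥0∞ := (Iic 0).indicator fun _ => ∞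
  have hg : Measurable g := measurable_const.indicator measurableSet_Iic
  have h := hT g hg
  have h0 : ∫⁻ u in Ioi 0, (1 - negExp (g u)) = 0 := by
    rw [setLIntegral_congr_fun (g := fun _ => 0) measurableSet_Ioi, lintegral_zero]
    intro u hu
    have hu' : u ∉ Iic (0 : ℝ) := by simpa using hu
    simp [g, indicator_of_notMem hu']
  rw [h0, mul_zero, negExp_zero] at h
  have h1 := ae_ne_top_of_tendsto_laplace (P := P) (J := fun _ ω => ∑' n, g (T n ω))
    (fun _ => Measurable.tsum fun n => hg.comp (hTm n)) (by rw [h]; exact tendsto_const_nhds)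
  filter_upwards [h1] with ω ⟨_, hω⟩ n
  by_contra hn
  refine hω (ENNReal.tsum_eq_top_of_eq_top ⟨n, ?_⟩)
  exact indicator_of_mem (show T n ω ∈ Iic (0 : ℝ) from not_lt.1 hn) _

/-- The Laplace functional seen from the smallest of the points `T n`, for an interaction `g`
which only depends on ratios and forbids ratios up to one. -/
lemma HasPoissonLaplace.lintegral_tsum_min (hT : HasPoissonLaplace P T c) (hc : c ≠ ∞) (hc0 : c ≠ 0)
    (hTm : ∀ n, Measurable (T n)) {ψ g : ℝ → ℝ≥0∞} (hψ : Measurable ψ) (hg : Measurable g)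
    (hg1 : ∀ v ≤ 1, g v = ∞) (hganti : Antitone g) (hgc : ContinuousOn g (Ioi 1))
    (hC : ∫⁻ u in Ioi 0, (1 - negExp (g u)) ≠ ∞)
    (hreg : ∀ᵐ ω ∂P, ∀ a > 0, ∃ s : Finset ℕ, ∑' m, (if m ∈ s then 0 else g (T m ω / a)) ≠ ∞) :
    ∫⁻ ω, ∑' n, negExp (ψ (T n ω)) * negExp (sumExcept n fun m => g (T m ω / T n ω)) ∂P
      = ∫⁻ z in Ioi 0, c * negExp (ψ z) *
          negExp (c * (ENNReal.ofReal z * ∫⁻ u in Ioi 0, (1 - negExp (g u)))) := by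
  set C := ∫⁻ u in Ioi 0, (1 - negExp (g u)) with hCdef
  -- Cells of length `1 / (j + 1)`. Dividing by the upper end point `a j k` makes every ratio from
  -- the cell at most one, so `g` is infinite on the whole cell as the Campbell formula requires.
  let A : ℕ → ℕ → Set ℝ := fun j k =>
    Ioc ((k : ℝ) / ((j : ℝ) + 1)) (((k : ℝ) + 1) / ((j : ℝ) + 1))
  let a : ℕ → ℕ → ℝ := fun j k => ((k : ℝ) + 1) / ((j : ℝ) + 1)
  have ha : ∀ j k, 0 < a j k := fun j k => by positivity
  let φ : ℝ → ℝ≥0∞ := fun u => negExp (ψ u)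
  have hφ : Measurable φ := measurable_negExp.comp hψ
  let F : ℕ → Ω → ℝ≥0∞ := fun j ω =>
    ∑' n, φ (T n ω) * negExp (sumExcept n fun m => g (T m ω / gridCeil j (T n ω)))
  have hFm : ∀ j, Measurable (F j) := fun j => by
    refine Measurable.tsum fun n => (hφ.comp (hTm n)).mul (measurable_negExp.comp ?_)
    refine measurable_sumExcept n fun m => hg.comp ((hTm m).div ?_)
    exact (measurable_gridCeil j).comp (hTm n)
  have hscale : ∀ b : ℝ, 0 < b →
      ∫⁻ u in Ioi 0, (1 - negExp (g (u / b))) = ENNReal.ofReal b * C := fun b hb => by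
    have := lintegral_Ioi_comp_mul (F := fun u => 1 - negExp (g u)) (inv_pos.2 hb) 0
    rw [inv_inv, mul_zero] at this
    rw [← this]
    simp_rw [div_eq_inv_mul]
  have hpos := hT.ae_pos hTm
  have hFint : ∀ j, ∫⁻ ω, F j ω ∂P
      = ∫⁻ z in Ioi 0, c * φ z * negExp (c * (ENNReal.ofReal (gridCeil j z) * C)) := fun j => by
    calc ∫⁻ ω, F j ω ∂P
        = ∫⁻ ω, ∑' k, ∑' n, (A j k).indicator φ (T n ω)
            * negExp (sumExcept n fun m => g (T m ω / a j k)) ∂P := by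
          refine lintegral_congr_ae ?_
          filter_upwards [hpos] with ω hω
          rw [ENNReal.tsum_comm]
          refine tsum_congr fun n => ?_
          exact (tsum_indicator_grid j (hω n) φ
            fun r => negExp (sumExcept n fun m => g (T m ω / r))).symm
      _ = ∑' k, c * (∫⁻ u in Ioi 0, (A j k).indicator φ u)
            * negExp (c * (ENNReal.ofReal (a j k) * C)) := by
          rw [lintegral_tsum]
          · congr 1; ext k
            rw [hT.lintegral_tsum_indicator hc hTm measurableSet_Ioc hψ
              (h := fun u => g (u / a j k)) (by fun_prop), hscale _ (ha j k)]
            · exact fun u hu => hg1 _ ((div_le_one (ha j k)).2 hu.2)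
            · rw [hscale _ (ha j k)]
              exact ENNReal.mul_ne_top ENNReal.ofReal_ne_top hC
          · intro k
            refine (Measurable.tsum fun n => ?_).aemeasurable
            refine ((hφ.indicator measurableSet_Ioc).comp (hTm n)).mul (measurable_negExp.comp ?_)
            exact measurable_sumExcept n fun m => hg.comp ((hTm m).div_const _)
      _ = ∫⁻ z in Ioi 0, ∑' k, (A j k).indicator φ z *
            (c * negExp (c * (ENNReal.ofReal (a j k) * C))) := by
          rw [lintegral_tsum fun k => ((hφ.indicator measurableSet_Ioc).mul_const _).aemeasurable]
          congr 1; ext k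
          rw [lintegral_mul_const _ (hφ.indicator measurableSet_Ioc)]
          ring
      _ = _ := by
          refine setLIntegral_congr_fun measurableSet_Ioi fun z hz => ?_
          have := tsum_indicator_grid j hz φ
            fun r => c * negExp (c * (ENNReal.ofReal r * C))
          simp only [A, a]
          rw [this]; ring
  -- Another point not beyond `T n` has ratio at most one and kills the `n`-th term. Hence at most
  -- one term of the sum survives, which bounds the sum by one.
  have hdead : ∀ j ω, (∀ n, 0 < T n ω) → ∀ n m, m ≠ n → T m ω ≤ T n ω →
      negExp (sumExcept n fun m => g (T m ω / gridCeil j (T n ω))) = 0 := fun j ω hω n m hmn hle => by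
    rw [negExp_eq_zero_iff]
    refine top_le_iff.1 (le_trans (hg1 _ ?_).symm.le
      (le_sumExcept hmn fun m => g (T m ω / gridCeil j (T n ω))))
    have := le_gridCeil j (T n ω)
    exact (div_le_one ((hω n).trans_le this)).2 (hle.trans this)
  have hdead' : ∀ ω, (∀ n, 0 < T n ω) → ∀ n m, m ≠ n → T m ω ≤ T n ω →
      negExp (sumExcept n fun m => g (T m ω / T n ω)) = 0 := fun ω hω n m hmn hle => by
    rw [negExp_eq_zero_iff]
    exact top_le_iff.1 (le_trans (hg1 _ ((div_le_one (hω n)).2 hle)).symm.le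
      (le_sumExcept hmn fun m => g (T m ω / T n ω)))
  refine tendsto_nhds_unique (f := fun j => ∫⁻ ω, F j ω ∂P) (l := atTop) ?_ ?_
  · refine tendsto_lintegral_of_dominated_convergence (fun _ => 1) hFm (fun j => ?_)
      (by simp) ?_
    · filter_upwards [hpos] with ω hω
      refine tsum_le_one_of_forall_ne (fun n => mul_le_one' (negExp_le_one _) (negExp_le_one _)) ?_
      intro n m hnm hn
      by_contra hm
      rcases le_total (T m ω) (T n ω) with h | h
      · exact hn (by rw [hdead j ω hω n m hnm.symm h, mul_zero])
      · exact hm (by rw [hdead j ω hω m n hnm h, mul_zero])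
    · filter_upwards [hpos, hreg] with ω hω hr
      by_cases hn : ∃ n, ∀ m, m ≠ n → T n ω < T m ω
      · obtain ⟨n, hn⟩ := hn
        have e1 : ∀ j, F j ω =
            φ (T n ω) * negExp (sumExcept n fun m => g (T m ω / gridCeil j (T n ω))) := fun j =>
          tsum_eq_single n fun m hm => by
            rw [hdead j ω hω m n hm.symm (hn m hm).le, mul_zero]
        rw [tsum_eq_single n fun m hm => by
          rw [hdead' ω hω m n hm.symm (hn m hm).le, mul_zero]]
        simp_rw [e1]
        refine ENNReal.Tendsto.const_mul ?_ (Or.inr (negExp_ne_top _))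
        refine (continuous_negExp.tendsto _).comp ?_
        have hlim := tendsto_gridCeil (hω n)
        have hterm : ∀ m, Tendsto (fun j => if m = n then 0 else g (T m ω / gridCeil j (T n ω))) atTop
            (𝓝 (if m = n then 0 else g (T m ω / T n ω))) := fun m => by
          split_ifs with hm
          · exact tendsto_const_nhds
          · have h1 : 1 < T m ω / T n ω := (one_lt_div (hω n)).2 (hn m hm)
            exact ((hgc.continuousAt (Ioi_mem_nhds h1)).tendsto).comp
              (tendsto_const_nhds.div hlim (hω n).ne')
        -- The grid point above `T n` is eventually below `T n + 1`. As `g` is antitone, the terms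
        -- outside `s` are then dominated by a convergent sum that does not depend on `j`.
        obtain ⟨s, hs⟩ := hr (T n ω + 1) (by linarith [hω n])
        unfold sumExcept
        refine Tendsto.congr (fun j => (tsum_eq_sum_add_tsum_ite s _).symm) ?_
        rw [tsum_eq_sum_add_tsum_ite s fun m => if m = n then 0 else g (T m ω / T n ω)]
        refine Tendsto.add (tendsto_finsetSum _ fun m _ => hterm m) ?_
        refine tendsto_tsum_of_dominated ?_ hs fun m => ?_
        · filter_upwards [hlim.eventually (gt_mem_nhds (lt_add_one _))] with j hj m
          split_ifs
          · exact le_rfl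
          · exact zero_le
          · refine hganti ?_
            exact div_le_div_of_nonneg_left (hω m).le ((hω n).trans_le (le_gridCeil _ _)) hj.le
        · by_cases hm : m ∈ s
          · simp only [if_pos hm]
            exact tendsto_const_nhds
          · simp only [if_neg hm]
            exact hterm m
      -- Without a strictly smallest point every term vanishes, both along the grid and in the
      -- limit.
      · push Not at hn
        have e1 : ∀ j, F j ω = 0 := fun j => by
          refine ENNReal.tsum_eq_zero.2 fun n => ?_
          obtain ⟨m, hm, hle⟩ := hn n
          rw [hdead j ω hω n m hm hle, mul_zero]
        simp_rw [e1]
        rw [ENNReal.tsum_eq_zero.2 fun n => ?_]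
        · exact tendsto_const_nhds
        · obtain ⟨m, hm, hle⟩ := hn n
          rw [hdead' ω hω n m hm hle, mul_zero]
  · simp_rw [hFint]
    -- The interval `(0, 1]`, where `g` is infinite, alone contributes one. With `z ≤ gridCeil j z`
    -- this gives the integrable bound `c * e ^ (-c z)` for all `j`.
    have h1C : 1 ≤ C := by
      calc (1 : ℝ≥0∞) = ∫⁻ u in Ioc (0 : ℝ) 1, 1 := by simp
        _ = ∫⁻ u in Ioc (0 : ℝ) 1, (1 - negExp (g u)) := by
          refine setLIntegral_congr_fun measurableSet_Ioc fun u hu => ?_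
          simp [hg1 u hu.2]
        _ ≤ C := lintegral_mono_set Ioc_subset_Ioi_self
    refine tendsto_lintegral_of_dominated_convergence
      (fun z => c * negExp (c * ENNReal.ofReal z)) (fun j => ?_) (fun j => ?_) ?_ ?_
    · have := measurable_gridCeil j
      fun_prop
    · refine ae_of_all _ fun z => ?_
      change c * φ z * _ ≤ c * _
      rw [mul_assoc]
      gcongr c * ?_
      calc φ z * negExp (c * (ENNReal.ofReal (gridCeil j z) * C))
          ≤ 1 * negExp (c * (ENNReal.ofReal z * 1)) := by
            refine mul_le_mul' (negExp_le_one _) (antitone_negExp ?_)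
            gcongr
            exact le_gridCeil j z
        _ = _ := by rw [one_mul, mul_one]
    · rw [lintegral_const_mul _ (by fun_prop)]
      refine ENNReal.mul_ne_top hc ?_
      have hcr : 0 < c.toReal := ENNReal.toReal_pos hc0 hc
      have e : ∫⁻ z in Ioi 0, negExp (c * ENNReal.ofReal z)
          = ∫⁻ z in Ioi 0, ENNReal.ofReal (Real.exp (-c.toReal * z)) := by
        refine setLIntegral_congr_fun measurableSet_Ioi fun z hz => ?_
        have hz' : (0 : ℝ) < z := hz
        nth_rewrite 1 [← ENNReal.ofReal_toReal hc]
        rw [← ENNReal.ofReal_mul hcr.le, negExp_ofReal (by positivity), neg_mul]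
      rw [e]
      exact (exp_neg_integrableOn_Ioi 0 hcr).lintegral_lt_top.ne
    · filter_upwards [ae_restrict_mem measurableSet_Ioi] with z hz
      refine ENNReal.Tendsto.const_mul ?_ (Or.inr (ENNReal.mul_ne_top hc (negExp_ne_top _)))
      refine (continuous_negExp.tendsto _).comp
        (ENNReal.Tendsto.const_mul (ENNReal.Tendsto.mul_const ?_ (Or.inr hC)) (Or.inr hc))
      exact ENNReal.tendsto_ofReal (tendsto_gridCeil hz)

end SpectrumSharing

/-! ### The interaction caused by fading, and the functions `ρ`. -/

namespace SpectrumSharing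

open Filter Topology

/-- The logarithm of the Laplace transform of a faded signal with path loss `u ^ (α / 2)`. -/
noncomputable def fadeCost (α κ u : ℝ) : ℝ≥0∞ := ENNReal.ofReal (Real.log (1 + κ * u ^ (-(α / 2))))

/-- The interaction with a point at relative distance `v` of the nearest point. -/
noncomputable def minKernel (α β v : ℝ) : ℝ≥0∞ := if v ≤ 1 then ∞ else fadeCost α β v

@[fun_prop] lemma measurable_fadeCost (α κ : ℝ) : Measurable (fadeCost α κ) := by
  unfold fadeCost; fun_prop

@[fun_prop] lemma measurable_minKernel (α β : ℝ) : Measurable (minKernel α β) :=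
  Measurable.ite measurableSet_Iic measurable_const (measurable_fadeCost α β)

lemma fadeCost_zero (α u : ℝ) : fadeCost α 0 u = 0 := by simp [fadeCost]

lemma negExp_ofReal_log {x : ℝ} (hx : 0 ≤ x) :
    negExp (ENNReal.ofReal (Real.log (1 + x))) = ENNReal.ofReal (1 / (1 + x)) := by
  rw [negExp_ofReal (Real.log_nonneg (by linarith)), Real.exp_neg, Real.exp_log (by linarith),
    one_div]

/-- Here `1 - 1 / (1 + x) = 1 / (1 + 1 / x)` with `x = κ u ^ (-α/2)`, brought to the form of the
integrand of `ρ` by a dilation of `u`. -/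
lemma one_sub_negExp_fadeCost {α κ u : ℝ} (hα : 0 < α) (hκ : 0 < κ) (hu : 0 < u) :
    1 - negExp (fadeCost α κ u)
      = ENNReal.ofReal (1 / (1 + (κ ^ (-(2 / α)) * u) ^ (α / 2))) := by
  have hp : 0 < u ^ (α / 2) := Real.rpow_pos_of_pos hu _
  have hx : 0 ≤ κ * u ^ (-(α / 2)) := by positivity
  rw [fadeCost, negExp_ofReal_log hx, ← ENNReal.ofReal_one, ← ENNReal.ofReal_sub _ (by positivity)]
  congr 1
  rw [Real.mul_rpow (by positivity) hu.le, ← Real.rpow_mul hκ.le,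
    show -(2 / α) * (α / 2) = -1 by field_simp, Real.rpow_neg_one, Real.rpow_neg hu.le]
  field_simp
  ring

lemma integrableOn_one_div_one_add_rpow {a : ℝ} (ha : 1 < a) :
    IntegrableOn (fun ν : ℝ => 1 / (1 + ν ^ a)) (Ioi 0) := by
  have hm : Measurable fun ν : ℝ => 1 / (1 + ν ^ a) := by fun_prop
  have h0 : IntegrableOn (fun ν : ℝ => 1 / (1 + ν ^ a)) (Ioc 0 1) := by
    refine Integrable.mono' (g := fun _ => 1) (integrableOn_const (by simp) (by simp)) hm.aestronglyMeasurable ?_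
    filter_upwards [ae_restrict_mem measurableSet_Ioc] with ν hν
    have : 0 < ν ^ a := Real.rpow_pos_of_pos hν.1 _
    rw [Real.norm_of_nonneg (by positivity), div_le_one (by positivity)]
    linarith
  have h1 : IntegrableOn (fun ν : ℝ => 1 / (1 + ν ^ a)) (Ioi 1) := by
    refine Integrable.mono' (integrableOn_Ioi_rpow_of_lt (a := -a) (by linarith) one_pos)
      hm.aestronglyMeasurable ?_
    filter_upwards [ae_restrict_mem measurableSet_Ioi] with ν hν
    have h0 : (0 : ℝ) < ν := one_pos.trans hν
    have : 0 < ν ^ a := Real.rpow_pos_of_pos h0 _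
    rw [Real.norm_of_nonneg (by positivity), Real.rpow_neg h0.le, one_div]
    exact inv_anti₀ this (by linarith)
  have := h0.union h1
  rwa [Ioc_union_Ioi_eq_Ioi zero_le_one] at this

lemma lintegral_Ioi_one_div_one_add_rpow {a t : ℝ} (ha : 1 < a) (ht : 0 ≤ t) :
    ∫⁻ ν in Ioi t, ENNReal.ofReal (1 / (1 + ν ^ a))
      = ENNReal.ofReal (∫ ν in Ioi t, 1 / (1 + ν ^ a)) := by
  rw [ofReal_integral_eq_lintegral_ofReal
    ((integrableOn_one_div_one_add_rpow ha).mono_set (Ioi_subset_Ioi ht))]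
  filter_upwards [ae_restrict_mem measurableSet_Ioi] with ν hν
  have h0 : (0 : ℝ) < ν := ht.trans_lt hν
  simp only [Pi.zero_apply]
  positivity

lemma rhoInf_pos {α : ℝ} (hα : 2 < α) : 0 < rhoInf α := by
  rw [rhoInf, setIntegral_pos_iff_support_of_nonneg_ae]
  · refine lt_of_lt_of_le (b := volume (Ioi (0 : ℝ))) (by simp) (measure_mono fun x hx => ⟨?_, hx⟩)
    have : 0 < x ^ (α / 2) := Real.rpow_pos_of_pos hx _
    simp only [Function.mem_support]
    positivity
  · filter_upwards [ae_restrict_mem measurableSet_Ioi] with ν hν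
    have h0 : (0 : ℝ) < ν := hν
    simp only [Pi.zero_apply]
    positivity
  · exact integrableOn_one_div_one_add_rpow (by linarith)

lemma rho_nonneg {α β : ℝ} (hβ : 0 ≤ β) : 0 ≤ rho α β := by
  refine setIntegral_nonneg measurableSet_Ioi fun ν hν => ?_
  have h0 : (0 : ℝ) ≤ ν := (Real.rpow_nonneg hβ _).trans (le_of_lt hν)
  positivity

/-- The substitution `ν = κ ^ (-2/α) * u` gives both constants: `t = 0` leads to `ρ(α, ∞)`, and `t =
1` with `κ = β` leads to `ρ(α, β)`. -/
lemma lintegral_one_sub_negExp_fadeCost {α κ t : ℝ} (hα : 2 < α) (hκ : 0 < κ) (ht : 0 ≤ t) :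
    ∫⁻ u in Ioi t, (1 - negExp (fadeCost α κ u))
      = ENNReal.ofReal (κ ^ (2 / α) * ∫ ν in Ioi (κ ^ (-(2 / α)) * t), 1 / (1 + ν ^ (α / 2))) := by
  have hk : 0 < κ ^ (-(2 / α)) := Real.rpow_pos_of_pos hκ _
  rw [setLIntegral_congr_fun (g := fun u =>
      ENNReal.ofReal (1 / (1 + (κ ^ (-(2 / α)) * u) ^ (α / 2)))) measurableSet_Ioi
      fun u hu => one_sub_negExp_fadeCost (by linarith) hκ (ht.trans_lt hu),
    lintegral_Ioi_comp_mul (F := fun u => ENNReal.ofReal (1 / (1 + u ^ (α / 2)))) hk,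
    lintegral_Ioi_one_div_one_add_rpow (by linarith) (by positivity),
    ← ENNReal.ofReal_mul (by positivity), ← Real.rpow_neg hκ.le, neg_neg]

lemma lintegral_one_sub_negExp_fadeCost_zero {α κ : ℝ} (hα : 2 < α) (hκ : 0 < κ) :
    ∫⁻ u in Ioi 0, (1 - negExp (fadeCost α κ u)) = ENNReal.ofReal (κ ^ (2 / α) * rhoInf α) := by
  rw [lintegral_one_sub_negExp_fadeCost hα hκ le_rfl, mul_zero, rhoInf]

/-- The summand one is the length of the forbidden interval. After scaling by `z` it yields the void
factor `e ^ (-c z)`. -/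
lemma lintegral_one_sub_negExp_minKernel_eq_add (α β : ℝ) :
    ∫⁻ u in Ioi 0, (1 - negExp (minKernel α β u))
      = 1 + ∫⁻ u in Ioi 1, (1 - negExp (fadeCost α β u)) := by
  rw [← Ioc_union_Ioi_eq_Ioi (zero_le_one' ℝ), lintegral_union measurableSet_Ioi
    (Set.disjoint_left.2 fun x hx hx' => not_le.2 (mem_Ioi.1 hx') hx.2)]
  congr 1
  · rw [setLIntegral_congr_fun (g := fun _ => 1) measurableSet_Ioc fun u hu => by
      simp [minKernel, hu.2]]
    simp
  · exact setLIntegral_congr_fun measurableSet_Ioi fun u hu => by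
      simp only [minKernel, if_neg (not_le.2 (mem_Ioi.1 hu))]

lemma lintegral_one_sub_negExp_minKernel {α β : ℝ} (hα : 2 < α) (hβ : 0 < β) :
    ∫⁻ u in Ioi 0, (1 - negExp (minKernel α β u))
      = ENNReal.ofReal (1 + β ^ (2 / α) * rho α β) := by
  have := rho_nonneg (α := α) hβ.le
  rw [lintegral_one_sub_negExp_minKernel_eq_add, lintegral_one_sub_negExp_fadeCost hα hβ zero_le_one,
    ENNReal.ofReal_add zero_le_one (by positivity), ENNReal.ofReal_one, mul_one, rho, neg_div]

lemma lintegral_one_sub_negExp_minKernel_zero (α : ℝ) :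
    ∫⁻ u in Ioi 0, (1 - negExp (minKernel α 0 u)) = 1 := by
  simp [lintegral_one_sub_negExp_minKernel_eq_add, fadeCost_zero]

lemma fadeCost_antitoneOn {α β : ℝ} (hα : 0 < α) (hβ : 0 ≤ β) : AntitoneOn (fadeCost α β) (Ioi 0) := by
  intro u hu v _ huv
  have hu' : (0 : ℝ) < u := hu
  have hv' : 0 < v := hu'.trans_le huv
  have h : v ^ (-(α / 2)) ≤ u ^ (-(α / 2)) := Real.rpow_le_rpow_of_nonpos hu' huv (by linarith)
  have hv : 0 < v ^ (-(α / 2)) := Real.rpow_pos_of_pos hv' _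
  refine ENNReal.ofReal_le_ofReal (Real.log_le_log (by positivity) ?_)
  gcongr

lemma antitone_minKernel {α β : ℝ} (hα : 0 < α) (hβ : 0 ≤ β) : Antitone (minKernel α β) := by
  intro u v huv
  unfold minKernel
  split_ifs with h1 h2 h2
  · exact le_rfl
  · exact absurd (huv.trans h1) h2
  · exact le_top
  · have hu : 0 < u := one_pos.trans (not_le.1 h2)
    exact fadeCost_antitoneOn hα hβ hu (hu.trans_le huv) huv

lemma continuousOn_minKernel {α β : ℝ} (hβ : 0 ≤ β) : ContinuousOn (minKernel α β) (Ioi 1) := by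
  have h : ContinuousOn (fadeCost α β) (Ioi 1) := by
    refine ENNReal.continuous_ofReal.comp_continuousOn (ContinuousOn.log ?_ fun u hu => ?_)
    · refine continuousOn_const.add (continuousOn_const.mul ?_)
      exact continuousOn_id.rpow_const fun u hu => Or.inl (one_pos.trans hu).ne'
    · have : (0 : ℝ) < u := one_pos.trans hu
      positivity
  refine h.congr fun u hu => ?_
  rw [minKernel, if_neg (not_le.2 hu)]

/-- By Bernoulli, `1 + K x ≤ (1 + x) ^ K` for `K ≥ 1`. Finiteness of the total cost at one `κ₀ > 0`
thus carries over to every `κ`. -/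
lemma fadeCost_le_mul {α κ κ₀ K u : ℝ} (hκ : 0 ≤ κ) (hκ₀ : 0 ≤ κ₀) (hK : 1 ≤ K) (h : κ ≤ K * κ₀)
    (hu : 0 ≤ u) : fadeCost α κ u ≤ ENNReal.ofReal K * fadeCost α κ₀ u := by
  have hp : 0 ≤ u ^ (-(α / 2)) := Real.rpow_nonneg hu _
  rw [fadeCost, fadeCost, ← ENNReal.ofReal_mul (by linarith)]
  refine ENNReal.ofReal_le_ofReal ?_
  rw [← Real.log_rpow (by positivity)]
  refine Real.log_le_log (by positivity) ?_
  calc 1 + κ * u ^ (-(α / 2)) ≤ 1 + K * (κ₀ * u ^ (-(α / 2))) := by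
        rw [← mul_assoc]; gcongr
    _ ≤ _ := one_add_mul_self_le_rpow_one_add (by nlinarith [mul_nonneg hκ₀ hp]) hK

/-- A change of the reference distance is absorbed into `κ`; this links ratios of points with the
absolute interference. -/
lemma fadeCost_mul_rpow {α β a u : ℝ} (ha : 0 < a) (hu : 0 < u) :
    fadeCost α β (u / a) = fadeCost α (β * a ^ (α / 2)) u := by
  rw [fadeCost, fadeCost, Real.div_rpow hu.le ha.le, Real.rpow_neg ha.le, div_inv_eq_mul]
  congr 3; ring

variable {Ω : Type*} [MeasurableSpace Ω] {P : Measure Ω} {T : ℕ → Ω → ℝ} {c : ℝ≥0∞}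

lemma HasPoissonLaplace.lintegral_fadeCost (hT : HasPoissonLaplace P T c) {α κ : ℝ}
    (hα : 2 < α) (hκ : 0 < κ) :
    ∫⁻ ω, negExp (∑' m, fadeCost α κ (T m ω)) ∂P
      = negExp (c * ENNReal.ofReal (κ ^ (2 / α) * rhoInf α)) := by
  rw [hT _ (measurable_fadeCost α κ), lintegral_one_sub_negExp_fadeCost_zero hα hκ]

lemma tendsto_negExp_mul_rpow {c : ℝ≥0∞} (hc : c ≠ ∞) {p : ℝ} (hp : 0 < p) (r : ℝ) :
    Tendsto (fun n : ℕ => negExp (c * ENNReal.ofReal ((1 / ((n : ℝ) + 1)) ^ p * r))) atTop (𝓝 1) := by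
  have h1 : Tendsto (fun n : ℕ => (1 / ((n : ℝ) + 1)) ^ p * r) atTop (𝓝 (0 ^ p * r)) :=
    (tendsto_one_div_add_atTop_nhds_zero_nat.rpow_const (Or.inr hp.le)).mul_const r
  rw [Real.zero_rpow hp.ne', zero_mul] at h1
  have h2 := ENNReal.Tendsto.const_mul (a := c) (ENNReal.tendsto_ofReal h1) (Or.inr hc)
  simpa [Function.comp_def] using (continuous_negExp.tendsto _).comp h2

variable [IsProbabilityMeasure P]

/-- The transform of the total cost tends to one as `κ → 0`, so almost surely the cost is finite for
some `κ₀`. This forces finitely many points below `a` and, by comparison of costs, a finite tail. -/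
lemma HasPoissonLaplace.ae_regular (hT : HasPoissonLaplace P T c) (hc : c ≠ ∞)
    (hTm : ∀ n, Measurable (T n)) {α β : ℝ} (hα : 2 < α) (hβ : 0 ≤ β) :
    ∀ᵐ ω ∂P, ∀ a > 0, ∃ s : Finset ℕ,
      ∑' m, (if m ∈ s then 0 else minKernel α β (T m ω / a)) ≠ ∞ := by
  have hlap : Tendsto (fun n : ℕ => ∫⁻ ω, negExp (∑' m, fadeCost α (1 / ((n : ℝ) + 1)) (T m ω)) ∂P)
      atTop (𝓝 1) := by
    refine (tendsto_negExp_mul_rpow hc (p := 2 / α) (by positivity) (rhoInf α)).congr fun n => ?_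
    exact (hT.lintegral_fadeCost hα (by positivity)).symm
  have h1 := ae_ne_top_of_tendsto_laplace (fun n => Measurable.tsum fun m =>
    (measurable_fadeCost α _).comp (hTm m)) hlap
  filter_upwards [h1, hT.ae_pos hTm] with ω ⟨n, hn⟩ hpos a ha
  set κ₀ : ℝ := 1 / ((n : ℝ) + 1)
  have hκ₀ : 0 < κ₀ := by positivity
  have hfin : {m | T m ω ≤ a}.Finite := by
    have ha0 : fadeCost α κ₀ a ≠ 0 := by
      refine (ENNReal.ofReal_pos.2 (Real.log_pos ?_)).ne'
      have : 0 < κ₀ * a ^ (-(α / 2)) := by positivity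
      linarith
    refine (ENNReal.finite_const_le_of_tsum_ne_top hn ha0).subset fun m hm => ?_
    exact fadeCost_antitoneOn (by linarith) hκ₀.le (hpos m) ha hm
  refine ⟨hfin.toFinset, ?_⟩
  -- Large enough for `β a ^ (α/2) ≤ K κ₀`, and at least one for Bernoulli's inequality.
  let K := max 1 (β * a ^ (α / 2) / κ₀)
  have hK : β * a ^ (α / 2) ≤ K * κ₀ := by
    rw [← div_le_iff₀ hκ₀]; exact le_max_right _ _
  refine ne_top_of_le_ne_top (ENNReal.mul_ne_top (ENNReal.ofReal_ne_top (r := K)) hn) ?_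
  rw [← ENNReal.tsum_mul_left]
  refine ENNReal.tsum_le_tsum fun m => ?_
  split_ifs with hm
  · exact zero_le
  · have hm' : a < T m ω := by simpa using hm
    rw [minKernel, if_neg (not_le.2 ((one_lt_div ha).2 hm')), fadeCost_mul_rpow ha (hpos m)]
    exact fadeCost_le_mul (by positivity) hκ₀.le (le_max_left _ _) hK (hpos m).le

lemma HasPoissonLaplace.lintegral_tsum_minKernel (hT : HasPoissonLaplace P T c) (hc : c ≠ ∞)
    (hc0 : c ≠ 0) (hTm : ∀ n, Measurable (T n)) {α β : ℝ} (hα : 2 < α) (hβ : 0 < β)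
    {ψ : ℝ → ℝ≥0∞} (hψ : Measurable ψ) :
    ∫⁻ ω, ∑' n, negExp (ψ (T n ω)) * negExp (sumExcept n fun m => minKernel α β (T m ω / T n ω)) ∂P
      = ∫⁻ z in Ioi 0, c * negExp (ψ z) *
          negExp (c * (ENNReal.ofReal z * ENNReal.ofReal (1 + β ^ (2 / α) * rho α β))) := by
  have hC := lintegral_one_sub_negExp_minKernel hα hβ
  rw [hT.lintegral_tsum_min hc hc0 hTm hψ (measurable_minKernel α β)
    (fun v hv => by simp [minKernel, hv]) (antitone_minKernel (by linarith) hβ.le)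
    (continuousOn_minKernel hβ.le) (by rw [hC]; exact ENNReal.ofReal_ne_top)
    (hT.ae_regular hc hTm hα hβ.le), hC]

lemma lintegral_mul_negExp_mul (hc : c ≠ ∞) (hc0 : c ≠ 0) :
    ∫⁻ z in Ioi 0, c * negExp (c * ENNReal.ofReal z) = 1 := by
  have hcr : 0 < c.toReal := ENNReal.toReal_pos hc0 hc
  have e : ∫⁻ z in Ioi 0, c * negExp (c * ENNReal.ofReal z)
      = ∫⁻ z in Ioi 0, ENNReal.ofReal (c.toReal * Real.exp (-c.toReal * z)) := by
    refine setLIntegral_congr_fun measurableSet_Ioi fun z hz => ?_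
    have hz' : (0 : ℝ) < z := hz
    rw [ENNReal.ofReal_mul hcr.le, ENNReal.ofReal_toReal hc]
    congr 1
    nth_rewrite 1 [← ENNReal.ofReal_toReal hc]
    rw [← ENNReal.ofReal_mul hcr.le, negExp_ofReal (by positivity), neg_mul]
  rw [e, ← ofReal_integral_eq_lintegral_ofReal ((exp_neg_integrableOn_Ioi 0 hcr).const_mul _)
    (ae_of_all _ fun z => by simp only [Pi.zero_apply]; positivity), integral_const_mul,
    integral_exp_mul_Ioi (by linarith)]
  simp [hcr.ne']

/-- Almost surely exactly one of the points `T n` is strictly smaller than all others. -/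
lemma HasPoissonLaplace.ae_exists_min (hT : HasPoissonLaplace P T c) (hc : c ≠ ∞)
    (hc0 : c ≠ 0) (hTm : ∀ n, Measurable (T n)) :
    ∀ᵐ ω ∂P, ∃ n, ∀ m, m ≠ n → T n ω < T m ω := by
  -- With `β = 0` only the exclusion of ratios up to one remains; the exponent `3` is just an
  -- admissible value above two.
  have h := hT.lintegral_tsum_min hc hc0 hTm (ψ := 0) measurable_zero (measurable_minKernel 3 0)
    (fun v hv => by simp [minKernel, hv]) (antitone_minKernel (by norm_num) le_rfl)
    (continuousOn_minKernel le_rfl)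
    (by rw [lintegral_one_sub_negExp_minKernel_zero]; exact ENNReal.one_ne_top)
    (hT.ae_regular hc hTm (by norm_num) le_rfl)
  rw [lintegral_one_sub_negExp_minKernel_zero] at h
  simp only [Pi.zero_apply, negExp_zero, mul_one, one_mul] at h
  rw [lintegral_mul_negExp_mul hc hc0] at h
  have hs : MeasurableSet {ω | ∃ n, ∀ m, m ≠ n → T n ω < T m ω} := by
    have : {ω | ∃ n, ∀ m, m ≠ n → T n ω < T m ω}
        = ⋃ n, ⋂ m, ⋂ (_ : m ≠ n), {ω | T n ω < T m ω} := by ext; simp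
    rw [this]
    exact MeasurableSet.iUnion fun n => MeasurableSet.iInter fun m => MeasurableSet.iInter fun _ =>
      measurableSet_lt (hTm n) (hTm m)
  refine (mem_ae_iff_prob_eq_one hs).2 (le_antisymm prob_le_one ?_)
  -- The sum has expectation one, is at most one where a strict minimum exists, and is zero
  -- elsewhere. The probability of a strict minimum is therefore one.
  rw [← h, ← lintegral_indicator_one hs]
  refine lintegral_mono_ae ?_
  filter_upwards [hT.ae_pos hTm] with ω hpos
  have hdead : ∀ n m, m ≠ n → T m ω ≤ T n ω →
      negExp (sumExcept n fun m => minKernel 3 0 (T m ω / T n ω)) = 0 := fun n m hmn hle => by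
    rw [negExp_eq_zero_iff]
    refine top_le_iff.1 (le_trans (le_of_eq ?_)
      (le_sumExcept hmn fun m => minKernel 3 0 (T m ω / T n ω)))
    rw [minKernel, if_pos ((div_le_one (hpos n)).2 hle)]
  by_cases hω : ∃ n, ∀ m, m ≠ n → T n ω < T m ω
  · rw [indicator_of_mem (show ω ∈ {ω | ∃ n, ∀ m, m ≠ n → T n ω < T m ω} from hω)]
    refine tsum_le_one_of_forall_ne (fun n => negExp_le_one _) fun n m hnm hn => ?_
    by_contra hm
    rcases le_total (T m ω) (T n ω) with h | h
    · exact hn (hdead n m hnm.symm h)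
    · exact hm (hdead m n hnm h)
  · refine (ENNReal.tsum_eq_zero.2 fun n => ?_).le.trans zero_le
    push Not at hω
    obtain ⟨m, hm, hle⟩ := hω n
    exact hdead n m hm hle

end SpectrumSharing

/-! ### Exponential gains and independence of groups of sources. -/

namespace SpectrumSharing

open Filter Topology

lemma lintegral_expMeasure_one {f : ℝ → ℝ≥0∞} (hf : Measurable f) :
    ∫⁻ x, f x ∂(expMeasure 1) = ∫⁻ x in Ioi 0, ENNReal.ofReal (Real.exp (-x)) * f x := by
  have h : expMeasure 1 = volume.withDensity (exponentialPDF 1) := rfl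
  have hm : Measurable (exponentialPDF 1) := (measurable_exponentialPDFReal 1).ennreal_ofReal
  rw [h, lintegral_withDensity_eq_lintegral_mul _ hm hf, restrict_Ioi_eq_restrict_Ici,
    ← lintegral_indicator measurableSet_Ici]
  refine lintegral_congr fun x => ?_
  by_cases hx : 0 ≤ x
  · rw [indicator_of_mem (show x ∈ Ici 0 from hx), Pi.mul_apply, exponentialPDF_of_nonneg hx]
    simp
  · rw [indicator_of_notMem (show x ∉ Ici 0 from hx), Pi.mul_apply,
      exponentialPDF_of_neg (not_le.1 hx), zero_mul]

lemma lintegral_Ioi_exp_neg_mul {a : ℝ} (ha : 0 < a) (t : ℝ) :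
    ∫⁻ x in Ioi t, ENNReal.ofReal (Real.exp (-(a * x)))
      = ENNReal.ofReal (Real.exp (-(a * t)) / a) := by
  have h := exp_neg_integrableOn_Ioi t ha
  simp only [neg_mul] at h
  rw [← ofReal_integral_eq_lintegral_ofReal h (ae_of_all _ fun x => (Real.exp_pos _).le)]
  simp_rw [← neg_mul]
  rw [integral_exp_mul_Ioi (by linarith), neg_div_neg_eq]

/-- The exponential tail at a level in `[0, ∞]`: this is where coverage becomes a Laplace transform.
-/
lemma expMeasure_one_lt_ofReal (Y : ℝ≥0∞) :
    expMeasure 1 {x | Y < ENNReal.ofReal x} = negExp Y := by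
  induction Y using ENNReal.recTopCoe with
  | top => simp
  | coe y =>
    have hs : {x : ℝ | (y : ℝ≥0∞) < ENNReal.ofReal x} = Ioi (y : ℝ) := by
      ext x
      rw [← ENNReal.ofReal_coe_nnreal]
      exact ENNReal.ofReal_lt_ofReal_iff_of_nonneg y.coe_nonneg
    rw [hs, ← lintegral_indicator_one measurableSet_Ioi,
      lintegral_expMeasure_one (measurable_one.indicator measurableSet_Ioi)]
    have : ∀ x, ENNReal.ofReal (Real.exp (-x)) * (Ioi (y : ℝ)).indicator 1 x
        = (Ioi (y : ℝ)).indicator (fun x => ENNReal.ofReal (Real.exp (-(1 * x)))) x := fun x => by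
      by_cases hx : x ∈ Ioi (y : ℝ) <;> simp [hx]
    simp_rw [this]
    rw [lintegral_indicator measurableSet_Ioi, Measure.restrict_restrict measurableSet_Ioi,
      inter_eq_self_of_subset_left (Ioi_subset_Ioi y.coe_nonneg), lintegral_Ioi_exp_neg_mul one_pos,
      one_mul, div_one, ← negExp_ofReal y.coe_nonneg, ENNReal.ofReal_coe_nnreal]

/-- The transform of a unit exponential is `1 / (1 + a)`; its logarithm is what `fadeCost` records.
-/
lemma lintegral_negExp_mul_expMeasure_one {a : ℝ} (ha : 0 ≤ a) :
    ∫⁻ x, negExp (ENNReal.ofReal a * ENNReal.ofReal x) ∂(expMeasure 1)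
      = negExp (ENNReal.ofReal (Real.log (1 + a))) := by
  rw [lintegral_expMeasure_one (by fun_prop), negExp_ofReal_log ha]
  rw [setLIntegral_congr_fun (g := fun x => ENNReal.ofReal (Real.exp (-((1 + a) * x))))
    measurableSet_Ioi fun x hx => ?_, lintegral_Ioi_exp_neg_mul (by linarith)]
  · simp
  · have hx' : (0 : ℝ) < x := hx
    simp only
    rw [← ENNReal.ofReal_mul ha, negExp_ofReal (by positivity),
      ← ENNReal.ofReal_mul (Real.exp_nonneg _), ← Real.exp_add]
    congr 2; ring

lemma ae_pos_expMeasure_one : ∀ᵐ x ∂(expMeasure 1), 0 < x := by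
  have hs : MeasurableSet {x : ℝ | 0 < x} := measurableSet_Ioi
  have := isProbabilityMeasure_expMeasure one_pos
  refine (mem_ae_iff_prob_eq_one hs).2 ?_
  have h := expMeasure_one_lt_ofReal 0
  simpa using h

lemma lintegral_rpow_expMeasure_one {p : ℝ} (hp : 0 < p) :
    ∫⁻ x, ENNReal.ofReal (x ^ p) ∂(expMeasure 1) = ENNReal.ofReal (Real.Gamma (p + 1)) := by
  have hI := Real.GammaIntegral_convergent (s := p + 1) (by linarith)
  rw [lintegral_expMeasure_one (by fun_prop), Real.Gamma_eq_integral (by linarith),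
    ofReal_integral_eq_lintegral_ofReal hI]
  · refine setLIntegral_congr_fun measurableSet_Ioi fun x hx => ?_
    rw [← ENNReal.ofReal_mul (Real.exp_nonneg _), add_sub_cancel_right]
  · filter_upwards [ae_restrict_mem measurableSet_Ioi] with x hx
    have hx' : (0 : ℝ) < x := hx
    simp only [Pi.zero_apply]
    positivity

lemma indepFun_of_iIndep_of_disjoint {Ω ι E F : Type*} [mΩ : MeasurableSpace Ω]
    [MeasurableSpace E] [MeasurableSpace F] {P : Measure Ω} {m : ι → MeasurableSpace Ω}
    (hle : ∀ i, m i ≤ mΩ) (h : iIndep m P) {s t : Set ι} (hst : Disjoint s t) {f : Ω → E}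
    {g : Ω → F} (hf : Measurable[⨆ i ∈ s, m i] f) (hg : Measurable[⨆ i ∈ t, m i] g) :
    IndepFun f g P := by
  rw [IndepFun_iff_Indep]
  exact indep_of_indep_of_le_left (indep_of_indep_of_le_right
    (indep_iSup_of_disjoint hle h hst) hg.comap_le) hf.comap_le

lemma measurable_iSup_of_mem {Ω ι E : Type*} [mE : MeasurableSpace E]
    {m : ι → MeasurableSpace Ω} {s : Set ι} {i : ι} (hi : i ∈ s) {f : Ω → E}
    (h : MeasurableSpace.comap f mE ≤ m i) : Measurable[⨆ i ∈ s, m i] f :=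
  measurable_iff_comap_le.2 (h.trans (le_iSup₂_of_le i hi le_rfl))

lemma measurable_seq_iSup_of_mem {Ω ι E : Type*} [mE : MeasurableSpace E]
    {m : ι → MeasurableSpace Ω} {s : Set ι} {i : ℕ → ι} (hi : ∀ n, i n ∈ s) {f : ℕ → Ω → E}
    (h : ∀ n, MeasurableSpace.comap (f n) mE ≤ m (i n)) :
    Measurable[⨆ i ∈ s, m i] fun ω n => f n ω :=
  @measurable_pi_lambda _ _ _ (⨆ i ∈ s, m i) _ _ fun n => measurable_iSup_of_mem (hi n) (h n)

/-! ### The maximum allowed power and its moment of order `2/α`. -/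

section Reference

variable {S B Ω : Type*} {N : Params S B} [MeasurableSpace Ω] {P : Measure Ω}
  {R : Network N Ω}

lemma Network.IsModel.refSigma_le (hR : R.IsModel P) (l : N.Band) (i : Option ℕ) :
    R.refSigma l i ≤ (inferInstance : MeasurableSpace Ω) := by
  cases i with
  | none => exact (measurable_pi_lambda _ (hR.userS_ppp l.1).measurable).comap_le
  | some i => exact (hR.refGain_meas l i).comap_le

/-- The path losses from the reference base station to the users of the seller owning `l`. -/
noncomputable def Network.refPoint (R : Network N Ω) (l : N.Band) : ℕ → Ω → ℝ :=
  lossPoint N.α R.refSite (R.refGain l) (R.userS l.1)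

lemma Network.IsModel.measurable_refPoint (hR : R.IsModel P) (l : N.Band) (n : ℕ) :
    Measurable (R.refPoint l n) :=
  measurable_lossPoint (hR.refGain_meas l) (hR.userS_ppp l.1).measurable n

lemma Network.IsModel.measurable_refPow (hR : R.IsModel P) (l : N.Band) :
    Measurable (R.refPow l) := by
  have h1 := hR.refGain_meas l
  have h2 := (hR.userS_ppp l.1).measurable
  unfold Network.refPow Network.refH
  fun_prop

variable [IsProbabilityMeasure P]

/-- The users are marked by their channel gains, and the moment of order `2/α` of a unit exponential
is `Γ(2/α + 1)`. -/
lemma Network.IsModel.hasPoissonLaplace_refPoint (hR : R.IsModel P) (l : N.Band) :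
    HasPoissonLaplace P (R.refPoint l) (ENNReal.ofReal (Real.pi * N.muS l.1) *
      ENNReal.ofReal (Real.Gamma (2 / N.α + 1))) := by
  have hα := N.α_gt
  rw [← lintegral_rpow_expMeasure_one (p := 2 / N.α) (by positivity)]
  have := isProbabilityMeasure_expMeasure one_pos
  refine (hR.userS_ppp l.1).hasPoissonLaplace_lossPoint (hR.refGain_meas l) ?_
    (fun n => (hR.refGain_law l n).map_eq) ae_pos_expMeasure_one ?_ _ _
  · exact (hR.ref_indep l).precomp (Option.some_injective ℕ)
  · refine indepFun_of_iIndep_of_disjoint (hR.refSigma_le l) (hR.ref_indep l)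
      (s := {none}) (t := Set.range some) (by simp) ?_ ?_
    · exact measurable_iSup_of_mem (m := R.refSigma l) (s := {none}) (i := none) rfl le_rfl
    · exact measurable_seq_iSup_of_mem (m := R.refSigma l) (s := Set.range some) (i := some)
        (fun n => ⟨n, rfl⟩) fun n => le_rfl

/-- Each interference gain is `u ^ (-α/2)` at a user point `u`, so the supremum `refH` dominates all
of them. Inverting gives a bound on the power by every user point. -/
lemma Network.IsModel.ae_refPow (hR : R.IsModel P) (l : N.Band) :
    ∀ᵐ ω ∂P, 0 < R.refPow l ω ∧
      ∀ n, R.refPow l ω ^ (2 / N.α) ≤ N.ζ l.1 ^ (2 / N.α) * R.refPoint l n ω := by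
  have hα := N.α_gt
  have hT := hR.hasPoissonLaplace_refPoint l
  set c := ENNReal.ofReal (Real.pi * N.muS l.1) * ENNReal.ofReal (Real.Gamma (2 / N.α + 1))
  have hc : c ≠ ∞ := ENNReal.mul_ne_top ENNReal.ofReal_ne_top ENNReal.ofReal_ne_top
  have hTm := hR.measurable_refPoint l
  -- The user points stay away from zero, since the void probability of `(0, 1 / (k + 1)]` tends to
  -- one. Without this the real supremum could be that of an unbounded set, which has the default
  -- value zero.
  have hbdd : ∀ᵐ ω ∂P, ∃ k : ℕ, ∀ n, 1 / ((k : ℝ) + 1) < R.refPoint l n ω := by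
    have hs : MeasurableSet {ω | ∃ k : ℕ, ∀ n, 1 / ((k : ℝ) + 1) < R.refPoint l n ω} := by
      have : {ω | ∃ k : ℕ, ∀ n, 1 / ((k : ℝ) + 1) < R.refPoint l n ω}
          = ⋃ k : ℕ, ⋂ n, {ω | 1 / ((k : ℝ) + 1) < R.refPoint l n ω} := by ext; simp
      rw [this]
      exact MeasurableSet.iUnion fun k => MeasurableSet.iInter fun n =>
        measurableSet_lt measurable_const (hTm n)
    refine (mem_ae_iff_prob_eq_one hs).2 (le_antisymm prob_le_one ?_)
    have hlim := tendsto_negExp_mul_rpow hc one_pos 1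
    refine le_of_tendsto' hlim fun k => ?_
    rw [Real.rpow_one, mul_one, ← hT.measure_forall_le hTm]
    exact measure_mono fun ω hω => ⟨k, hω⟩
  have hgpos : ∀ᵐ ω ∂P, ∀ n, 0 < R.refGain l n ω := ae_all_iff.2 fun n => by
    have := ae_pos_expMeasure_one
    rw [← (hR.refGain_law l n).map_eq] at this
    exact ae_of_ae_map (hR.refGain_meas l n).aemeasurable this
  filter_upwards [hbdd, hgpos, hT.ae_pos hTm] with ω ⟨k, hk⟩ hg hpos
  have hU : ∀ n, R.refGain l n ω * ‖R.refSite - R.userS l.1 n ω‖ ^ (-N.α)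
      = R.refPoint l n ω ^ (-(N.α / 2)) := fun n => by
    rw [Network.refPoint, lossPoint_rpow (by linarith) (hg n).le, norm_sub_rev]
  have hbd : BddAbove (range fun n => R.refGain l n ω * ‖R.refSite - R.userS l.1 n ω‖ ^ (-N.α)) := by
    refine ⟨(1 / ((k : ℝ) + 1)) ^ (-(N.α / 2)), ?_⟩
    rintro _ ⟨n, rfl⟩
    simp only [hU]
    exact Real.rpow_le_rpow_of_nonpos (by positivity) (hk n).le (by linarith)
  have hle : ∀ n, R.refPoint l n ω ^ (-(N.α / 2)) ≤ R.refH l ω := fun n => by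
    rw [← hU n]; exact le_ciSup hbd n
  have hUpos : ∀ n, 0 < R.refPoint l n ω ^ (-(N.α / 2)) := fun n => Real.rpow_pos_of_pos (hpos n) _
  have hH : 0 < R.refH l ω := (hUpos 0).trans_le (hle 0)
  have hζ := N.ζ_pos l.1
  refine ⟨div_pos hζ hH, fun n => ?_⟩
  rw [Network.refPow, Real.div_rpow hζ.le hH.le, div_eq_mul_inv]
  gcongr
  rw [← Real.rpow_neg hH.le]
  calc R.refH l ω ^ (-(2 / N.α))
      ≤ (R.refPoint l n ω ^ (-(N.α / 2))) ^ (-(2 / N.α)) :=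
        Real.rpow_le_rpow_of_nonpos (hUpos n) (hle n) (by
          have : 0 < 2 / N.α := by positivity
          linarith)
    _ = R.refPoint l n ω := by
      rw [← Real.rpow_mul (hpos n).le, show -(N.α / 2) * -(2 / N.α) = 1 by field_simp,
        Real.rpow_one]

/-- The normalised power exceeds `t` only if all user points do, which has probability `e ^ (-c t)`;
the layer-cake formula integrates this tail. -/
lemma Network.IsModel.integrable_refPow_rpow (hR : R.IsModel P) (l : N.Band) :
    Integrable (fun ω => R.refPow l ω ^ (2 / N.α)) P := by
  have hα := N.α_gt
  have hT := hR.hasPoissonLaplace_refPoint l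
  set c := ENNReal.ofReal (Real.pi * N.muS l.1) * ENNReal.ofReal (Real.Gamma (2 / N.α + 1)) with hcdef
  have hc : c ≠ ∞ := ENNReal.mul_ne_top ENNReal.ofReal_ne_top ENNReal.ofReal_ne_top
  have hc0 : c ≠ 0 := by
    have h1 : 0 < Real.pi * N.muS l.1 := mul_pos Real.pi_pos (N.muS_pos _)
    have h2 : 0 < Real.Gamma (2 / N.α + 1) := Real.Gamma_pos_of_pos (by positivity)
    exact mul_ne_zero (ENNReal.ofReal_pos.2 h1).ne' (ENNReal.ofReal_pos.2 h2).ne'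
  have hTm := hR.measurable_refPoint l
  have hζ : 0 < N.ζ l.1 ^ (2 / N.α) := Real.rpow_pos_of_pos (N.ζ_pos _) _
  have hm : Measurable fun ω => R.refPow l ω ^ (2 / N.α) := (hR.measurable_refPow l).pow_const _
  have hq : Integrable (fun ω => R.refPow l ω ^ (2 / N.α) / N.ζ l.1 ^ (2 / N.α)) P := by
    have hnn : 0 ≤ᵐ[P] fun ω => R.refPow l ω ^ (2 / N.α) / N.ζ l.1 ^ (2 / N.α) := by
      filter_upwards [hR.ae_refPow l] with ω hω
      have := hω.1
      simp only [Pi.zero_apply]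
      positivity
    refine (lintegral_ofReal_ne_top_iff_integrable (hm.div_const _).aestronglyMeasurable hnn).1 ?_
    rw [lintegral_eq_lintegral_meas_lt P hnn (hm.div_const _).aemeasurable]
    have hfin : ∫⁻ z in Ioi 0, negExp (c * ENNReal.ofReal z) ≠ ∞ := by
      intro h
      have := lintegral_mul_negExp_mul hc hc0
      rw [lintegral_const_mul _ (by fun_prop), h, ENNReal.mul_top hc0] at this
      exact ENNReal.top_ne_one this
    refine ne_top_of_le_ne_top hfin (lintegral_mono fun t => ?_)
    rw [← hT.measure_forall_le hTm]
    refine measure_mono_ae ?_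
    filter_upwards [hR.ae_refPow l] with ω hω ht n
    refine lt_of_lt_of_le ht ?_
    rw [div_le_iff₀ hζ, mul_comm]
    exact hω.2 n
  have := hq.mul_const (N.ζ l.1 ^ (2 / N.α))
  refine this.congr (ae_of_all _ fun ω => ?_)
  exact div_mul_cancel₀ _ hζ.ne'

lemma Network.IsModel.powMoment_pos (hR : R.IsModel P) (l : N.Band) : 0 < R.powMoment P l := by
  have hpos : ∀ᵐ ω ∂P, 0 < R.refPow l ω ^ (2 / N.α) := by
    filter_upwards [hR.ae_refPow l] with ω hω using Real.rpow_pos_of_pos hω.1 _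
  rw [Network.powMoment, integral_pos_iff_support_of_nonneg_ae (hpos.mono fun ω h => h.le)
    (hR.integrable_refPow_rpow l)]
  have : P (Function.support fun ω => R.refPow l ω ^ (2 / N.α)) = 1 := by
    refine le_antisymm prob_le_one ?_
    rw [← measure_univ (μ := P)]
    refine measure_mono_ae ?_
    filter_upwards [hpos] with ω hω _ using hω.ne'
  rw [this]; exact one_pos

lemma Network.IsModel.lintegral_refPow_rpow (hR : R.IsModel P) (l : N.Band) :
    ∫⁻ p, ENNReal.ofReal (p ^ (2 / N.α)) ∂(P.map (R.refPow l)) = ENNReal.ofReal (R.powMoment P l) := by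
  rw [lintegral_map (by fun_prop) (hR.measurable_refPow l), Network.powMoment,
    ofReal_integral_eq_lintegral_ofReal (hR.integrable_refPow_rpow l)]
  filter_upwards [hR.ae_refPow l] with ω hω
  exact (Real.rpow_pos_of_pos hω.1 _).le

end Reference

end SpectrumSharing

/-! ### Interference and coverage for a process on the half-line. -/

namespace SpectrumSharing

open Filter Topology

/-- The sequences whose `n`-th term is strictly smaller than all others. -/
def strictMinAt (n : ℕ) : Set (ℕ → ℝ) := {t | ∀ m, m ≠ n → t n < t m}

lemma measurableSet_strictMinAt (n : ℕ) : MeasurableSet (strictMinAt n) := by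
  have : strictMinAt n = ⋂ m, ⋂ (_ : m ≠ n), {t | t n < t m} := by ext; simp [strictMinAt]
  rw [this]
  exact MeasurableSet.iInter fun m => MeasurableSet.iInter fun _ =>
    measurableSet_lt (measurable_pi_apply n) (measurable_pi_apply m)

/-- The power received with path loss `t ^ (α / 2)` and channel gain `h`. -/
noncomputable def signal (α t h : ℝ) : ℝ≥0∞ := ENNReal.ofReal (t ^ (-(α / 2))) * ENNReal.ofReal h

lemma measurable_signal (α : ℝ) : Measurable fun q : ℝ × ℝ => signal α q.1 q.2 := by
  unfold signal; fun_prop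

variable {Ω : Type*} [MeasurableSpace Ω] {P : Measure Ω} [IsProbabilityMeasure P]
  {T h : ℕ → Ω → ℝ} {c : ℝ≥0∞} {α : ℝ}

lemma lintegral_negExp_tsum_mul_gain (hh : ∀ n, Measurable (h n)) (hind : iIndepFun h P)
    (hlaw : ∀ n, P.map (h n) = expMeasure 1) {a : ℕ → ℝ} (ha : ∀ n, 0 ≤ a n) :
    ∫⁻ ω, negExp (∑' n, ENNReal.ofReal (a n) * ENNReal.ofReal (h n ω)) ∂P
      = negExp (∑' n, ENNReal.ofReal (Real.log (1 + a n))) := by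
  rw [lintegral_negExp_tsum_of_iIndepFun (W := fun n ω => ENNReal.ofReal (a n) * ENNReal.ofReal (h n ω))
    (fun n => by have := hh n; fun_prop)
    (hind.comp (fun n x => ENNReal.ofReal (a n) * ENNReal.ofReal x) fun n => by fun_prop)]
  congr 1
  refine tsum_congr fun n => negExp_injective ?_
  have e : ∫⁻ ω, negExp (ENNReal.ofReal (a n) * ENNReal.ofReal (h n ω)) ∂P
      = negExp (ENNReal.ofReal (Real.log (1 + a n))) := by
    rw [← lintegral_negExp_mul_expMeasure_one (ha n), ← hlaw n, lintegral_map (by fun_prop) (hh n)]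
  rw [e, negExp_negLog (negExp_le_one _)]

lemma lintegral_negExp_sumExcept_signal (hh : ∀ n, Measurable (h n)) (hind : iIndepFun h P)
    (hlaw : ∀ n, P.map (h n) = expMeasure 1) {t : ℕ → ℝ} (ht : ∀ m, 0 < t m) {κ : ℝ} (hκ : 0 ≤ κ)
    (n : ℕ) :
    ∫⁻ ω, negExp (ENNReal.ofReal κ * sumExcept n fun m => signal α (t m) (h m ω)) ∂P
      = negExp (sumExcept n fun m => fadeCost α κ (t m)) := by
  have hp : ∀ m, 0 < t m ^ (-(α / 2)) := fun m => Real.rpow_pos_of_pos (ht m) _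
  have := lintegral_negExp_tsum_mul_gain hh hind hlaw
    -- The excluded index is given the weight zero, which turns the sum into one over all gains.
    (a := fun m => if m = n then 0 else κ * t m ^ (-(α / 2))) fun m => by
      split_ifs
      · exact le_rfl
      · exact mul_nonneg hκ (hp m).le
  have e1 : ∀ ω, ENNReal.ofReal κ * sumExcept n (fun m => signal α (t m) (h m ω))
      = ∑' m, ENNReal.ofReal (if m = n then 0 else κ * t m ^ (-(α / 2))) * ENNReal.ofReal (h m ω) :=
    fun ω => by
      rw [sumExcept, ← ENNReal.tsum_mul_left]
      refine tsum_congr fun m => ?_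
      split_ifs
      · simp
      · rw [signal, ENNReal.ofReal_mul hκ, mul_assoc]
  have e2 : sumExcept n (fun m => fadeCost α κ (t m))
      = ∑' m, ENNReal.ofReal (Real.log (1 + if m = n then 0 else κ * t m ^ (-(α / 2)))) := by
    rw [sumExcept]
    refine tsum_congr fun m => ?_
    split_ifs
    · simp
    · rfl
  simp_rw [e1, e2]
  exact this

/-- The Laplace transform of the total faded power received from a Poisson process. -/
lemma HasPoissonLaplace.laplace_signal (hT : HasPoissonLaplace P T c)
    (hTm : ∀ n, Measurable (T n)) (hh : ∀ n, Measurable (h n)) (hind : iIndepFun h P)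
    (hlaw : ∀ n, P.map (h n) = expMeasure 1)
    (hTh : IndepFun (fun ω n => T n ω) (fun ω n => h n ω) P) (hα : 2 < α) {κ : ℝ} (hκ : 0 < κ) :
    ∫⁻ ω, negExp (ENNReal.ofReal κ * ∑' n, signal α (T n ω) (h n ω)) ∂P
      = negExp (c * ENNReal.ofReal (κ ^ (2 / α) * rhoInf α)) := by
  have hsig := measurable_signal α
  rw [← hT.lintegral_fadeCost hα hκ, lintegral_of_indepFun
    (f := fun t h => negExp (ENNReal.ofReal κ * ∑' n, signal α (t n) (h n)))
    (by fun_prop) (by fun_prop) hTh ?_]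
  · refine lintegral_congr_ae ?_
    filter_upwards [hT.ae_pos hTm] with ω hω
    have := lintegral_negExp_tsum_mul_gain hh hind hlaw (a := fun n => κ * T n ω ^ (-(α / 2)))
      fun n => mul_nonneg hκ.le (Real.rpow_nonneg (hω n).le _)
    have e1 : ∀ ω', ENNReal.ofReal κ * ∑' n, signal α (T n ω) (h n ω')
        = ∑' n, ENNReal.ofReal (κ * T n ω ^ (-(α / 2))) * ENNReal.ofReal (h n ω') := fun ω' => by
      rw [← ENNReal.tsum_mul_left]
      refine tsum_congr fun n => ?_
      rw [signal, ENNReal.ofReal_mul hκ.le, mul_assoc]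
    simp_rw [e1]
    exact this
  · refine measurable_negExp.comp (Measurable.const_mul (Measurable.tsum fun n => ?_) _)
    have h2 : Measurable fun q : (ℕ → ℝ) × (ℕ → ℝ) => (q.1 n, q.2 n) := by fun_prop
    exact hsig.comp h2

/-- The nearest point `n` is heard if its channel gain exceeds `excessLevel`. -/
noncomputable def excessLevel (α β s : ℝ) (n : ℕ) (t h : ℕ → ℝ) (j : ℝ≥0∞) : ℝ≥0∞ :=
  ENNReal.ofReal (β * t n ^ (α / 2)) * (sumExcept n (fun m => signal α (t m) (h m)) + j
    + ENNReal.ofReal s)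

lemma measurable_excessLevel (α β s : ℝ) (n : ℕ) :
    Measurable fun q : (ℕ → ℝ) × (ℕ → ℝ) × ℝ≥0∞ => excessLevel α β s n q.1 q.2.1 q.2.2 := by
  unfold excessLevel
  have hsig := measurable_signal α
  have h1 : Measurable fun q : (ℕ → ℝ) × (ℕ → ℝ) × ℝ≥0∞ =>
      sumExcept n (fun m => signal α (q.1 m) (q.2.1 m)) := measurable_sumExcept n fun m => by
    have h2 : Measurable fun q : (ℕ → ℝ) × (ℕ → ℝ) × ℝ≥0∞ => (q.1 m, q.2.1 m) := by fun_prop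
    exact hsig.comp h2
  fun_prop

/-- The coverage probability of the nearest point, in the presence of additional interference `J`
and noise power `s`. -/
lemma HasPoissonLaplace.lintegral_coverage (hT : HasPoissonLaplace P T c) (hc : c ≠ ∞)
    (hc0 : c ≠ 0) (hTm : ∀ n, Measurable (T n)) (hh : ∀ n, Measurable (h n))
    (hind : iIndepFun h P) (hlaw : ∀ n, P.map (h n) = expMeasure 1) {J : Ω → ℝ≥0∞}
    (hJ : Measurable J)
    (hrest : ∀ n, IndepFun
      (fun ω => ((fun m => T m ω), (fun m => if m = n then 0 else h m ω), J ω)) (h n) P)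
    (hThJ : IndepFun (fun ω n => T n ω) (fun ω => ((fun n => h n ω), J ω)) P)
    (hhJ : IndepFun (fun ω n => h n ω) J P) {e : ℝ → ℝ≥0∞} (he : Measurable e)
    (hLJ : ∀ κ > 0, ∫⁻ ω, negExp (ENNReal.ofReal κ * J ω) ∂P = negExp (e κ))
    (hα : 2 < α) {β : ℝ} (hβ : 0 < β) (s : ℝ) :
    ∫⁻ ω, ∑' n, (strictMinAt n).indicator 1 (fun m => T m ω) *
        {q : ℝ≥0∞ × ℝ | q.1 < ENNReal.ofReal q.2}.indicator 1
          (excessLevel α β s n (fun m => T m ω) (fun m => h m ω) (J ω), h n ω) ∂P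
      = ∫⁻ z in Ioi 0, c * negExp (ENNReal.ofReal (β * z ^ (α / 2) * s) + e (β * z ^ (α / 2)))
          * negExp (c * (ENNReal.ofReal z * ENNReal.ofReal (1 + β ^ (2 / α) * rho α β))) := by
  have hψ : Measurable fun z : ℝ => ENNReal.ofReal (β * z ^ (α / 2) * s) + e (β * z ^ (α / 2)) := by
    fun_prop
  rw [← hT.lintegral_tsum_minKernel hc hc0 hTm hα hβ hψ]
  have hset : MeasurableSet {q : ℝ≥0∞ × ℝ | q.1 < ENNReal.ofReal q.2} :=
    measurableSet_lt measurable_fst (by fun_prop)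
  have hlev := measurable_excessLevel α β s
  have hTs : Measurable fun ω m => T m ω := measurable_pi_lambda _ hTm
  have hhs : Measurable fun ω m => h m ω := measurable_pi_lambda _ hh
  have hexc : ∀ n (x y : ℕ → ℝ) (j : ℝ≥0∞) t, (∀ m, m ≠ n → x m = y m) →
      excessLevel α β s n t x j = excessLevel α β s n t y j := fun n x y j t hxy => by
    unfold excessLevel
    rw [sumExcept_congr fun m hm => by rw [hxy m hm]]
  -- The gain of the serving station is integrated first: with all else frozen, it exceeds the level
  -- with probability `negExp` of the level.
  have hstep1 : ∀ n, ∫⁻ ω, (strictMinAt n).indicator 1 (fun m => T m ω) *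
        {q : ℝ≥0∞ × ℝ | q.1 < ENNReal.ofReal q.2}.indicator 1
          (excessLevel α β s n (fun m => T m ω) (fun m => h m ω) (J ω), h n ω) ∂P
      = ∫⁻ ω, (strictMinAt n).indicator 1 (fun m => T m ω) *
          negExp (excessLevel α β s n (fun m => T m ω) (fun m => h m ω) (J ω)) ∂P := fun n => by
    -- The level at `n` ignores the gain `h n`. Replacing that entry by zero exhibits the level as a
    -- function of data independent of `h n`.
    have hx : ∀ ω, excessLevel α β s n (fun m => T m ω) (fun m => h m ω) (J ω)
        = excessLevel α β s n (fun m => T m ω) (fun m => if m = n then 0 else h m ω) (J ω) :=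
      fun ω => hexc n _ _ _ _ fun m hm => by rw [if_neg hm]
    simp_rw [hx]
    have hm' : Measurable fun ω => ((fun m => T m ω), (fun m => if m = n then 0 else h m ω), J ω) := by
      refine hTs.prodMk (Measurable.prodMk (measurable_pi_lambda _ fun m => ?_) hJ)
      split_ifs
      · exact measurable_const
      · exact hh m
    rw [lintegral_of_indepFun (f := fun (q : (ℕ → ℝ) × (ℕ → ℝ) × ℝ≥0∞) x =>
        (strictMinAt n).indicator 1 q.1 * {q : ℝ≥0∞ × ℝ | q.1 < ENNReal.ofReal q.2}.indicator 1
          (excessLevel α β s n q.1 q.2.1 q.2.2, x)) hm' (hh n) (hrest n) ?_]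
    · refine lintegral_congr fun ω => ?_
      simp only
      have hm2 : Measurable fun x : ℝ => {q : ℝ≥0∞ × ℝ | q.1 < ENNReal.ofReal q.2}.indicator
          (1 : ℝ≥0∞ × ℝ → ℝ≥0∞) (excessLevel α β s n (fun m => T m ω)
            (fun m => if m = n then 0 else h m ω) (J ω), x) :=
        (measurable_one.indicator hset).comp measurable_prodMk_left
      have hm3 : Measurable fun ω' => {q : ℝ≥0∞ × ℝ | q.1 < ENNReal.ofReal q.2}.indicator
          (1 : ℝ≥0∞ × ℝ → ℝ≥0∞) (excessLevel α β s n (fun m => T m ω)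
            (fun m => if m = n then 0 else h m ω) (J ω), h n ω') := hm2.comp (hh n)
      rw [lintegral_const_mul _ hm3, ← lintegral_map (f := fun x =>
        {q : ℝ≥0∞ × ℝ | q.1 < ENNReal.ofReal q.2}.indicator (1 : ℝ≥0∞ × ℝ → ℝ≥0∞)
        (excessLevel α β s n (fun m => T m ω) (fun m => if m = n then 0 else h m ω) (J ω), x)) hm2
        (hh n), hlaw n, ← expMeasure_one_lt_ofReal, ← lintegral_indicator_one]
      · rfl
      · exact measurableSet_lt measurable_const (by fun_prop)
    · refine Measurable.mul ?_ ?_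
      · exact (measurable_one.indicator (measurableSet_strictMinAt n)).comp
          (measurable_fst.comp measurable_fst)
      · exact (measurable_one.indicator hset).comp (((hlev n).comp measurable_fst).prodMk measurable_snd)
  -- With the points frozen, the noise, the remaining gains of the network and the external
  -- interference contribute separate factors.
  have hstep2 : ∀ n, ∫⁻ ω, (strictMinAt n).indicator 1 (fun m => T m ω) *
          negExp (excessLevel α β s n (fun m => T m ω) (fun m => h m ω) (J ω)) ∂P
      = ∫⁻ ω, negExp (ENNReal.ofReal (β * T n ω ^ (α / 2) * s) + e (β * T n ω ^ (α / 2)))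
          * negExp (sumExcept n fun m => minKernel α β (T m ω / T n ω)) ∂P := fun n => by
    rw [lintegral_of_indepFun (f := fun (t : ℕ → ℝ) (q : (ℕ → ℝ) × ℝ≥0∞) =>
        (strictMinAt n).indicator 1 t * negExp (excessLevel α β s n t q.1 q.2))
        hTs (hhs.prodMk hJ) hThJ ?_]
    · refine lintegral_congr_ae ?_
      filter_upwards [hT.ae_pos hTm] with ω hω
      by_cases hW : (fun m => T m ω) ∈ strictMinAt n
      · set κ := β * T n ω ^ (α / 2) with hκdef
        have hκ : 0 < κ := mul_pos hβ (Real.rpow_pos_of_pos (hω n) _)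
        have hsplit : ∀ ω', negExp (excessLevel α β s n (fun m => T m ω) (fun m => h m ω') (J ω'))
            = negExp (ENNReal.ofReal (κ * s)) * (negExp (ENNReal.ofReal κ *
              sumExcept n fun m => signal α (T m ω) (h m ω')) * negExp (ENNReal.ofReal κ * J ω')) :=
          fun ω' => by
            rw [excessLevel, ← hκdef, mul_add, mul_add, negExp_add, negExp_add,
              ← ENNReal.ofReal_mul hκ.le]
            ring
        simp only [indicator_of_mem hW, Pi.one_apply, one_mul, hsplit]
        have hm1 : Measurable fun x : ℕ → ℝ => negExp (ENNReal.ofReal κ *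
              sumExcept n fun m => signal α (T m ω) (x m)) := by
          refine measurable_negExp.comp (Measurable.const_mul (measurable_sumExcept n fun m => ?_) _)
          unfold signal
          fun_prop
        rw [lintegral_const_mul _ (by have := hm1.comp hhs; fun_prop)]
        have hprod := lintegral_of_indepFun hhs hJ hhJ (f := fun x j => negExp (ENNReal.ofReal κ *
          sumExcept n fun m => signal α (T m ω) (x m)) * negExp (ENNReal.ofReal κ * j))
          ((hm1.comp measurable_fst).mul (by fun_prop))
        rw [hprod]
        have hJm : Measurable fun ω' => negExp (ENNReal.ofReal κ * J ω') := by fun_prop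
        simp_rw [lintegral_const_mul _ hJm]
        have hm4 : Measurable fun ω' => negExp (ENNReal.ofReal κ *
            sumExcept n fun m => signal α (T m ω) (h m ω')) := hm1.comp hhs
        rw [lintegral_mul_const _ hm4, hLJ κ hκ,
          lintegral_negExp_sumExcept_signal hh hind hlaw hω hκ.le, negExp_add]
        -- At a strict minimum all ratios exceed one, and `κ = β T n ^ (α/2)` absorbs the division
        -- by `T n`.
        have e3 : sumExcept n (fun m => fadeCost α κ (T m ω))
            = sumExcept n fun m => minKernel α β (T m ω / T n ω) := sumExcept_congr fun m hm => by
          rw [minKernel, if_neg (not_le.2 ((one_lt_div (hω n)).2 (hW m hm))),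
            fadeCost_mul_rpow (hω n) (hω m)]
        rw [e3]; ring
      -- When `n` is not the strict minimum, the exclusion built into `minKernel` makes the right
      -- side zero as well.
      · simp only [indicator_of_notMem hW, zero_mul, lintegral_zero]
        have : ∃ m, m ≠ n ∧ T m ω ≤ T n ω := by
          simpa [strictMinAt] using hW
        obtain ⟨m, hm, hle⟩ := this
        symm
        refine mul_eq_zero_of_right _ (negExp_eq_zero_iff.2 (top_le_iff.1 (le_trans (le_of_eq ?_)
          (le_sumExcept hm fun m => minKernel α β (T m ω / T n ω)))))
        rw [minKernel, if_pos ((div_le_one (hω n)).2 hle)]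
    · refine Measurable.mul ?_ ?_
      · exact (measurable_one.indicator (measurableSet_strictMinAt n)).comp measurable_fst
      · exact measurable_negExp.comp (hlev n)
  rw [lintegral_tsum, lintegral_tsum]
  · exact tsum_congr fun n => (hstep1 n).trans (hstep2 n)
  · intro n
    refine (((measurable_negExp.comp hψ).comp (hTm n)).mul (measurable_negExp.comp
      (measurable_sumExcept n fun m => ?_))).aemeasurable
    exact (measurable_minKernel α β).comp ((hTm m).div (hTm n))
  · intro n
    refine Measurable.aemeasurable (Measurable.mul ?_ ?_)
    · exact (measurable_one.indicator (measurableSet_strictMinAt n)).comp hTs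
    · exact (measurable_one.indicator hset).comp
        (((hlev n).comp (hTs.prodMk (hhs.prodMk hJ))).prodMk (hh n))

end SpectrumSharing

/-! ### Poisson images and external interference of the network. -/

namespace SpectrumSharing

open Filter Topology

/-- Needed because the fixed power of the seller is treated as a degenerate mark. -/
lemma iIndepFun_const {Ω ι E : Type*} [MeasurableSpace Ω] [MeasurableSpace E] {P : Measure Ω}
    [IsProbabilityMeasure P] (x : E) : iIndepFun (fun (_ : ι) (_ : Ω) => x) P := by
  rw [iIndepFun_iff_measure_inter_preimage_eq_mul]
  intro s A _
  by_cases h : ∀ i ∈ s, x ∈ A i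
  · have h1 : ⋂ i ∈ s, (fun _ : Ω => x) ⁻¹' A i = univ := by
      refine eq_univ_of_forall fun ω => mem_iInter₂.2 fun i hi => h i hi
    rw [h1, measure_univ]
    refine (Finset.prod_eq_one fun i hi => ?_).symm
    have : (fun _ : Ω => x) ⁻¹' A i = univ := eq_univ_of_forall fun ω => h i hi
    rw [this, measure_univ]
  · push Not at h
    obtain ⟨i, hi, hx⟩ := h
    have h0 : (fun _ : Ω => x) ⁻¹' A i = ∅ := eq_empty_of_forall_notMem fun ω hω => hx hω
    rw [Finset.prod_eq_zero hi (by rw [h0, measure_empty])]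
    exact measure_mono_null (iInter₂_subset i hi) (by rw [h0, measure_empty])

lemma measurable_tsum_signal {Ω : Type*} [MeasurableSpace Ω] {α : ℝ} {T h : ℕ → Ω → ℝ}
    (hT : ∀ n, Measurable (T n)) (hh : ∀ n, Measurable (h n)) :
    Measurable fun ω => ∑' n, signal α (T n ω) (h n ω) :=
  Measurable.tsum fun n => (measurable_signal α).comp ((hT n).prodMk (hh n))

variable {S B Ω : Type*} {N : Params S B}

/-- The σ-algebra generated by a set of sources of randomness on the sub-band `l`. -/
@[reducible] def Network.sourcesSigma [MeasurableSpace Ω] (R : Network N Ω) (l : N.Band)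
    (s : Set (Source B)) : MeasurableSpace Ω :=
  ⨆ i ∈ s, R.sourceSigma l i

/-- The path losses from the base stations of buyer `k` on the sub-band `l`. -/
noncomputable def Network.buyerPoint (R : Network N Ω) (l : N.Band) (k : B) : ℕ → Ω → ℝ :=
  lossPoint N.α 0 (R.powB l k) (R.siteB k)

/-- The path losses from the base stations of the seller that owns the sub-band `l`. -/
noncomputable def Network.sellerPoint (R : Network N Ω) (l : N.Band) : ℕ → Ω → ℝ :=
  lossPoint N.α 0 (fun _ _ => N.PS) (R.siteS l.1)

/-- The interference from the seller owning `l` and the buyers in `F`. -/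
noncomputable def Network.extInterference (R : Network N Ω) (l : N.Band) (F : Finset B) (ω : Ω) :
    ℝ≥0∞ :=
  ∑' n, signal N.α (R.sellerPoint l n ω) (R.gainS l n ω)
    + ∑ k ∈ F, ∑' n, signal N.α (R.buyerPoint l k n ω) (R.gainB l k n ω)

variable [mΩ : MeasurableSpace Ω] {P : Measure Ω} {R : Network N Ω} {l : N.Band}
  {s : Set (Source B)}

lemma Network.measurable_gainS_sources {n : ℕ} (hs : .sellerGain n ∈ s) :
    Measurable[R.sourcesSigma l s] (R.gainS l n) :=
  measurable_iSup_of_mem (m := R.sourceSigma l) hs le_rfl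

lemma Network.measurable_gainB_sources {k : B} {n : ℕ} (hs : .buyerGain k n ∈ s) :
    Measurable[R.sourcesSigma l s] (R.gainB l k n) :=
  measurable_iSup_of_mem (m := R.sourceSigma l) hs le_rfl

lemma Network.measurable_powB_sources {k : B} {n : ℕ} (hs : .buyerPower k n ∈ s) :
    Measurable[R.sourcesSigma l s] (R.powB l k n) :=
  measurable_iSup_of_mem (m := R.sourceSigma l) hs le_rfl

lemma Network.measurable_siteB_sources {k : B} (hs : .buyerSites k ∈ s) (n : ℕ) :
    Measurable[R.sourcesSigma l s] (R.siteB k n) := by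
  have h : Measurable[R.sourcesSigma l s] fun ω n => R.siteB k n ω :=
    measurable_iSup_of_mem (m := R.sourceSigma l) hs le_rfl
  exact (measurable_pi_apply n).comp h

lemma Network.measurable_siteS_sources (hs : .sellerSites ∈ s) (n : ℕ) :
    Measurable[R.sourcesSigma l s] (R.siteS l.1 n) := by
  have h : Measurable[R.sourcesSigma l s] fun ω n => R.siteS l.1 n ω :=
    measurable_iSup_of_mem (m := R.sourceSigma l) hs le_rfl
  exact (measurable_pi_apply n).comp h

lemma Network.measurable_buyerPoint_sources {k : B} (hs : .buyerSites k ∈ s)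
    (hp : ∀ n, .buyerPower k n ∈ s) (n : ℕ) :
    Measurable[R.sourcesSigma l s] (R.buyerPoint l k n) :=
  @measurable_lossPoint Ω (R.sourcesSigma l s) _ _ _ _
    (fun n => Network.measurable_powB_sources (hp n)) (Network.measurable_siteB_sources hs) n

lemma Network.measurable_sellerPoint_sources (hs : .sellerSites ∈ s) (n : ℕ) :
    Measurable[R.sourcesSigma l s] (R.sellerPoint l n) :=
  @measurable_lossPoint Ω (R.sourcesSigma l s) _ _ _ _
    (fun _ => measurable_const) (Network.measurable_siteS_sources hs) n

lemma Network.measurable_buyerSum_sources {k : B} (hs : .buyerSites k ∈ s)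
    (hp : ∀ n, .buyerPower k n ∈ s) (hg : ∀ n, .buyerGain k n ∈ s) :
    Measurable[R.sourcesSigma l s]
      fun ω => ∑' n, signal N.α (R.buyerPoint l k n ω) (R.gainB l k n ω) :=
  @measurable_tsum_signal Ω (R.sourcesSigma l s) _ _ _
    (Network.measurable_buyerPoint_sources hs hp) fun n => Network.measurable_gainB_sources (hg n)

lemma Network.measurable_extInterference_sources {F : Finset B} (hS : .sellerSites ∈ s)
    (hG : ∀ n, .sellerGain n ∈ s) (hs : ∀ k ∈ F, .buyerSites k ∈ s)
    (hp : ∀ k ∈ F, ∀ n, .buyerPower k n ∈ s) (hg : ∀ k ∈ F, ∀ n, .buyerGain k n ∈ s) :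
    Measurable[R.sourcesSigma l s] (R.extInterference l F) := by
  refine Measurable.add ?_ (Finset.measurable_sum _ fun k hk =>
    Network.measurable_buyerSum_sources (hs k hk) (hp k hk) (hg k hk))
  exact @measurable_tsum_signal Ω (R.sourcesSigma l s) _ _ _
    (Network.measurable_sellerPoint_sources hS) fun n => Network.measurable_gainS_sources (hG n)

lemma Network.IsModel.sourceSigma_le (hR : R.IsModel P) (l : N.Band) (i : Source B) :
    R.sourceSigma l i ≤ mΩ := by
  cases i with
  | sellerSites => exact (measurable_pi_lambda _ (hR.siteS_ppp l.1).measurable).comap_le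
  | buyerSites k => exact (measurable_pi_lambda _ (hR.siteB_ppp k).measurable).comap_le
  | sellerGain n => exact (hR.gainS_meas l n).comap_le
  | buyerGain k n => exact (hR.gainB_meas l k n).comap_le
  | buyerPower k n => exact (hR.powB_meas l k n).comap_le

lemma Network.IsModel.sourcesSigma_le (hR : R.IsModel P) (l : N.Band) (s : Set (Source B)) :
    R.sourcesSigma l s ≤ mΩ :=
  iSup₂_le fun i _ => hR.sourceSigma_le l i

/-- Reduces every independence claim to naming two disjoint sets of sources. -/
lemma Network.IsModel.indepFun {E F : Type*} [MeasurableSpace E] [MeasurableSpace F]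
    (hR : R.IsModel P) {s t : Set (Source B)} (hst : Disjoint s t) {f : Ω → E} {g : Ω → F}
    (hf : Measurable[R.sourcesSigma l s] f) (hg : Measurable[R.sourcesSigma l t] g) :
    IndepFun f g P :=
  indepFun_of_iIndep_of_disjoint (hR.sourceSigma_le l) (hR.indep l) hst hf hg

lemma Network.IsModel.measurable_buyerPoint (hR : R.IsModel P) (l : N.Band) (k : B) (n : ℕ) :
    Measurable (R.buyerPoint l k n) :=
  measurable_lossPoint (hR.powB_meas l k) (hR.siteB_ppp k).measurable n

lemma Network.IsModel.measurable_sellerPoint (hR : R.IsModel P) (l : N.Band) (n : ℕ) :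
    Measurable (R.sellerPoint l n) :=
  measurable_lossPoint (fun _ => measurable_const) (hR.siteS_ppp l.1).measurable n

lemma Network.IsModel.measurable_extInterference (hR : R.IsModel P) (l : N.Band) (F : Finset B) :
    Measurable (R.extInterference l F) :=
  (Network.measurable_extInterference_sources (s := univ) (mem_univ _) (fun _ => mem_univ _)
    (fun _ _ => mem_univ _) (fun _ _ _ => mem_univ _) (fun _ _ _ => mem_univ _)).mono
    (hR.sourcesSigma_le l univ) le_rfl

lemma Network.IsModel.iIndepFun_gainB (hR : R.IsModel P) (l : N.Band) (k : B) :
    iIndepFun (R.gainB l k) P :=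
  (hR.indep l).precomp (g := fun n => Source.buyerGain k n) fun n m h => by simpa using h

variable [IsProbabilityMeasure P]

/-- The powers are the marks. They share the law of `refPow`, whose moment of order `2/α` therefore
enters the intensity. -/
lemma Network.IsModel.hasPoissonLaplace_buyerPoint (hR : R.IsModel P) {k : B}
    (hk : k ∈ N.lessees l) :
    HasPoissonLaplace P (R.buyerPoint l k)
      (ENNReal.ofReal (Real.pi * N.lamB k) * ENNReal.ofReal (R.powMoment P l)) := by
  have : IsProbabilityMeasure (P.map (R.refPow l)) :=
    Measure.isProbabilityMeasure_map (hR.measurable_refPow l).aemeasurable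
  rw [← hR.lintegral_refPow_rpow l]
  refine (hR.siteB_ppp k).hasPoissonLaplace_lossPoint (hR.powB_meas l k) ?_
    (fun n => (hR.powB_law l k hk n).map_eq) ?_ ?_ _ _
  · exact (hR.indep l).precomp (g := fun n => Source.buyerPower k n) fun n m h => by simpa using h
  · rw [ae_map_iff (hR.measurable_refPow l).aemeasurable measurableSet_Ioi]
    filter_upwards [hR.ae_refPow l] with ω hω using hω.1
  · refine hR.indepFun (l := l) (s := {.buyerSites k}) (t := range fun n => .buyerPower k n) (by simp)
      ?_ ?_
    · exact @measurable_pi_lambda _ _ _ (R.sourcesSigma l _) _ _ (Network.measurable_siteB_sources rfl)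
    · exact @measurable_pi_lambda _ _ _ (R.sourcesSigma l _) _ _ fun n =>
        Network.measurable_powB_sources ⟨n, rfl⟩

lemma Network.IsModel.hasPoissonLaplace_sellerPoint (hR : R.IsModel P) (l : N.Band) :
    HasPoissonLaplace P (R.sellerPoint l)
      (ENNReal.ofReal (Real.pi * N.lamS l.1) * ENNReal.ofReal (N.PS ^ (2 / N.α))) := by
  have h := (hR.siteS_ppp l.1).hasPoissonLaplace_lossPoint (M := fun _ _ => N.PS)
    (fun _ => measurable_const) (iIndepFun_const _) (ν := Measure.dirac N.PS)
    (fun n => by simp [Measure.map_const])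
    (by rw [ae_dirac_iff measurableSet_Ioi]; exact N.PS_pos) (indepFun_const_right _ _) N.α 0
  rwa [lintegral_dirac' _ (by fun_prop)] at h

lemma Network.IsModel.laplace_buyer (hR : R.IsModel P) {k : B} (hk : k ∈ N.lessees l) {κ : ℝ}
    (hκ : 0 < κ) :
    ∫⁻ ω, negExp (ENNReal.ofReal κ *
        ∑' n, signal N.α (R.buyerPoint l k n ω) (R.gainB l k n ω)) ∂P
      = negExp (ENNReal.ofReal (Real.pi * N.lamB k) * ENNReal.ofReal (R.powMoment P l)
          * ENNReal.ofReal (κ ^ (2 / N.α) * rhoInf N.α)) := by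
  refine (hR.hasPoissonLaplace_buyerPoint hk).laplace_signal (hR.measurable_buyerPoint l k)
    (hR.gainB_meas l k) (hR.iIndepFun_gainB l k) (fun n => (hR.gainB_law l k hk n).map_eq) ?_
    N.α_gt hκ
  refine hR.indepFun (l := l) (s := {.buyerSites k} ∪ range fun n => .buyerPower k n)
    (t := range fun n => .buyerGain k n) ?_ ?_ ?_
  · rw [Set.disjoint_left]; rintro _ (rfl | ⟨n, rfl⟩) ⟨m, hm⟩ <;> simp at hm
  · exact @measurable_pi_lambda _ _ _ (R.sourcesSigma l _) _ _
      (Network.measurable_buyerPoint_sources (Or.inl rfl) fun n => Or.inr ⟨n, rfl⟩)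
  · exact @measurable_pi_lambda _ _ _ (R.sourcesSigma l _) _ _ fun n =>
        Network.measurable_gainB_sources ⟨n, rfl⟩

lemma Network.IsModel.laplace_seller (hR : R.IsModel P) (l : N.Band) {κ : ℝ} (hκ : 0 < κ) :
    ∫⁻ ω, negExp (ENNReal.ofReal κ *
        ∑' n, signal N.α (R.sellerPoint l n ω) (R.gainS l n ω)) ∂P
      = negExp (ENNReal.ofReal (Real.pi * N.lamS l.1) * ENNReal.ofReal (N.PS ^ (2 / N.α))
          * ENNReal.ofReal (κ ^ (2 / N.α) * rhoInf N.α)) := by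
  refine (hR.hasPoissonLaplace_sellerPoint l).laplace_signal (hR.measurable_sellerPoint l)
    (hR.gainS_meas l) ((hR.indep l).precomp (g := fun n => Source.sellerGain n)
    fun n m h => by simpa using h) (fun n => (hR.gainS_law l n).map_eq) ?_ N.α_gt hκ
  refine hR.indepFun (l := l) (s := {.sellerSites}) (t := range fun n => .sellerGain n)
    (by simp) ?_ ?_
  · exact @measurable_pi_lambda _ _ _ (R.sourcesSigma l _) _ _
      (Network.measurable_sellerPoint_sources rfl)
  · exact @measurable_pi_lambda _ _ _ (R.sourcesSigma l _) _ _ fun n =>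
        Network.measurable_gainS_sources ⟨n, rfl⟩

/-- The operator of a source of randomness: `none` for the seller. -/
def Source.operator : Source B → Option B
  | .sellerSites => none
  | .buyerSites k => some k
  | .sellerGain _ => none
  | .buyerGain k _ => some k
  | .buyerPower k _ => some k

/-- Distinct operators are independent, so exponents add: induction on the set of buyers, starting
from the seller alone. -/
lemma Network.IsModel.laplace_extInterference (hR : R.IsModel P) {F : Finset B}
    (hF : F ⊆ N.lessees l) {κ : ℝ} (hκ : 0 < κ) :
    ∫⁻ ω, negExp (ENNReal.ofReal κ * R.extInterference l F ω) ∂P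
      = negExp ((ENNReal.ofReal (Real.pi * N.lamS l.1) * ENNReal.ofReal (N.PS ^ (2 / N.α))
          + ∑ k ∈ F, ENNReal.ofReal (Real.pi * N.lamB k) * ENNReal.ofReal (R.powMoment P l))
          * ENNReal.ofReal (κ ^ (2 / N.α) * rhoInf N.α)) := by
  classical
  induction F using Finset.induction_on with
  | empty => simpa [Network.extInterference] using hR.laplace_seller l hκ
  | insert k F hk ih =>
    have hsplit : ∀ ω, R.extInterference l (insert k F) ω =
        ∑' n, signal N.α (R.buyerPoint l k n ω) (R.gainB l k n ω) + R.extInterference l F ω :=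
      fun ω => by
        rw [Network.extInterference, Network.extInterference, Finset.sum_insert hk]; ring
    have hkl : k ∈ N.lessees l := hF (Finset.mem_insert_self _ _)
    -- The sources of operator `k` are separated from those of the seller and of all other buyers.
    have hind : IndepFun (fun ω => ∑' n, signal N.α (R.buyerPoint l k n ω) (R.gainB l k n ω))
        (R.extInterference l F) P := by
      refine hR.indepFun (l := l) (s := {i | i.operator = some k})
        (t := {i | i.operator ≠ some k}) ?_ ?_ ?_
      · exact Set.disjoint_left.2 fun i hi hi' => hi' hi
      · exact Network.measurable_buyerSum_sources rfl (fun _ => rfl) fun _ => rfl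
      · have hne : ∀ k' ∈ F, some k' ≠ some k := fun k' hk' h => by
          rw [Option.some_inj] at h
          exact hk (h ▸ hk')
        refine Network.measurable_extInterference_sources ?_ (fun _ => ?_) hne
          (fun k' hk' _ => hne k' hk') fun k' hk' _ => hne k' hk'
        · exact (Option.some_ne_none k).symm
        · exact (Option.some_ne_none k).symm
    have hm1 := measurable_tsum_signal (α := N.α) (hR.measurable_buyerPoint l k) (hR.gainB_meas l k)
    have hm2 := hR.measurable_extInterference l F
    simp_rw [hsplit, mul_add, negExp_add]
    rw [lintegral_of_indepFun (f := fun x y => negExp (ENNReal.ofReal κ * x) *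
      negExp (ENNReal.ofReal κ * y)) hm1 hm2 hind (by fun_prop)]
    rw [Finset.sum_insert hk, add_left_comm, add_mul, negExp_add, ← hR.laplace_buyer hkl hκ,
      ← ih ((Finset.subset_insert _ _).trans hF), ← lintegral_mul_const _ (by fun_prop)]
    refine lintegral_congr fun ω => ?_
    rw [lintegral_const_mul _ (by fun_prop)]

end SpectrumSharing

/-! ### The coverage probability of the typical user. -/

namespace SpectrumSharing

open Filter Topology

lemma lt_mul_iff_mul_lt_of_mul_eq_one {U V x y : ℝ≥0∞} (hUV : U * V = 1) (hU0 : U ≠ 0) (hU : U ≠ ∞) :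
    x < V * y ↔ U * x < y := by
  constructor
  · intro h
    have := (ENNReal.mul_lt_mul_iff_right hU0 hU).2 h
    rwa [← mul_assoc, hUV, one_mul] at this
  · intro h
    have hV0 : V ≠ 0 := fun h0 => by simp [h0] at hUV
    have hV : V ≠ ∞ := fun h0 => by simp [h0, ENNReal.mul_top hU0] at hUV
    have := (ENNReal.mul_lt_mul_iff_right hV0 hV).2 h
    rwa [← mul_assoc, mul_comm V, hUV, one_mul] at this

/-- The threshold on the ratio is a threshold on the gain alone. Division in `[0, ∞]` keeps this
valid for `D = 0` and `D = ∞`. -/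
lemma lt_signal_div_iff {α β t h : ℝ} (hβ : 0 < β) (ht : 0 < t) (D : ℝ≥0∞) :
    ENNReal.ofReal β < signal α t h / D
      ↔ ENNReal.ofReal (β * t ^ (α / 2)) * D < ENNReal.ofReal h := by
  have hp : 0 < t ^ (α / 2) := Real.rpow_pos_of_pos ht _
  have hβ0 : ENNReal.ofReal β ≠ 0 := (ENNReal.ofReal_pos.2 hβ).ne'
  rw [ENNReal.lt_div_iff_mul_lt (Or.inr ENNReal.ofReal_ne_top) (Or.inr hβ0), signal,
    lt_mul_iff_mul_lt_of_mul_eq_one (U := ENNReal.ofReal (t ^ (α / 2)))]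
  · rw [mul_comm β, ENNReal.ofReal_mul hp.le, mul_assoc]
  · rw [← ENNReal.ofReal_mul hp.le, ← Real.rpow_add ht]
    simp
  · exact (ENNReal.ofReal_pos.2 hp).ne'
  · exact ENNReal.ofReal_ne_top

lemma strictMinAt_unique {t : ℕ → ℝ} {n m : ℕ} (hn : t ∈ strictMinAt n) (hm : t ∈ strictMinAt m) :
    n = m := by
  by_contra h
  exact lt_asymm (hn m (Ne.symm h)) (hm n h)

lemma tsum_strictMinAt {t : ℕ → ℝ} {n : ℕ} (hn : t ∈ strictMinAt n) (f : ℕ → ℝ≥0∞) :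
    ∑' m, (strictMinAt m).indicator 1 t * f m = f n := by
  rw [tsum_eq_single n, indicator_of_mem hn, Pi.one_apply, one_mul]
  intro m hm
  rw [indicator_of_notMem fun h => hm (strictMinAt_unique h hn), zero_mul]

variable {S B Ω : Type*} {N : Params S B} [DecidableEq B]

/-- The interference and noise when `n` is the serving base station. -/
noncomputable def Network.interfNoise (R : Network N Ω) (l : N.Band) (b : B) (n : ℕ) (ω : Ω) : ℝ≥0∞ :=
  sumExcept n (fun m => signal N.α (R.buyerPoint l b m ω) (R.gainB l b m ω))
    + R.extInterference l ((N.lessees l).erase b) ω + ENNReal.ofReal (N.σ ^ 2)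

/-- The signal-to-interference-plus-noise ratio with values in `[0, ∞]`. -/
noncomputable def Network.esinr (R : Network N Ω) (l : N.Band) (b : B) (ω : Ω) : ℝ≥0∞ :=
  ∑' n, (strictMinAt n).indicator 1 (fun m => R.buyerPoint l b m ω) *
    (signal N.α (R.buyerPoint l b n ω) (R.gainB l b n ω) / R.interfNoise l b n ω)

variable [mΩ : MeasurableSpace Ω] {P : Measure Ω} {R : Network N Ω} {l : N.Band} {b : B}

lemma Network.IsModel.measurable_esinr (hR : R.IsModel P) (l : N.Band) (b : B) :
    Measurable (R.esinr l b) := by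
  have hT := hR.measurable_buyerPoint l b
  have hsig : ∀ n, Measurable fun ω => signal N.α (R.buyerPoint l b n ω) (R.gainB l b n ω) := fun n =>
    (measurable_signal N.α).comp ((hT n).prodMk (hR.gainB_meas l b n))
  have hext := hR.measurable_extInterference l ((N.lessees l).erase b)
  refine Measurable.tsum fun n => ?_
  refine Measurable.mul ?_ (Measurable.div (hsig n) ?_)
  · exact (measurable_one.indicator (measurableSet_strictMinAt n)).comp (measurable_pi_lambda _ hT)
  · exact ((measurable_sumExcept n hsig).add hext).add_const _

/-- Since `(β z ^ (α/2)) ^ (2/α) = β ^ (2/α) * z`, the terms `1` and `β ^ (2/α) ρ(α, β)` in the last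
factor on the left split into the void factor and the interference of the buyer's own network. -/
lemma Network.coverageIntegrand_eq [IsProbabilityMeasure P] (hR : R.IsModel P) {β z : ℝ}
    (hβ : 0 < β) (hz : 0 < z) :
    ENNReal.ofReal (Real.pi * N.lamB b) * ENNReal.ofReal (R.powMoment P l) *
      negExp (ENNReal.ofReal (β * z ^ (N.α / 2) * N.σ ^ 2) +
        (ENNReal.ofReal (Real.pi * N.lamS l.1) * ENNReal.ofReal (N.PS ^ (2 / N.α))
          + ∑ k ∈ (N.lessees l).erase b,
            ENNReal.ofReal (Real.pi * N.lamB k) * ENNReal.ofReal (R.powMoment P l))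
          * ENNReal.ofReal ((β * z ^ (N.α / 2)) ^ (2 / N.α) * rhoInf N.α)) *
      negExp (ENNReal.ofReal (Real.pi * N.lamB b) * ENNReal.ofReal (R.powMoment P l) *
        (ENNReal.ofReal z * ENNReal.ofReal (1 + β ^ (2 / N.α) * rho N.α β)))
      = ENNReal.ofReal (R.coverageIntegrand P l b β z) := by
  have hα := N.α_gt
  have hm := hR.powMoment_pos l
  set m := R.powMoment P l
  have hπ := Real.pi_pos
  have hb := N.lamB_pos b
  have hl := N.lamS_pos l.1
  have hPS : 0 < N.PS ^ (2 / N.α) := Real.rpow_pos_of_pos N.PS_pos _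
  have hρ := rho_nonneg (α := N.α) hβ.le
  have hρi := rhoInf_pos hα
  have hβp : 0 < β ^ (2 / N.α) := Real.rpow_pos_of_pos hβ _
  have hzp : 0 < z ^ (N.α / 2) := Real.rpow_pos_of_pos hz _
  have hκ : (β * z ^ (N.α / 2)) ^ (2 / N.α) = β ^ (2 / N.α) * z := by
    rw [Real.mul_rpow hβ.le hzp.le, ← Real.rpow_mul hz.le,
      show N.α / 2 * (2 / N.α) = 1 by field_simp, Real.rpow_one]
  have hother : 0 ≤ otherIntensity N l b := Finset.sum_nonneg fun k _ => (N.lamB_pos k).le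
  have hsum : ∑ k ∈ (N.lessees l).erase b, ENNReal.ofReal (Real.pi * N.lamB k) * ENNReal.ofReal m
      = ENNReal.ofReal (Real.pi * otherIntensity N l b * m) := by
    rw [← Finset.sum_mul, ← ENNReal.ofReal_sum_of_nonneg fun k _ => by
      have := N.lamB_pos k; positivity, ← ENNReal.ofReal_mul (Finset.sum_nonneg fun k _ => by
      have := N.lamB_pos k; positivity), ← Finset.mul_sum]
    rfl
  rw [hsum, ← ENNReal.ofReal_mul (by positivity), ← ENNReal.ofReal_mul (by positivity),
    ← ENNReal.ofReal_mul (by positivity), ← ENNReal.ofReal_add (by positivity) (by positivity),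
    ← ENNReal.ofReal_mul (by positivity), ← ENNReal.ofReal_add (by positivity) (by positivity),
    ← ENNReal.ofReal_mul (by positivity), negExp_ofReal (by positivity),
    negExp_ofReal (by positivity), ← ENNReal.ofReal_mul (by positivity),
    ← ENNReal.ofReal_mul (by positivity)]
  have hexp : ∀ A a1 a2 b1 b2 b3 b4 b5 : ℝ, a1 + a2 = b1 + b2 + (b3 + b4 + b5) →
      A * Real.exp a1 * Real.exp a2 = A * Real.exp b1 * Real.exp b2 *
        (Real.exp b3 * Real.exp b4 * Real.exp b5) := fun A a1 a2 b1 b2 b3 b4 b5 h => by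
    rw [← Real.exp_add, ← Real.exp_add, mul_assoc, ← Real.exp_add, h, Real.exp_add (b1 + b2),
      Real.exp_add b1]
    ring
  congr 1
  rw [Network.coverageIntegrand, Network.laplaceI, hκ]
  refine hexp _ _ _ _ _ _ _ _ ?_
  simp only [m]
  ring

/-- The coverage probability of the typical user of `b` on the sub-band `l`. -/
lemma Network.IsModel.measure_lt_esinr [IsProbabilityMeasure P] (hR : R.IsModel P)
    (hb : b ∈ N.lessees l) {β : ℝ} (hβ : 0 < β) :
    P {ω | ENNReal.ofReal β < R.esinr l b ω}
      = ∫⁻ z in Ioi 0, ENNReal.ofReal (R.coverageIntegrand P l b β z) := by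
  have hT := hR.hasPoissonLaplace_buyerPoint hb
  have hTm := hR.measurable_buyerPoint l b
  have hhm := hR.gainB_meas l b
  have hJ := hR.measurable_extInterference l ((N.lessees l).erase b)
  have hm := hR.powMoment_pos l
  set c := ENNReal.ofReal (Real.pi * N.lamB b) * ENNReal.ofReal (R.powMoment P l) with hcdef
  have hc : c ≠ ∞ := ENNReal.mul_ne_top ENNReal.ofReal_ne_top ENNReal.ofReal_ne_top
  have hc0 : c ≠ 0 := mul_ne_zero
    (ENNReal.ofReal_pos.2 (mul_pos Real.pi_pos (N.lamB_pos b))).ne' (ENNReal.ofReal_pos.2 hm).ne'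
  have hne : ∀ k ∈ (N.lessees l).erase b, k ≠ b := fun k hk => (Finset.mem_erase.1 hk).1
  -- Each independence hypothesis splits the sources into a set and its complement: one gain of `b`,
  -- then the sites and powers of `b`, then all gains of `b`.
  have key := hT.lintegral_coverage hc hc0 hTm hhm (hR.iIndepFun_gainB l b)
    (fun n => (hR.gainB_law l b hb n).map_eq) hJ
    (fun n => by
      refine hR.indepFun (l := l) (s := {.buyerGain b n}ᶜ) (t := {.buyerGain b n})
        disjoint_compl_left ?_ (Network.measurable_gainB_sources rfl)
      have h1 : Measurable[R.sourcesSigma l {.buyerGain b n}ᶜ] fun ω m => R.buyerPoint l b m ω :=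
        @measurable_pi_lambda _ _ _ (R.sourcesSigma l _) _ _
          (Network.measurable_buyerPoint_sources (by simp) (by simp))
      have h2 : Measurable[R.sourcesSigma l {.buyerGain b n}ᶜ]
          fun ω m => if m = n then 0 else R.gainB l b m ω :=
        @measurable_pi_lambda _ _ _ (R.sourcesSigma l _) _ _ fun m => by
          split_ifs with hmn
          · exact measurable_const
          · exact Network.measurable_gainB_sources (by simpa using hmn)
      have h3 : Measurable[R.sourcesSigma l {.buyerGain b n}ᶜ]
          (R.extInterference l ((N.lessees l).erase b)) :=
        Network.measurable_extInterference_sources (by simp) (by simp) (by simp) (by simp)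
          fun k hk n' => by simp [hne k hk]
      exact h1.prodMk (h2.prodMk h3))
    (by
      let s : Set (Source B) := {.buyerSites b} ∪ range (Source.buyerPower b)
      have hns : ∀ k ∈ (N.lessees l).erase b, b ≠ k := fun k hk => (hne k hk).symm
      refine hR.indepFun (l := l) (s := s) (t := sᶜ) disjoint_compl_right ?_ ?_
      · exact @measurable_pi_lambda _ _ _ (R.sourcesSigma l _) _ _
          (Network.measurable_buyerPoint_sources (by simp [s]) (by simp [s]))
      · have h2 : Measurable[R.sourcesSigma l sᶜ] fun ω m => R.gainB l b m ω :=
          @measurable_pi_lambda _ _ _ (R.sourcesSigma l _) _ _ fun m =>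
            Network.measurable_gainB_sources (by simp [s])
        have h3 : Measurable[R.sourcesSigma l sᶜ]
            (R.extInterference l ((N.lessees l).erase b)) :=
          Network.measurable_extInterference_sources (by simp [s]) (by simp [s])
            (fun k hk => by simp [s, hne k hk]) (fun k hk n => by simp [s, hns k hk])
            (by simp [s])
        exact h2.prodMk h3)
    (by
      let s : Set (Source B) := range (Source.buyerGain b)
      have hns : ∀ k ∈ (N.lessees l).erase b, b ≠ k := fun k hk => (hne k hk).symm
      refine hR.indepFun (l := l) (s := s) (t := sᶜ) disjoint_compl_right ?_ ?_
      · exact @measurable_pi_lambda _ _ _ (R.sourcesSigma l _) _ _ fun m =>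
          Network.measurable_gainB_sources (by simp [s])
      · exact Network.measurable_extInterference_sources (by simp [s]) (by simp [s])
          (by simp [s]) (by simp [s]) (fun k hk n => by simp [s, hns k hk]))
    (e := fun κ => (ENNReal.ofReal (Real.pi * N.lamS l.1) * ENNReal.ofReal (N.PS ^ (2 / N.α))
          + ∑ k ∈ (N.lessees l).erase b,
            ENNReal.ofReal (Real.pi * N.lamB k) * ENNReal.ofReal (R.powMoment P l))
          * ENNReal.ofReal (κ ^ (2 / N.α) * rhoInf N.α)) (by fun_prop)
    (fun κ hκ => hR.laplace_extInterference (Finset.erase_subset _ _) hκ) N.α_gt hβ (N.σ ^ 2)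
  rw [← lintegral_indicator_one (measurableSet_lt measurable_const (hR.measurable_esinr l b))]
  refine Eq.trans ?_ (key.trans ?_)
  · refine lintegral_congr_ae ?_
    -- Almost surely there is a unique strict minimum, and the sums over candidate servers collapse
    -- to one term.
    filter_upwards [hT.ae_pos hTm, hT.ae_exists_min hc hc0 hTm] with ω hω ⟨n, hn⟩
    have hn' : (fun m => R.buyerPoint l b m ω) ∈ strictMinAt n := hn
    rw [tsum_strictMinAt hn']
    have h1 : R.esinr l b ω = _ := tsum_strictMinAt hn' _
    have hiff : ENNReal.ofReal β < R.esinr l b ω ↔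
        excessLevel N.α β (N.σ ^ 2) n (fun m => R.buyerPoint l b m ω) (fun m => R.gainB l b m ω)
          (R.extInterference l ((N.lessees l).erase b) ω) < ENNReal.ofReal (R.gainB l b n ω) := by
      rw [h1, lt_signal_div_iff hβ (hω n)]
      rfl
    simp only [indicator_apply, mem_ofPred_eq, hiff, Pi.one_apply]
  · refine setLIntegral_congr_fun measurableSet_Ioi fun z hz => ?_
    exact Network.coverageIntegrand_eq hR hβ hz

end SpectrumSharing

/-! ### Identification of the real SINR with its version in `[0, ∞]`. -/

namespace SpectrumSharing

open Filter Topology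

lemma signal_ne_top (α t h : ℝ) : signal α t h ≠ ∞ :=
  ENNReal.mul_ne_top ENNReal.ofReal_ne_top ENNReal.ofReal_ne_top

lemma toReal_signal {α t h : ℝ} (ht : 0 ≤ t) (hh : 0 ≤ h) :
    (signal α t h).toReal = t ^ (-(α / 2)) * h := by
  rw [signal, ENNReal.toReal_mul, ENNReal.toReal_ofReal (Real.rpow_nonneg ht _),
    ENNReal.toReal_ofReal hh]

lemma sumExcept_le_tsum (n : ℕ) (f : ℕ → ℝ≥0∞) : sumExcept n f ≤ ∑' m, f m := by
  rw [← add_sumExcept n f]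
  exact le_add_self

lemma toReal_sumExcept {n : ℕ} {f : ℕ → ℝ≥0∞} (hf : ∀ m, f m ≠ ∞) :
    (sumExcept n f).toReal = ∑' m, if m = n then 0 else (f m).toReal := by
  rw [sumExcept, ENNReal.tsum_toReal_eq fun m => by split_ifs <;> simp [hf m]]
  refine tsum_congr fun m => ?_
  split_ifs <;> rfl

variable {S B Ω : Type*} {N : Params S B} {R : Network N Ω} {l : N.Band} {b : B} {ω : Ω}

lemma Network.avgRecv_eq {n : ℕ} (hp : 0 ≤ R.powB l b n ω) :
    R.avgRecv l b n ω = R.buyerPoint l b n ω ^ (-(N.α / 2)) := by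
  have hα := N.α_gt
  rw [Network.buyerPoint, lossPoint_rpow (by linarith) hp, sub_zero, Network.avgRecv]

lemma Network.recvB_eq {n : ℕ} (hp : 0 ≤ R.powB l b n ω) (hg : 0 ≤ R.gainB l b n ω) :
    R.recvB l b n ω = (signal N.α (R.buyerPoint l b n ω) (R.gainB l b n ω)).toReal := by
  have h0 : 0 ≤ R.buyerPoint l b n ω := by
    rw [Network.buyerPoint, lossPoint]
    positivity
  rw [toReal_signal h0 hg, ← Network.avgRecv_eq hp, Network.recvB, Network.avgRecv]
  ring

lemma Network.recvS_eq {n : ℕ} (hg : 0 ≤ R.gainS l n ω) :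
    R.recvS l n ω = (signal N.α (R.sellerPoint l n ω) (R.gainS l n ω)).toReal := by
  have hα := N.α_gt
  have hPS := N.PS_pos
  have h0 : 0 ≤ R.sellerPoint l n ω := by
    rw [Network.sellerPoint, lossPoint]
    positivity
  rw [toReal_signal h0 hg, Network.sellerPoint, lossPoint_rpow (by linarith) hPS.le, sub_zero,
    Network.recvS]
  ring

/-- Since `u ↦ u ^ (-α/2)` is strictly decreasing, the set of best stations is `{n}`, and its
infimum is `n`. -/
lemma Network.serving_eq (hp : ∀ n, 0 ≤ R.powB l b n ω) (hT : ∀ n, 0 < R.buyerPoint l b n ω)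
    {n : ℕ} (hn : (fun m => R.buyerPoint l b m ω) ∈ strictMinAt n) : R.serving l b ω = n := by
  have hα := N.α_gt
  have h : {n | ∀ m, R.avgRecv l b m ω ≤ R.avgRecv l b n ω} = {n} := by
    ext k
    simp only [mem_ofPred_eq, mem_singleton_iff, Network.avgRecv_eq (hp _)]
    constructor
    · intro hk
      by_contra hne
      exact absurd (hk n) (not_le.2 (Real.rpow_lt_rpow_of_neg (hT n) (hn k hne) (by linarith)))
    · rintro rfl m
      rcases eq_or_ne m k with rfl | hm
      · exact le_rfl
      · exact Real.rpow_le_rpow_of_nonpos (hT k) (hn m hm).le (by linarith)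
  rw [Network.serving, h, csInf_singleton]

section Sinr

variable [DecidableEq B]

/-- The hypotheses `hsum` and `hext` let `toReal` pass through the additions, so no real series
silently takes the default value zero for a divergent sum. -/
lemma Network.sinr_eq_toReal_esinr (hb : b ∈ N.lessees l)
    (hp : ∀ k ∈ N.lessees l, ∀ n, 0 ≤ R.powB l k n ω)
    (hgB : ∀ k ∈ N.lessees l, ∀ n, 0 ≤ R.gainB l k n ω) (hgS : ∀ n, 0 ≤ R.gainS l n ω)
    (hT : ∀ n, 0 < R.buyerPoint l b n ω)
    (hsum : ∑' n, signal N.α (R.buyerPoint l b n ω) (R.gainB l b n ω) ≠ ∞)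
    (hext : R.extInterference l ((N.lessees l).erase b) ω ≠ ∞)
    (hmin : ∃ n, (fun m => R.buyerPoint l b m ω) ∈ strictMinAt n) :
    R.sinr l b ω = (R.esinr l b ω).toReal := by
  obtain ⟨n, hn⟩ := hmin
  have hserv := Network.serving_eq (hp b hb) hT hn
  have hown : ∀ m, R.recvB l b m ω
      = (signal N.α (R.buyerPoint l b m ω) (R.gainB l b m ω)).toReal := fun m =>
    Network.recvB_eq (hp b hb m) (hgB b hb m)
  have hexc := ne_top_of_le_ne_top hsum (sumExcept_le_tsum n _)
  have hint : R.interference l b ω + N.σ ^ 2 = (R.interfNoise l b n ω).toReal := by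
    rw [Network.extInterference, ENNReal.add_ne_top] at hext
    have hk : ∀ k ∈ (N.lessees l).erase b,
        ∑' n, signal N.α (R.buyerPoint l k n ω) (R.gainB l k n ω) ≠ ∞ :=
      ENNReal.sum_ne_top.1 hext.2
    rw [Network.interfNoise, Network.extInterference, ENNReal.toReal_add
      (ENNReal.add_ne_top.2 ⟨hexc, ENNReal.add_ne_top.2 hext⟩) ENNReal.ofReal_ne_top,
      ENNReal.toReal_add hexc (ENNReal.add_ne_top.2 hext), ENNReal.toReal_add hext.1 hext.2,
      ENNReal.toReal_sum hk, ENNReal.toReal_ofReal (sq_nonneg _),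
      toReal_sumExcept fun m => signal_ne_top _ _ _,
      ENNReal.tsum_toReal_eq fun m => signal_ne_top _ _ _, Network.interference, hserv, ← add_assoc]
    congr 2
    · congr 1
      · exact tsum_congr fun m => by rw [hown]
      · exact tsum_congr fun m => Network.recvS_eq (hgS m)
    · refine Finset.sum_congr rfl fun k hk => ?_
      have hkl := Finset.mem_of_mem_erase hk
      rw [ENNReal.tsum_toReal_eq fun m => signal_ne_top _ _ _]
      exact tsum_congr fun m => Network.recvB_eq (hp k hkl m) (hgB k hkl m)
  have h1 : R.esinr l b ω = _ := tsum_strictMinAt hn _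
  rw [h1, ENNReal.toReal_div, ← hint, Network.sinr, hserv, hown]

end Sinr

variable [MeasurableSpace Ω] {P : Measure Ω}

lemma Network.IsModel.ae_gainB_pos (hR : R.IsModel P) (l : N.Band) :
    ∀ᵐ ω ∂P, ∀ k ∈ N.lessees l, ∀ n, 0 < R.gainB l k n ω := by
  refine (Finset.eventually_all _).2 fun k hk => ae_all_iff.2 fun n => ?_
  have h := ae_pos_expMeasure_one
  rw [← (hR.gainB_law l k hk n).map_eq] at h
  exact ae_of_ae_map (hR.gainB_meas l k n).aemeasurable h

lemma Network.IsModel.ae_gainS_pos (hR : R.IsModel P) (l : N.Band) :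
    ∀ᵐ ω ∂P, ∀ n, 0 < R.gainS l n ω := by
  refine ae_all_iff.2 fun n => ?_
  have h := ae_pos_expMeasure_one
  rw [← (hR.gainS_law l n).map_eq] at h
  exact ae_of_ae_map (hR.gainS_meas l n).aemeasurable h

variable [IsProbabilityMeasure P]

/-- The transform tends to one along `κ = 1 / (n + 1)`, while an infinite `J` would make `κ * J`
infinite for every such `κ`. -/
lemma ae_ne_top_of_laplace_eq {α : ℝ} (hα : 2 < α) {J : Ω → ℝ≥0∞} (hJ : Measurable J) {c : ℝ≥0∞}
    (hc : c ≠ ∞) (h : ∀ κ > 0, ∫⁻ ω, negExp (ENNReal.ofReal κ * J ω) ∂P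
      = negExp (c * ENNReal.ofReal (κ ^ (2 / α) * rhoInf α))) : ∀ᵐ ω ∂P, J ω ≠ ∞ := by
  have hlim := tendsto_negExp_mul_rpow hc (p := 2 / α) (by positivity) (rhoInf α)
  have hpos : ∀ n : ℕ, (0 : ℝ) < 1 / ((n : ℝ) + 1) := fun n => by positivity
  have := ae_ne_top_of_tendsto_laplace (P := P)
    (J := fun n ω => ENNReal.ofReal (1 / ((n : ℝ) + 1)) * J ω) (fun n => hJ.const_mul _)
    (by simp_rw [h _ (hpos _)]; exact hlim)
  filter_upwards [this] with ω ⟨n, hn⟩ htop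
  exact hn (by rw [htop, ENNReal.mul_top (ENNReal.ofReal_pos.2 (hpos n)).ne'])

lemma Network.IsModel.ae_powB_pos (hR : R.IsModel P) (l : N.Band) :
    ∀ᵐ ω ∂P, ∀ k ∈ N.lessees l, ∀ n, 0 < R.powB l k n ω := by
  refine (Finset.eventually_all _).2 fun k hk => ae_all_iff.2 fun n => ?_
  have h : ∀ᵐ p ∂(P.map (R.refPow l)), 0 < p :=
    (ae_map_iff (hR.measurable_refPow l).aemeasurable measurableSet_Ioi).2
      ((hR.ae_refPow l).mono fun ω hω => hω.1)
  rw [← (hR.powB_law l k hk n).map_eq] at h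
  exact ae_of_ae_map (hR.powB_meas l k n).aemeasurable h

lemma Network.IsModel.ae_sinr_eq [DecidableEq B] (hR : R.IsModel P) (hb : b ∈ N.lessees l) :
    R.sinr l b =ᵐ[P] fun ω => (R.esinr l b ω).toReal := by
  have hT := hR.hasPoissonLaplace_buyerPoint hb
  have hTm := hR.measurable_buyerPoint l b
  have hc : ENNReal.ofReal (Real.pi * N.lamB b) * ENNReal.ofReal (R.powMoment P l) ≠ ∞ :=
    ENNReal.mul_ne_top ENNReal.ofReal_ne_top ENNReal.ofReal_ne_top
  have hc0 : ENNReal.ofReal (Real.pi * N.lamB b) * ENNReal.ofReal (R.powMoment P l) ≠ 0 :=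
    mul_ne_zero (ENNReal.ofReal_pos.2 (mul_pos Real.pi_pos (N.lamB_pos b))).ne'
      (ENNReal.ofReal_pos.2 (hR.powMoment_pos l)).ne'
  have hce : ENNReal.ofReal (Real.pi * N.lamS l.1) * ENNReal.ofReal (N.PS ^ (2 / N.α))
      + ∑ k ∈ (N.lessees l).erase b,
        ENNReal.ofReal (Real.pi * N.lamB k) * ENNReal.ofReal (R.powMoment P l) ≠ ∞ :=
    ENNReal.add_ne_top.2 ⟨ENNReal.mul_ne_top ENNReal.ofReal_ne_top ENNReal.ofReal_ne_top,
      ENNReal.sum_ne_top.2 fun k _ => ENNReal.mul_ne_top ENNReal.ofReal_ne_top ENNReal.ofReal_ne_top⟩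
  have hsum := ae_ne_top_of_laplace_eq N.α_gt
    (measurable_tsum_signal (α := N.α) hTm (hR.gainB_meas l b)) hc
    fun κ hκ => hR.laplace_buyer hb hκ
  have hext := ae_ne_top_of_laplace_eq N.α_gt
    (hR.measurable_extInterference l ((N.lessees l).erase b)) hce
    fun κ hκ => hR.laplace_extInterference (Finset.erase_subset _ _) hκ
  filter_upwards [hR.ae_powB_pos l, hR.ae_gainB_pos l, hR.ae_gainS_pos l, hT.ae_pos hTm, hsum, hext,
    hT.ae_exists_min hc hc0 hTm] with ω h1 h2 h3 h4 h5 h6 h7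
  exact Network.sinr_eq_toReal_esinr hb (fun k hk n => (h1 k hk n).le)
    (fun k hk n => (h2 k hk n).le) (fun n => (h3 n).le) h4 h5 h6 h7

end SpectrumSharing

/-! ### Conditional laws, decay of the coverage and the expected rate. -/

namespace SpectrumSharing

open Filter Topology

lemma measurable_rho (α : ℝ) : Measurable (rho α) := by
  have hs : MeasurableSet {q : ℝ × ℝ | q.1 ^ (-2 / α) < q.2} :=
    measurableSet_lt (by fun_prop) (by fun_prop)
  have hf : Measurable fun q : ℝ × ℝ => 1 / (1 + q.2 ^ (α / 2)) := by fun_prop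
  have h : rho α = fun β => ∫ ν : ℝ, {q : ℝ × ℝ | q.1 ^ (-2 / α) < q.2}.indicator
      (fun q => 1 / (1 + q.2 ^ (α / 2))) (β, ν) := by
    funext β
    rw [rho, ← integral_indicator measurableSet_Ioi]
    rfl
  rw [h]
  exact (hf.indicator hs).stronglyMeasurable.integral_prod_right'.measurable

lemma one_add_rpow_le {p β : ℝ} (hp : 0 ≤ p) (hp1 : p ≤ 1) (hβ : 0 ≤ β) :
    (1 + β) ^ p ≤ 1 + β ^ p := by
  have h := NNReal.rpow_add_le_add_rpow 1 ⟨β, hβ⟩ hp hp1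
  rw [NNReal.one_rpow] at h
  exact_mod_cast h

/-- Subadditivity of the power `p ≤ 1` gives `e ^ (p t) ≤ 1 + (e ^ t - 1) ^ p`, so the denominator
grows at least like `e ^ (p t)`. -/
lemma div_add_mul_rpow_exp_sub_one_le {p c D t : ℝ} (hp : 0 ≤ p) (hp1 : p ≤ 1) (hc : 0 < c)
    (hD : 0 < D) (ht : 0 ≤ t) :
    c / (c + D * (Real.exp t - 1) ^ p) ≤ c / min c D * Real.exp (-(p * t)) := by
  have hβ : 0 ≤ Real.exp t - 1 := by linarith [Real.one_le_exp ht]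
  have hm : 0 < min c D := lt_min hc hD
  have hβp : 0 ≤ (Real.exp t - 1) ^ p := Real.rpow_nonneg hβ _
  have h1 : Real.exp (p * t) ≤ 1 + (Real.exp t - 1) ^ p := by
    have := one_add_rpow_le hp hp1 hβ
    rwa [add_sub_cancel, ← Real.exp_mul, mul_comm] at this
  have h2 : min c D * Real.exp (p * t) ≤ c + D * (Real.exp t - 1) ^ p :=
    calc min c D * Real.exp (p * t) ≤ min c D * (1 + (Real.exp t - 1) ^ p) := by gcongr
      _ = min c D + min c D * (Real.exp t - 1) ^ p := by ring
      _ ≤ c + D * (Real.exp t - 1) ^ p := by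
        gcongr
        · exact min_le_left _ _
        · exact min_le_right _ _
  rw [Real.exp_neg, ← div_eq_mul_inv, div_div]
  gcongr

lemma lt_log_one_add_toReal_iff {t : ℝ} (ht : 0 < t) {x : ℝ≥0∞} (hx : x ≠ ∞) :
    t < Real.log (1 + x.toReal) ↔ ENNReal.ofReal (Real.exp t - 1) < x := by
  have h0 : 0 ≤ x.toReal := ENNReal.toReal_nonneg
  rw [Real.lt_log_iff_exp_lt (by linarith), ← sub_lt_iff_lt_add',
    ENNReal.ofReal_lt_iff_lt_toReal (by linarith [Real.one_le_exp ht.le]) hx]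

/-- The tower property, from the disintegration of the joint law of `X` and `Y`; it removes the
conditioning on the powers. -/
lemma integral_condDistrib_comp {Ω E F : Type*} [MeasurableSpace Ω] [MeasurableSpace E]
    [MeasurableSpace F] [StandardBorelSpace F] [Nonempty F] {P : Measure Ω} [IsFiniteMeasure P]
    {X : Ω → E} {Y : Ω → F} (hX : AEMeasurable X P) (hY : AEMeasurable Y P) {f : F → ℝ}
    (hf : Measurable f) (hint : Integrable (fun ω => f (Y ω)) P) :
    ∫ p, (∫ y, f y ∂(condDistrib Y X P p)) ∂(P.map X) = ∫ ω, f (Y ω) ∂P := by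
  have hm : Measurable fun q : E × F => f q.2 := hf.comp measurable_snd
  have hi : Integrable (fun q : E × F => f q.2) (P.map X ⊗ₘ condDistrib Y X P) := by
    rw [compProd_map_condDistrib hY, integrable_map_measure hm.aestronglyMeasurable (hX.prodMk hY)]
    exact hint
  rw [← Measure.integral_compProd hi, compProd_map_condDistrib hY,
    integral_map (hX.prodMk hY) hm.aestronglyMeasurable]

/-- The layer-cake formula is applied under almost every conditional law, to which integrability and
nonnegativity descend from the joint law. -/
lemma integral_condDistrib_eq_integral_meas_lt {Ω E F : Type*} [MeasurableSpace Ω]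
    [MeasurableSpace E] [MeasurableSpace F] [StandardBorelSpace F] [Nonempty F] {P : Measure Ω}
    [IsFiniteMeasure P] {X : Ω → E} {Y : Ω → F} (hX : AEMeasurable X P) (hY : AEMeasurable Y P)
    {f : F → ℝ} (hf : Measurable f) (hint : Integrable (fun ω => f (Y ω)) P)
    (hnn : ∀ᵐ ω ∂P, 0 ≤ f (Y ω)) :
    ∫ p, (∫ y, f y ∂(condDistrib Y X P p)) ∂(P.map X)
      = ∫ p, (∫ t in Ioi (0 : ℝ), (condDistrib Y X P p).real {y | t < f y}) ∂(P.map X) := by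
  have hm : Measurable fun q : E × F => f q.2 := hf.comp measurable_snd
  have hi : Integrable (fun q : E × F => f q.2) (P.map fun ω => (X ω, Y ω)) := by
    rw [integrable_map_measure hm.aestronglyMeasurable (hX.prodMk hY)]
    exact hint
  have hnn' : ∀ᵐ q ∂(P.map X ⊗ₘ condDistrib Y X P), 0 ≤ f q.2 := by
    rw [compProd_map_condDistrib hY, ae_map_iff (hX.prodMk hY) (measurableSet_le measurable_const hm)]
    exact hnn
  refine integral_congr_ae ?_
  filter_upwards [hi.condDistrib_ae_map hY, Measure.ae_ae_of_ae_compProd hnn'] with p hp hp'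
  exact Integrable.integral_eq_integral_meas_lt hp hp'

variable {S B Ω : Type*} {N : Params S B} [MeasurableSpace Ω] {P : Measure Ω}
  {R : Network N Ω} {l : N.Band} {b : B}

lemma Network.IsModel.measurable_powers (hR : R.IsModel P) (l : N.Band) :
    Measurable (R.powers l) :=
  measurable_pi_lambda _ fun k => measurable_pi_lambda _ fun n => hR.powB_meas l k n

variable [DecidableEq B]

lemma Network.measurable_coverageIntegrand (R : Network N Ω) (P : Measure Ω) (l : N.Band) (b : B) :
    Measurable fun q : ℝ × ℝ => R.coverageIntegrand P l b (Real.exp q.1 - 1) q.2 := by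
  have h1 : Measurable fun q : ℝ × ℝ => rho N.α (Real.exp q.1 - 1) :=
    (measurable_rho N.α).comp (by fun_prop)
  unfold Network.coverageIntegrand Network.laplaceI
  fun_prop

lemma Network.lintegral_prod_coverageIntegrand (R : Network N Ω) (P : Measure Ω) (l : N.Band) (b : B) :
    ∫⁻ q in Ioi (0 : ℝ) ×ˢ Ioi (0 : ℝ),
        ENNReal.ofReal (R.coverageIntegrand P l b (Real.exp q.1 - 1) q.2)
      = ∫⁻ t in Ioi 0, ∫⁻ z in Ioi 0,
        ENNReal.ofReal (R.coverageIntegrand P l b (Real.exp t - 1) z) := by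
  rw [Measure.volume_eq_prod, ← Measure.prod_restrict, lintegral_prod]
  exact (R.measurable_coverageIntegrand P l b).ennreal_ofReal.aemeasurable

variable [IsProbabilityMeasure P]

lemma Network.IsModel.coverageIntegrand_nonneg (hR : R.IsModel P) (β z : ℝ) :
    0 ≤ R.coverageIntegrand P l b β z := by
  have := hR.powMoment_pos l
  have := N.lamB_pos b
  unfold Network.coverageIntegrand Network.laplaceI
  positivity

/-- Noise, interference from the own network and interference from other buyers are discarded. The
seller's interference is always present and suffices for the decay in `β`. -/
lemma Network.IsModel.coverageIntegrand_le (hR : R.IsModel P) {β z : ℝ} (hβ : 0 ≤ β) (hz : 0 < z) :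
    R.coverageIntegrand P l b β z ≤ Real.pi * N.lamB b * R.powMoment P l *
      Real.exp (-((Real.pi * N.lamB b * R.powMoment P l +
        Real.pi * N.lamS l.1 * N.PS ^ (2 / N.α) * rhoInf N.α * β ^ (2 / N.α)) * z)) := by
  have hα := N.α_gt
  have hm := hR.powMoment_pos l
  have hb := N.lamB_pos b
  have hπ := Real.pi_pos
  have hρ := rho_nonneg (α := N.α) hβ
  have hρi := rhoInf_pos hα
  have hzp : 0 < z ^ (N.α / 2) := Real.rpow_pos_of_pos hz _
  have hκ : (β * z ^ (N.α / 2)) ^ (2 / N.α) = β ^ (2 / N.α) * z := by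
    rw [Real.mul_rpow hβ hzp.le, ← Real.rpow_mul hz.le,
      show N.α / 2 * (2 / N.α) = 1 by field_simp, Real.rpow_one]
  have hother : 0 ≤ otherIntensity N l b := Finset.sum_nonneg fun k _ => (N.lamB_pos k).le
  have h1 : 0 ≤ β * N.σ ^ 2 * z ^ (N.α / 2) := by positivity
  have h2 : 0 ≤ Real.pi * N.lamB b * R.powMoment P l * (β ^ (2 / N.α) * z) * rho N.α β := by
    positivity
  have h3 : 0 ≤ Real.pi * otherIntensity N l b * R.powMoment P l * (β ^ (2 / N.α) * z)
      * rhoInf N.α := by positivity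
  unfold Network.coverageIntegrand Network.laplaceI
  rw [hκ, mul_assoc, mul_assoc, ← Real.exp_add, ← Real.exp_add, ← Real.exp_add, ← Real.exp_add]
  gcongr
  linarith

lemma Network.IsModel.lintegral_coverageIntegrand_le (hR : R.IsModel P) {t : ℝ} (ht : 0 ≤ t) :
    ∫⁻ z in Ioi 0, ENNReal.ofReal (R.coverageIntegrand P l b (Real.exp t - 1) z)
      ≤ ENNReal.ofReal (Real.pi * N.lamB b * R.powMoment P l /
        min (Real.pi * N.lamB b * R.powMoment P l)
          (Real.pi * N.lamS l.1 * N.PS ^ (2 / N.α) * rhoInf N.α))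
        * ENNReal.ofReal (Real.exp (-(2 / N.α * t))) := by
  have hα := N.α_gt
  have hβ : 0 ≤ Real.exp t - 1 := by linarith [Real.one_le_exp ht]
  have hc : 0 < Real.pi * N.lamB b * R.powMoment P l :=
    mul_pos (mul_pos Real.pi_pos (N.lamB_pos b)) (hR.powMoment_pos l)
  have hD : 0 < Real.pi * N.lamS l.1 * N.PS ^ (2 / N.α) * rhoInf N.α :=
    mul_pos (mul_pos (mul_pos Real.pi_pos (N.lamS_pos _)) (Real.rpow_pos_of_pos N.PS_pos _))
      (rhoInf_pos hα)
  set c := Real.pi * N.lamB b * R.powMoment P l with hcdef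
  set D := Real.pi * N.lamS l.1 * N.PS ^ (2 / N.α) * rhoInf N.α with hDdef
  have hβp : 0 ≤ (Real.exp t - 1) ^ (2 / N.α) := Real.rpow_nonneg hβ _
  have ha : 0 < c + D * (Real.exp t - 1) ^ (2 / N.α) := by positivity
  calc ∫⁻ z in Ioi 0, ENNReal.ofReal (R.coverageIntegrand P l b (Real.exp t - 1) z)
      ≤ ∫⁻ z in Ioi 0, ENNReal.ofReal c *
          ENNReal.ofReal (Real.exp (-((c + D * (Real.exp t - 1) ^ (2 / N.α)) * z))) := by
        refine setLIntegral_mono' measurableSet_Ioi fun z hz => ?_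
        rw [← ENNReal.ofReal_mul hc.le]
        exact ENNReal.ofReal_le_ofReal (hR.coverageIntegrand_le hβ hz)
    _ = ENNReal.ofReal (c / (c + D * (Real.exp t - 1) ^ (2 / N.α))) := by
        rw [lintegral_const_mul _ (by fun_prop), lintegral_Ioi_exp_neg_mul ha,
          ← ENNReal.ofReal_mul hc.le]
        simp [div_eq_mul_inv]
    _ ≤ _ := by
        rw [← ENNReal.ofReal_mul (by positivity)]
        refine ENNReal.ofReal_le_ofReal
          (div_add_mul_rpow_exp_sub_one_le (by positivity) ?_ hc hD ht)
        rw [div_le_one (by linarith)]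
        exact hα.le

lemma Network.IsModel.lintegral_lintegral_coverageIntegrand_ne_top (hR : R.IsModel P) :
    ∫⁻ t in Ioi 0, ∫⁻ z in Ioi 0, ENNReal.ofReal (R.coverageIntegrand P l b (Real.exp t - 1) z)
      ≠ ∞ := by
  have hα := N.α_gt
  refine ne_top_of_le_ne_top ?_ (setLIntegral_mono' measurableSet_Ioi fun t ht =>
    hR.lintegral_coverageIntegrand_le (le_of_lt ht))
  rw [lintegral_const_mul _ (by fun_prop), lintegral_Ioi_exp_neg_mul (by positivity)]
  exact ENNReal.mul_ne_top ENNReal.ofReal_ne_top ENNReal.ofReal_ne_top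

lemma Network.IsModel.integrableOn_coverageIntegrand (hR : R.IsModel P) :
    IntegrableOn (fun q : ℝ × ℝ => R.coverageIntegrand P l b (Real.exp q.1 - 1) q.2)
      (Ioi 0 ×ˢ Ioi 0) := by
  refine (lintegral_ofReal_ne_top_iff_integrable
    (R.measurable_coverageIntegrand P l b).aestronglyMeasurable
    (ae_of_all _ fun q => hR.coverageIntegrand_nonneg _ _)).1 ?_
  rw [R.lintegral_prod_coverageIntegrand]
  exact hR.lintegral_lintegral_coverageIntegrand_ne_top

lemma Network.IsModel.toReal_lintegral_coverageIntegrand (hR : R.IsModel P) :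
    (∫⁻ t in Ioi 0, ∫⁻ z in Ioi 0,
        ENNReal.ofReal (R.coverageIntegrand P l b (Real.exp t - 1) z)).toReal
      = ∫ t in Ioi (0 : ℝ), ∫ z in Ioi (0 : ℝ), R.coverageIntegrand P l b (Real.exp t - 1) z := by
  have h := hR.integrableOn_coverageIntegrand (l := l) (b := b)
  rw [← R.lintegral_prod_coverageIntegrand, ← integral_eq_lintegral_of_nonneg_ae
    (ae_of_all _ fun q => hR.coverageIntegrand_nonneg _ _)
    (R.measurable_coverageIntegrand P l b).aestronglyMeasurable]
  rw [Measure.volume_eq_prod] at h ⊢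
  exact setIntegral_prod _ h

/-- An infinite ratio exceeds every threshold, and the coverage probability tends to zero with
growing threshold. -/
lemma Network.IsModel.ae_esinr_ne_top (hR : R.IsModel P) (hb : b ∈ N.lessees l) :
    ∀ᵐ ω ∂P, R.esinr l b ω ≠ ∞ := by
  have hα := N.α_gt
  set K := ENNReal.ofReal (Real.pi * N.lamB b * R.powMoment P l /
        min (Real.pi * N.lamB b * R.powMoment P l)
          (Real.pi * N.lamS l.1 * N.PS ^ (2 / N.α) * rhoInf N.α))
  have hlim : Tendsto (fun t : ℝ => K * ENNReal.ofReal (Real.exp (-(2 / N.α * t)))) atTop (𝓝 0) := by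
    have h1 : Tendsto (fun t : ℝ => 2 / N.α * t) atTop atTop :=
      tendsto_id.const_mul_atTop (by positivity)
    have h2 := ENNReal.tendsto_ofReal (Real.tendsto_exp_neg_atTop_nhds_zero.comp h1)
    have h3 := ENNReal.Tendsto.const_mul (a := K) h2 (Or.inr ENNReal.ofReal_ne_top)
    simpa using h3
  have h0 : P {ω | R.esinr l b ω = ∞} ≤ 0 := by
    refine ge_of_tendsto hlim ?_
    filter_upwards [eventually_gt_atTop 0] with t ht
    refine le_trans (measure_mono fun ω hω => ?_)
      ((hR.measure_lt_esinr hb (β := Real.exp t - 1) (by linarith [Real.add_one_lt_exp ht.ne'])).trans_le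
        (hR.lintegral_coverageIntegrand_le ht.le))
    rw [mem_ofPred_eq] at hω ⊢
    rw [hω]
    exact ENNReal.ofReal_lt_top
  simpa [ae_iff] using h0

lemma Network.IsModel.ae_log_sinr_nonneg (hR : R.IsModel P) (hb : b ∈ N.lessees l) :
    ∀ᵐ ω ∂P, 0 ≤ Real.log (1 + R.sinr l b ω) := by
  filter_upwards [hR.ae_sinr_eq hb] with ω hω
  rw [hω]
  exact Real.log_nonneg (le_add_of_nonneg_right ENNReal.toReal_nonneg)

lemma Network.IsModel.aemeasurable_sinr (hR : R.IsModel P) (hb : b ∈ N.lessees l) :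
    AEMeasurable (R.sinr l b) P :=
  ⟨_, (hR.measurable_esinr l b).ennreal_toReal, hR.ae_sinr_eq hb⟩

lemma Network.IsModel.aemeasurable_log_sinr (hR : R.IsModel P) (hb : b ∈ N.lessees l) :
    AEMeasurable (fun ω => Real.log (1 + R.sinr l b ω)) P :=
  Real.measurable_log.comp_aemeasurable ((hR.aemeasurable_sinr hb).const_add 1)

/-- By the layer-cake formula, since `ln (1 + γ) > t` means `γ > e ^ t - 1`, which is the coverage
event at that threshold. -/
lemma Network.IsModel.lintegral_log_sinr (hR : R.IsModel P) (hb : b ∈ N.lessees l) :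
    ∫⁻ ω, ENNReal.ofReal (Real.log (1 + R.sinr l b ω)) ∂P
      = ∫⁻ t in Ioi 0, ∫⁻ z in Ioi 0,
        ENNReal.ofReal (R.coverageIntegrand P l b (Real.exp t - 1) z) := by
  rw [lintegral_eq_lintegral_meas_lt P (hR.ae_log_sinr_nonneg hb) (hR.aemeasurable_log_sinr hb)]
  refine setLIntegral_congr_fun measurableSet_Ioi fun t ht => ?_
  have ht0 : 0 < t := ht
  rw [← hR.measure_lt_esinr hb (by linarith [Real.add_one_lt_exp ht0.ne'])]
  refine measure_congr ?_
  filter_upwards [hR.ae_sinr_eq hb, hR.ae_esinr_ne_top hb] with ω h1 h2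
  refine propext ?_
  change t < Real.log (1 + R.sinr l b ω) ↔ ENNReal.ofReal (Real.exp t - 1) < R.esinr l b ω
  rw [h1]
  exact lt_log_one_add_toReal_iff ht0 h2

lemma Network.IsModel.integrable_log_sinr (hR : R.IsModel P) (hb : b ∈ N.lessees l) :
    Integrable (fun ω => Real.log (1 + R.sinr l b ω)) P := by
  refine (lintegral_ofReal_ne_top_iff_integrable (hR.aemeasurable_log_sinr hb).aestronglyMeasurable
    (hR.ae_log_sinr_nonneg hb)).1 ?_
  rw [hR.lintegral_log_sinr hb]
  exact hR.lintegral_lintegral_coverageIntegrand_ne_top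

lemma Network.IsModel.integral_log_sinr (hR : R.IsModel P) (hb : b ∈ N.lessees l) :
    ∫ ω, Real.log (1 + R.sinr l b ω) ∂P
      = ∫ t in Ioi (0 : ℝ), ∫ z in Ioi (0 : ℝ), R.coverageIntegrand P l b (Real.exp t - 1) z := by
  rw [integral_eq_lintegral_of_nonneg_ae (hR.ae_log_sinr_nonneg hb)
    (hR.aemeasurable_log_sinr hb).aestronglyMeasurable, hR.lintegral_log_sinr hb,
    hR.toReal_lintegral_coverageIntegrand]

end SpectrumSharing

/-! ### The average rate. -/

theorem theorem3 {S B Ω : Type*} [Fintype S] [DecidableEq B] [MeasurableSpace Ω]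
    (P : MeasureTheory.Measure Ω) [MeasureTheory.IsProbabilityMeasure P]
    (N : SpectrumSharing.Params S B) (R : SpectrumSharing.Network N Ω) (hR : R.IsModel P) (b : B) :
    (∀ l : N.Band, b ∈ N.lessees l →
      AEMeasurable (R.sinr l b) P ∧
      MeasureTheory.Integrable (fun ω => Real.log (1 + R.sinr l b ω)) P ∧
      MeasureTheory.Integrable (fun ω => R.refPow l ω ^ (2 / N.α)) P ∧
      MeasureTheory.IntegrableOn
        (fun q : ℝ × ℝ => R.coverageIntegrand P l b (Real.exp q.1 - 1) q.2)
        (Set.Ioi 0 ×ˢ Set.Ioi 0)) ∧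
    R.averageRate P b =
      ∑ l : N.Band with b ∈ N.lessees l,
        ∫ p, (∫ t in Set.Ioi (0 : ℝ), (R.sinrLaw P l b p).real {γ | t < Real.log (1 + γ)})
          ∂(R.powerLaw P l) ∧
    R.averageRate P b =
      ∑ l : N.Band with b ∈ N.lessees l,
        ∫ t in Set.Ioi (0 : ℝ), ∫ z in Set.Ioi (0 : ℝ),
          R.coverageIntegrand P l b (Real.exp t - 1) z := by
  have hlog : Measurable fun γ : ℝ => Real.log (1 + γ) := by fun_prop
  refine ⟨fun l hb => ⟨hR.aemeasurable_sinr hb, hR.integrable_log_sinr hb,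
    hR.integrable_refPow_rpow l, hR.integrableOn_coverageIntegrand⟩, ?_, ?_⟩
  · refine Finset.sum_congr rfl fun l hl => ?_
    have hb := (Finset.mem_filter.1 hl).2
    exact SpectrumSharing.integral_condDistrib_eq_integral_meas_lt
      (hR.measurable_powers l).aemeasurable (hR.aemeasurable_sinr hb) hlog
      (hR.integrable_log_sinr hb) (hR.ae_log_sinr_nonneg hb)
  · refine Finset.sum_congr rfl fun l hl => ?_
    have hb := (Finset.mem_filter.1 hl).2
    exact (SpectrumSharing.integral_condDistrib_comp (hR.measurable_powers l).aemeasurable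
      (hR.aemeasurable_sinr hb) hlog (hR.integrable_log_sinr hb)).trans (hR.integral_log_sinr hb)
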